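/- Let $n\ge 2$, let $G=\mathrm{SO}(n,1)^\circ$ be the identity component of the special orthogonal group of $x_1^2+\dots+x_n^2-x_{n+1}^2$, let $\|\cdot\|$ be any norm on $M_{n+1}(\mathbb R)$, and let $G_T=\{g\in G:\|g\|\le T\}$. Let $K=\begin{bmatrix}\mathrm{SO}(n)&\\&1\end{bmatrix}$ with Haar probability measure $dk$, and for integers $i,j\ge 0$ with $i+j=n-1$ let $$H_{i,j}=\begin{bmatrix}\mathrm{SO}(i+1)&\\&\mathrm{SO}(j,1)^\circ\end{bmatrix},$$ where $\mathrm{SO}(1)$ and $\mathrm{SO}(0,1)^\circ$ are trivial. For $s\in\mathbb R$ and $\mathbf x\in\mathbb R^{n-1}$ (a row vector) put $$a(s)=\begin{bmatrix}\cosh s&\mathbf 0&\sinh s\\ \mathbf 0&I_{n-1}&\mathbf 0\\ \sinh s&\mathbf 0&\cosh s\end{bmatrix},\qquad u(\mathbf x)=\begin{bmatrix}1-\frac{\|\mathbf x\|^2}{2}&\mathbf x&\frac{\|\mathbf x\|^2}{2}\\-\mathbf x^{\intercal}&I_{n-1}&\mathbf x^{\intercal}\\-\frac{\|\mathbf x\|^2}{2}&\mathbf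 x&1+\frac{\|\mathbf x\|^2}{2}\end{bmatrix},$$ where $\|\mathbf x\|$ is the Euclidean norm, and $$a(\pm\infty)=\begin{bmatrix}\frac12&\mathbf 0&\pm\frac12\\ \mathbf 0&\mathbf 0&\mathbf 0\\ \pm\frac12&\mathbf 0&\frac12\end{bmatrix},\qquad w=\begin{bmatrix}-I_2&\\&I_{n-1}\end{bmatrix}.$$ Fix a Haar measure $dg$ on $G$ and write $\mathrm{Vol}$ for it. Then $\mathrm{Vol}(G_T)<\infty$ for all $T$, and the following hold. 1. There is a Haar measure $dh$ on $H=H_{0,n-1}$ such that, for all Borel $f:G\to[0,\infty]$, $$\int_G f\,dg=\int_K\int_H\int_0^\infty\bigl(f(ka(s)h)+f(ka(s)wh)\bigr)\cosh(s)^{n-1}\,ds\,dh\,dk ,$$ and for every such $dh$, $$\lim_{T\to\infty}\frac{\mathrm{Vol}(G_T)}{T^{n-1}}=\frac{1}{(n-1)2^{n-1}}\int_K\int_H\left(\frac{1}{\|ka(\infty)h\|^{n-1}}+\frac{1}{\|ka(-\infty)h\|^{n-1}}\right)dh\,dk .$$ 2. Let $i+j=n-1$ with $i\neq 0$. There is a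 Haar measure $dh$ on $H=H_{i,j}$ such that, for all Borel $f:G\to[0,\infty]$, $$\int_G f\,dg=\int_K\int_H\int_0^\infty f(ka(s)h)\sinh(s)^i\cosh(s)^j\,ds\,dh\,dk ,$$ and for every such $dh$, $$\lim_{T\to\infty}\frac{\mathrm{Vol}(G_T)}{T^{n-1}}=\frac{1}{(n-1)2^{n-1}}\int_K\int_H\frac{1}{\|ka(\infty)h\|^{n-1}}\,dh\,dk .$$ 3. There is a Haar measure $d\mathbf x$ on $\mathbb R^{n-1}$ such that, for all Borel $f:G\to[0,\infty]$, $$\int_G f\,dg=\int_K\int_{\mathbb R^{n-1}}\int_{-\infty}^\infty f(ka(s)u(\mathbf x))\,e^{(n-1)s}\,ds\,d\mathbf x\,dk ,$$ and for every such $d\mathbf x$, $$\lim_{T\to\infty}\frac{\mathrm{Vol}(G_T)}{T^{n-1}}=\frac{1}{n-1}\int_K\int_{\mathbb R^{n-1}}\frac{1}{\|ka(\infty)u(\mathbf x)\|^{n-1}}\,d\mathbf x\,dk .$$ In each case the integral on the right converges absolutely (the integrand is integrable for the product measure). -/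

import Mathlib

open MeasureTheory Filter Topology Matrix
open scoped ENNReal

noncomputable section

namespace HypVol

/-- Real square matrices of size `n + 1`. -/
abbrev Mat (n : ℕ) : Type := Matrix (Fin (n + 1)) (Fin (n + 1)) ℝ

/-- Spaces of real matrices carry their Borel σ-algebra. -/
instance instMeasurableSpaceMat (n : ℕ) : MeasurableSpace (Mat n) := borel _

instance instBorelSpaceMat (n : ℕ) : BorelSpace (Mat n) := ⟨rfl⟩

/-- Real special linear groups carry their Borel σ-algebra; subgroups inherit it. -/
instance instMeasurableSpaceSL (m : ℕ) :
    MeasurableSpace (SpecialLinearGroup (Fin m) ℝ) := borel _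

instance instBorelSpaceSL (m : ℕ) : BorelSpace (SpecialLinearGroup (Fin m) ℝ) := ⟨rfl⟩

/-- The special orthogonal group `{g ∈ SL : gᵀ B g = B}` of the form with Gram matrix `B`. -/
def formGroup {ι : Type*} [Fintype ι] [DecidableEq ι] (B : Matrix ι ι ℝ) :
    Subgroup (SpecialLinearGroup ι ℝ) where
  carrier := {g | (g : Matrix ι ι ℝ)ᵀ * B * (g : Matrix ι ι ℝ) = B}
  one_mem' := by
    change ((1 : SpecialLinearGroup ι ℝ) : Matrix ι ι ℝ)ᵀ * B * (1 : SpecialLinearGroup ι ℝ) = B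
    simp
  mul_mem' := by
    intro g h hg hh
    change (g : Matrix ι ι ℝ)ᵀ * B * (g : Matrix ι ι ℝ) = B at hg
    change (h : Matrix ι ι ℝ)ᵀ * B * (h : Matrix ι ι ℝ) = B at hh
    change ((g : Matrix ι ι ℝ) * (h : Matrix ι ι ℝ))ᵀ * B *
      ((g : Matrix ι ι ℝ) * (h : Matrix ι ι ℝ)) = B
    rw [transpose_mul]
    calc (h : Matrix ι ι ℝ)ᵀ * (g : Matrix ι ι ℝ)ᵀ * B * ((g : Matrix ι ι ℝ) * h)
        = (h : Matrix ι ι ℝ)ᵀ * ((g : Matrix ι ι ℝ)ᵀ * B * g) * h := by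
          simp only [Matrix.mul_assoc]
      _ = B := by rw [hg, hh]
  inv_mem' := by
    intro g hg
    change (g : Matrix ι ι ℝ)ᵀ * B * (g : Matrix ι ι ℝ) = B at hg
    change ((g⁻¹ : SpecialLinearGroup ι ℝ) : Matrix ι ι ℝ)ᵀ * B *
      ((g⁻¹ : SpecialLinearGroup ι ℝ) : Matrix ι ι ℝ) = B
    have h1 : (g : Matrix ι ι ℝ) * ((g⁻¹ : SpecialLinearGroup ι ℝ) : Matrix ι ι ℝ) = 1 :=
      congrArg Subtype.val (mul_inv_cancel g)
    have h2 : ((g⁻¹ : SpecialLinearGroup ι ℝ) : Matrix ι ι ℝ)ᵀ * (g : Matrix ι ι ℝ)ᵀ = 1 := by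
      rw [← transpose_mul, h1, transpose_one]
    generalize ((g⁻¹ : SpecialLinearGroup ι ℝ) : Matrix ι ι ℝ) = C at *
    calc Cᵀ * B * C = Cᵀ * ((g : Matrix ι ι ℝ)ᵀ * B * g) * C := by rw [hg]
      _ = (Cᵀ * (g : Matrix ι ι ℝ)ᵀ) * B * (g * C) := by simp only [Matrix.mul_assoc]
      _ = B := by rw [h1, h2, Matrix.one_mul, Matrix.mul_one]

/-- `SO(m)`. -/
def SO (m : ℕ) : Subgroup (SpecialLinearGroup (Fin m) ℝ) := formGroup 1

/-- `SO(p,1)`, the special orthogonal group of `x₁² + ⋯ + x_p² - x_{p+1}²`. -/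
def SOLorentz (p : ℕ) : Subgroup (SpecialLinearGroup (Fin (p + 1)) ℝ) :=
  formGroup (Matrix.diagonal fun a => if a = Fin.last p then -1 else 1)

/-- `SO(p,1)°`, the identity component of `SO(p,1)`. It is trivial for `p = 0`. -/
def SOLorentz₀ (p : ℕ) : Subgroup (SpecialLinearGroup (Fin (p + 1)) ℝ) :=
  (Subgroup.connectedComponentOfOne (SOLorentz p)).map (SOLorentz p).subtype

/-- The block diagonal embedding `(c, d) ↦ diag(c, d)`. -/
def blockHom {p q m : ℕ} (h : p + q = m) :
    SpecialLinearGroup (Fin p) ℝ × SpecialLinearGroup (Fin q) ℝ →*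
      SpecialLinearGroup (Fin m) ℝ where
  toFun x :=
    ⟨Matrix.reindex (finSumFinEquiv.trans (finCongr h)) (finSumFinEquiv.trans (finCongr h))
      (Matrix.fromBlocks (x.1 : Matrix (Fin p) (Fin p) ℝ) 0 0 (x.2 : Matrix (Fin q) (Fin q) ℝ)),
      by rw [Matrix.det_reindex_self, Matrix.det_fromBlocks_zero₂₁, x.1.det_coe, x.2.det_coe,
        one_mul]⟩
  map_one' := by
    apply Subtype.ext
    change Matrix.reindex (finSumFinEquiv.trans (finCongr h)) (finSumFinEquiv.trans (finCongr h))
      (Matrix.fromBlocks (1 : Matrix (Fin p) (Fin p) ℝ) 0 0 (1 : Matrix (Fin q) (Fin q) ℝ)) =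
        (1 : Matrix (Fin m) (Fin m) ℝ)
    rw [Matrix.fromBlocks_one, Matrix.reindex_apply, Matrix.submatrix_one_equiv]
  map_mul' x y := by
    apply Subtype.ext
    change Matrix.reindex (finSumFinEquiv.trans (finCongr h)) (finSumFinEquiv.trans (finCongr h))
        (Matrix.fromBlocks ((x.1 : Matrix (Fin p) (Fin p) ℝ) * (y.1 : Matrix (Fin p) (Fin p) ℝ)) 0 0
          ((x.2 : Matrix (Fin q) (Fin q) ℝ) * (y.2 : Matrix (Fin q) (Fin q) ℝ))) =
      Matrix.reindex (finSumFinEquiv.trans (finCongr h)) (finSumFinEquiv.trans (finCongr h))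
        (Matrix.fromBlocks (x.1 : Matrix (Fin p) (Fin p) ℝ) 0 0
          (x.2 : Matrix (Fin q) (Fin q) ℝ)) *
      Matrix.reindex (finSumFinEquiv.trans (finCongr h)) (finSumFinEquiv.trans (finCongr h))
        (Matrix.fromBlocks (y.1 : Matrix (Fin p) (Fin p) ℝ) 0 0
          (y.2 : Matrix (Fin q) (Fin q) ℝ))
    rw [Matrix.reindex_apply, Matrix.reindex_apply, Matrix.reindex_apply,
      Matrix.submatrix_mul_equiv, Matrix.fromBlocks_multiply]
    simp only [Matrix.mul_zero, Matrix.zero_mul, add_zero, zero_add]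

/-- `G = SO(n,1)°`. -/
abbrev G (n : ℕ) : Subgroup (SpecialLinearGroup (Fin (n + 1)) ℝ) := SOLorentz₀ n

/-- `K = diag(SO(n), 1)`. -/
def K (n : ℕ) : Subgroup (SpecialLinearGroup (Fin (n + 1)) ℝ) :=
  ((SO n).prod ⊥).map (blockHom (q := 1) rfl)

/-- `H_{i,j} = diag(SO(i+1), SO(j,1)°)`, where `i + j = n - 1`. -/
def H {n i j : ℕ} (h : i + j + 1 = n) : Subgroup (SpecialLinearGroup (Fin (n + 1)) ℝ) :=
  ((SO (i + 1)).prod (SOLorentz₀ j)).map (blockHom (by omega))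

/-- The matrix of an element of a subgroup of `SL(n+1,ℝ)`. -/
abbrev mat {n : ℕ} {S : Subgroup (SpecialLinearGroup (Fin (n + 1)) ℝ)} (g : S) : Mat n :=
  ((g : SpecialLinearGroup (Fin (n + 1)) ℝ) : Mat n)

/-- The elementary matrix with entry `1` at `(p, q)`. -/
abbrev E {n : ℕ} (p q : Fin (n + 1)) : Mat n := Matrix.single p q 1

/-- `a(s)`: hyperbolic rotation in the first and last coordinate, that is
`exp (s (E₁,ₙ₊₁ + Eₙ₊₁,₁))`. -/
def a (n : ℕ) (s : ℝ) : Mat n :=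
  1 + (Real.cosh s - 1) • (E 0 0 + E (Fin.last n) (Fin.last n)) +
    Real.sinh s • (E 0 (Fin.last n) + E (Fin.last n) 0)

/-- `a(∞)`, the limit of `e^{-s} a(s)` as `s → ∞`. -/
def aInf (n : ℕ) : Mat n :=
  (1 / 2 : ℝ) • (E 0 0 + E 0 (Fin.last n) + E (Fin.last n) 0 + E (Fin.last n) (Fin.last n))

/-- `J = diag(-1, I_n)`. -/
def Jmat (n : ℕ) : Mat n := Matrix.diagonal fun p => if p = 0 then -1 else 1

/-- `a(-∞) = J a(∞) J`. -/
def aNegInf (n : ℕ) : Mat n := Jmat n * aInf n * Jmat n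

/-- `diag(-I₂, I_{n-1})`. -/
def wMat (n : ℕ) : Mat n := Matrix.diagonal fun p => if (p : ℕ) < 2 then -1 else 1

/-- The position in `Fin (n + 1)` of the `l`-th of the `n - 1` middle coordinates. -/
def mid {n : ℕ} (l : Fin (n - 1)) : Fin (n + 1) := ⟨l + 1, by omega⟩

/-- `u(x)`, that is `exp X` for the matrix `X` with rows `(0, x, 0)`, `(-xᵀ, 0, xᵀ)`, `(0, x, 0)`. -/
def u (n : ℕ) (x : EuclideanSpace ℝ (Fin (n - 1))) : Mat n :=
  1 + ∑ l, x l • (E 0 (mid l) - E (mid l) 0 + E (mid l) (Fin.last n) + E (Fin.last n) (mid l)) +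
    (‖x‖ ^ 2 / 2) • (-E 0 0 + E 0 (Fin.last n) - E (Fin.last n) 0 +
      E (Fin.last n) (Fin.last n))

/-- `G_T = {g ∈ G : ‖g‖ ≤ T}`. -/
def normBall {n : ℕ} (N : Seminorm ℝ (Mat n)) (T : ℝ) : Set (G n) := {g | N (mat g) ≤ T}

/-- The Haar measures `μ` on `G`, `κ` on `K` and `ν` on `H = H_{0,n-1}` are normalized compatibly:
`∫_G f = ∫_K ∫_H ∫_0^∞ (f(k a(s) h) + f(k a(s) diag(-I₂, I_{n-1}) h)) cosh(s)^{n-1} ds dh dk`.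
Nonnegative Borel functions on `G` are written as restrictions of such functions on the space
of matrices. -/
def DecompZero {n i j : ℕ} (h : i + j + 1 = n) (μ : Measure (G n)) (κ : Measure (K n))
    (ν : Measure (H h)) : Prop :=
  ∀ f : Mat n → ℝ≥0∞, Measurable f →
    ∫⁻ g, f (mat g) ∂μ =
      ∫⁻ k, ∫⁻ b, ∫⁻ s in Set.Ioi (0 : ℝ),
        (f (mat k * a n s * mat b) + f (mat k * a n s * wMat n * mat b)) *
          ENNReal.ofReal (Real.cosh s ^ (n - 1)) ∂volume ∂ν ∂κ

/-- Compatible normalization of `μ`, `κ` and `ν` on `H = H_{i,j}`, for `i ≠ 0`: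
`∫_G f = ∫_K ∫_H ∫_0^∞ f(k a(s) h) sinh(s)^i cosh(s)^j ds dh dk`. -/
def DecompPos {n i j : ℕ} (h : i + j + 1 = n) (μ : Measure (G n)) (κ : Measure (K n))
    (ν : Measure (H h)) : Prop :=
  ∀ f : Mat n → ℝ≥0∞, Measurable f →
    ∫⁻ g, f (mat g) ∂μ =
      ∫⁻ k, ∫⁻ b, ∫⁻ s in Set.Ioi (0 : ℝ),
        f (mat k * a n s * mat b) *
          ENNReal.ofReal (Real.sinh s ^ i * Real.cosh s ^ j) ∂volume ∂ν ∂κ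

/-- Compatible normalization of `μ`, `κ` and a Haar measure `ν` on `ℝ^{n-1} ≅ U`:
`∫_G f = ∫_K ∫_{ℝ^{n-1}} ∫_{-∞}^∞ f(k a(s) u(x)) e^{(n-1)s} ds dx dk`. -/
def DecompU {n : ℕ} (μ : Measure (G n)) (κ : Measure (K n))
    (ν : Measure (EuclideanSpace ℝ (Fin (n - 1)))) : Prop :=
  ∀ f : Mat n → ℝ≥0∞, Measurable f →
    ∫⁻ g, f (mat g) ∂μ =
      ∫⁻ k, ∫⁻ x, ∫⁻ s,
        f (mat k * a n s * u n x) *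
          ENNReal.ofReal (Real.exp (((n : ℝ) - 1) * s)) ∂volume ∂ν ∂κ

end HypVol

end

open MeasureTheory Filter Topology Matrix
open scoped ENNReal

noncomputable section

namespace HypVol

/-! ### Topology of the matrix groups -/

/-! `G` acts on row vectors from the right, and the last row of `g` is a point of the upper sheet of
the hyperboloid. This identifies `K\G` with hyperbolic space, parametrized by the first `n`
coordinates `row g`. Every `g` is an element of `K` times the boost to the point `row g`.

Haar measure. The measure `dx / √(1 + ‖x‖²)` is invariant under `G`, because Lebesgue measure on the
future cone is invariant under determinant-one maps and splits radially (`lintegral_hyp_row_mul`).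
Its product with `κ`, carried to `G`, is the right invariant measure `lam κ`. The group is
unimodular: the modular character is trivial on `K`, and on a boost it equals its own inverse since
the Cartan involution inverts boosts (`modularCharacterFun_G`). Hence `lam κ` is a Haar measure and
every Haar measure on `G` is a multiple of it.

Integration formulas. Integrating over `K` first leaves a function of the last row only
(`lintegral_K_family`). Each formula then becomes a coordinate system on hyperbolic space:
horospherical coordinates for `u(x)`, polar coordinates with hyperbolic fibres for `i ≠ 0`, and
signed distance from a hyperplane for `i = 0`. In the last case the element `w` supplies the
negative side. The Haar measure on `H` is again a product of one on `SO(i+1)` and `lam` on the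
Lorentz factor.

Asymptotics. Fix `k` and `h` and put `L = N(k a(∞) h)`. Since `e^{-s} a(s)` tends to `a(∞)`, the
condition `N(k a(s) h) ≤ T` becomes `e^s L ≤ T` in the limit. After the shift `s = t + log T`, a
weight asymptotic to `W e^{ds}` gives `W / (d L^d)`, where `d = n - 1`. Domination on the fibre
comes from the exact relation `a(∞) a(s) = e^s a(∞)` and compactness of `K`, which give `N(k a(s) h)
≥ c e^s L` uniformly (`exists_mul_exp_le`).

To integrate over `k` and `h` one needs `1 / L^d` to be integrable. A direct volume bound `Vol(G_T)
= O(T^d)`, read off from the last row (`exists_measure_normBall_le`), yields this through Fatou's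
lemma. The fibre bound is a multiple of `1 / L^d`, so dominated convergence applies a second time
(`sublevel_asymptotics`). -/

instance instSecondCountableTopologyMatrix (m : ℕ) :
    SecondCountableTopology (Matrix (Fin m) (Fin m) ℝ) :=
  inferInstanceAs (SecondCountableTopology (Fin m → Fin m → ℝ))

instance instSecondCountableTopologySL (m : ℕ) :
    SecondCountableTopology (SpecialLinearGroup (Fin m) ℝ) :=
  SpecialLinearGroup.isClosedEmbedding_val.isEmbedding.secondCountableTopology

instance instSecondCountableTopologySubgroup {m : ℕ}
    (S : Subgroup (SpecialLinearGroup (Fin m) ℝ)) : SecondCountableTopology S :=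
  TopologicalSpace.Subtype.secondCountableTopology (S : Set (SpecialLinearGroup (Fin m) ℝ))

lemma continuous_val_SL (m : ℕ) :
    Continuous (fun g : SpecialLinearGroup (Fin m) ℝ => (g : Matrix (Fin m) (Fin m) ℝ)) :=
  continuous_subtype_val

lemma continuous_mat {n : ℕ} {S : Subgroup (SpecialLinearGroup (Fin (n + 1)) ℝ)} :
    Continuous (fun g : S => mat g) :=
  (continuous_val_SL _).comp continuous_subtype_val

lemma measurable_mat {n : ℕ} {S : Subgroup (SpecialLinearGroup (Fin (n + 1)) ℝ)} :
    Measurable (fun g : S => mat g) :=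
  continuous_mat.measurable

lemma isEmbedding_mat {n : ℕ} {S : Subgroup (SpecialLinearGroup (Fin (n + 1)) ℝ)} :
    IsEmbedding (fun g : S => mat g) :=
  (SpecialLinearGroup.isClosedEmbedding_val.isEmbedding).comp IsEmbedding.subtypeVal

lemma mat_injective {n : ℕ} {S : Subgroup (SpecialLinearGroup (Fin (n + 1)) ℝ)} :
    Function.Injective (fun g : S => mat g) :=
  isEmbedding_mat.injective

@[simp] lemma mat_mul {n : ℕ} {S : Subgroup (SpecialLinearGroup (Fin (n + 1)) ℝ)} (g h : S) :
    mat (g * h) = mat g * mat h := by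
  simp [mat]

@[simp] lemma mat_one {n : ℕ} {S : Subgroup (SpecialLinearGroup (Fin (n + 1)) ℝ)} :
    mat (1 : S) = 1 := by
  simp [mat]

/-! ### The Lorentz form -/

/-- The Gram matrix of the form `x₁² + ⋯ + x_p² - x_{p+1}²`. -/
def gram (p : ℕ) : Mat p := Matrix.diagonal fun a => if a = Fin.last p then -1 else 1

lemma mem_SOLorentz {p : ℕ} {g : SpecialLinearGroup (Fin (p + 1)) ℝ} :
    g ∈ SOLorentz p ↔ (g : Mat p)ᵀ * gram p * (g : Mat p) = gram p := Iff.rfl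

lemma mem_SO {m : ℕ} {g : SpecialLinearGroup (Fin m) ℝ} :
    g ∈ SO m ↔ (g : Matrix (Fin m) (Fin m) ℝ)ᵀ * (g : Matrix (Fin m) (Fin m) ℝ) = 1 := by
  change (g : Matrix (Fin m) (Fin m) ℝ)ᵀ * 1 * (g : Matrix (Fin m) (Fin m) ℝ) = 1 ↔ _
  rw [Matrix.mul_one]

@[simp] lemma gram_mul_gram (p : ℕ) : gram p * gram p = 1 := by
  rw [gram, Matrix.diagonal_mul_diagonal, ← Matrix.diagonal_one]
  congr 1
  ext a
  by_cases h : a = Fin.last p <;> simp [h]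

@[simp] lemma gram_transpose (p : ℕ) : (gram p)ᵀ = gram p := by
  rw [gram, Matrix.diagonal_transpose]

lemma det_gram_ne_zero (p : ℕ) : (gram p).det ≠ 0 := by
  intro h
  have := congrArg Matrix.det (gram_mul_gram p)
  rw [Matrix.det_mul, h] at this
  simp at this

lemma SOLorentz₀_le (p : ℕ) : SOLorentz₀ p ≤ SOLorentz p := by
  rintro _ ⟨g, -, rfl⟩
  exact g.2

lemma mat_transpose_mul_gram_mul {p : ℕ} (g : G p) : (mat g)ᵀ * gram p * mat g = gram p :=
  mem_SOLorentz.1 (SOLorentz₀_le p g.2)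

/-- The transposed relation `g B gᵀ = B`. -/
lemma mul_gram_mul_transpose_of {p : ℕ} {A : Mat p} (hA : Aᵀ * gram p * A = gram p) :
    A * gram p * Aᵀ = gram p := by
  have h1 : (gram p * Aᵀ * gram p) * A = 1 := by
    rw [Matrix.mul_assoc (gram p), Matrix.mul_assoc (gram p), hA, gram_mul_gram]
  have h2 := mul_eq_one_comm.1 h1
  calc A * gram p * Aᵀ = A * (gram p * Aᵀ * gram p) * gram p := by
        simp only [Matrix.mul_assoc, gram_mul_gram, Matrix.mul_one]
    _ = gram p := by rw [h2, Matrix.one_mul]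

lemma mat_mul_gram_mul_transpose {p : ℕ} (g : G p) : mat g * gram p * (mat g)ᵀ = gram p :=
  mul_gram_mul_transpose_of (mat_transpose_mul_gram_mul g)

lemma isPreconnected_SOLorentz₀ (p : ℕ) :
    IsPreconnected (SOLorentz₀ p : Set (SpecialLinearGroup (Fin (p + 1)) ℝ)) := by
  have : (SOLorentz₀ p : Set (SpecialLinearGroup (Fin (p + 1)) ℝ)) =
      (SOLorentz p).subtype '' (connectedComponent (1 : SOLorentz p)) := rfl
  rw [this]
  exact isPreconnected_connectedComponent.image _ continuous_subtype_val.continuousOn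

instance instPreconnectedSpaceG (p : ℕ) : PreconnectedSpace (G p) :=
  isPreconnected_iff_preconnectedSpace.1 (isPreconnected_SOLorentz₀ p)

/-- A connected family of form-preserving elements through `1` lies in the identity component. -/
lemma mem_SOLorentz₀_of_preconnected {p : ℕ} {X : Type*} [TopologicalSpace X] [PreconnectedSpace X]
    (φ : X → SpecialLinearGroup (Fin (p + 1)) ℝ) (hφ : Continuous φ)
    (hmem : ∀ x, φ x ∈ SOLorentz p) (x₀ : X) (h₀ : φ x₀ = 1) (x : X) : φ x ∈ SOLorentz₀ p := by
  let ψ : X → SOLorentz p := fun x => ⟨φ x, hmem x⟩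
  have hψ : Continuous ψ := hφ.subtype_mk _
  have h1 : (1 : SOLorentz p) ∈ Set.range ψ := ⟨x₀, Subtype.ext h₀⟩
  have := (isPreconnected_range hψ).subset_connectedComponent h1 (Set.mem_range_self x)
  exact ⟨ψ x, this, rfl⟩

/-- A connected family of form-preserving matrices through `1` lies in the identity component. -/
lemma exists_mat_eq_of_preconnected {p : ℕ} {X : Type*} [TopologicalSpace X] [PreconnectedSpace X]
    (φ : X → Mat p) (hφ : Continuous φ) (hmem : ∀ x, (φ x)ᵀ * gram p * φ x = gram p)
    (x₀ : X) (h₀ : φ x₀ = 1) (x : X) : ∃ g : G p, mat g = φ x := by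
  -- Determinants of the relation give `det² = 1`. By connectedness, a value `-1` together with the
  -- value `1` at `x₀` would force a zero in between.
  have hsq : ∀ x, (φ x).det = 1 ∨ (φ x).det = -1 := by
    intro x
    have := congrArg Matrix.det (hmem x)
    rw [Matrix.det_mul, Matrix.det_mul, Matrix.det_transpose] at this
    have h2 : ((φ x).det - 1) * ((φ x).det + 1) = 0 := by
      have h3 : (gram p).det * (((φ x).det - 1) * ((φ x).det + 1)) = 0 := by linear_combination this
      exact (mul_eq_zero.1 h3).resolve_left (det_gram_ne_zero p)
    rcases mul_eq_zero.1 h2 with h | h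
    · left; linarith
    · right; linarith
  have hdet : ∀ x, (φ x).det = 1 := by
    intro x
    by_contra hne
    have hx : (φ x).det = -1 := (hsq x).resolve_left hne
    have hc : Continuous fun x => (φ x).det := hφ.matrix_det
    have := (isPreconnected_range hc).ordConnected.out ⟨x, rfl⟩ ⟨x₀, rfl⟩
    have h0 : (0 : ℝ) ∈ Set.Icc ((φ x).det) ((φ x₀).det) := by
      rw [hx, h₀, Matrix.det_one]; constructor <;> norm_num
    obtain ⟨y, hy⟩ := this h0
    rcases hsq y with h | h <;> simp [h] at hy
  have hmem' := mem_SOLorentz₀_of_preconnected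
    (fun x => (⟨φ x, hdet x⟩ : SpecialLinearGroup (Fin (p + 1)) ℝ))
    (hφ.subtype_mk _) (fun x => mem_SOLorentz.2 (hmem x)) x₀ (Subtype.ext h₀) x
  exact ⟨⟨_, hmem'⟩, rfl⟩

/-! ### Special orthogonal groups -/

/-- The matrix of the reflection in the hyperplane orthogonal to `v` (the identity for `v = 0`). -/
def refl {p : ℕ} (v : Fin p → ℝ) : Matrix (Fin p) (Fin p) ℝ :=
  1 - (2 / (v ⬝ᵥ v)) • Matrix.vecMulVec v v

lemma refl_transpose {p : ℕ} (v : Fin p → ℝ) : (refl v)ᵀ = refl v := by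
  rw [refl, Matrix.transpose_sub, Matrix.transpose_smul, Matrix.transpose_one,
    Matrix.transpose_vecMulVec]

lemma refl_mul_refl {p : ℕ} (v : Fin p → ℝ) : refl v * refl v = 1 := by
  by_cases hv : v ⬝ᵥ v = 0
  · simp [refl, hv]
  · have h1 : Matrix.vecMulVec v v * Matrix.vecMulVec v v = (v ⬝ᵥ v) • Matrix.vecMulVec v v := by
      rw [Matrix.vecMulVec_mul_vecMulVec, Matrix.vecMulVec_smul]
    simp only [refl, Matrix.sub_mul, Matrix.mul_sub, Matrix.one_mul, Matrix.mul_one,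
      Matrix.smul_mul, Matrix.mul_smul, h1, smul_smul]
    have h2 : 2 / (v ⬝ᵥ v) * (2 / (v ⬝ᵥ v)) * (v ⬝ᵥ v) = 2 * (2 / (v ⬝ᵥ v)) := by
      field_simp
    linear_combination (norm := module) h2 • Matrix.vecMulVec v v

lemma vecMul_refl {p : ℕ} (x v : Fin p → ℝ) :
    x ᵥ* refl v = x - (2 * (x ⬝ᵥ v) / (v ⬝ᵥ v)) • v := by
  rw [refl, Matrix.vecMul_sub, Matrix.vecMul_one, Matrix.vecMul_smul, Matrix.vecMul_vecMulVec,
    smul_smul]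
  congr 2
  ring

lemma dotProduct_self_ne_zero {p : ℕ} {v : Fin p → ℝ} (hv : v ≠ 0) : v ⬝ᵥ v ≠ 0 :=
  fun h => hv (dotProduct_self_eq_zero.1 h)

lemma continuousOn_refl (p : ℕ) : ContinuousOn (refl (p := p)) {0}ᶜ := by
  unfold refl
  refine continuousOn_const.sub (ContinuousOn.fun_smul ?_ ?_)
  · refine continuousOn_const.div ?_ fun v hv => dotProduct_self_ne_zero hv
    exact (Continuous.dotProduct continuous_id continuous_id).continuousOn
  · exact (Continuous.matrix_vecMulVec continuous_id continuous_id).continuousOn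

/-- A rank-one perturbation of the identity: the determinant is `1` plus a dot product, here `1 -
2`. -/
lemma det_refl {p : ℕ} {v : Fin p → ℝ} (hv : v ≠ 0) : (refl v).det = -1 := by
  have h : refl v = 1 + Matrix.replicateCol Unit (-(2 / (v ⬝ᵥ v)) • v) *
      Matrix.replicateRow Unit v := by
    rw [← Matrix.vecMulVec_eq, Matrix.smul_vecMulVec, neg_smul, refl, sub_eq_add_neg]
  rw [h, Matrix.det_one_add_replicateCol_mul_replicateRow, dotProduct_smul, smul_eq_mul]
  have := dotProduct_self_ne_zero hv
  field_simp
  norm_num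

/-- Every orthogonal matrix is a product of reflections. -/
lemma exists_list_refl {p : ℕ} (d : ℕ) (A : Matrix (Fin p) (Fin p) ℝ) (hA : A * Aᵀ = 1)
    (hfix : ∀ q : Fin p, (q : ℕ) + d < p → Pi.single q 1 ᵥ* A = Pi.single q 1) :
    ∃ l : List (Fin p → ℝ), (∀ v ∈ l, v ≠ 0) ∧ A = (l.map refl).prod := by
  -- The number `d` counts the last basis vectors that `A` may still move. If the first of them,
  -- `e`, goes to `eA ≠ e`, the reflection along `eA - e` brings it back without disturbing the
  -- vectors already fixed.
  induction d generalizing A with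
  | zero =>
    refine ⟨[], by simp, ?_⟩
    ext q r
    have := congrFun (hfix q (by simp)) r
    rw [Matrix.single_one_vecMul] at this
    simpa [Matrix.one_apply, Pi.single_apply, eq_comm] using this
  | succ d ih =>
    by_cases hd : d + 1 ≤ p
    swap
    · exact ih A hA fun q hq => hfix q (by omega)
    let q₀ : Fin p := ⟨p - (d + 1), by omega⟩
    let e : Fin p → ℝ := Pi.single q₀ 1
    by_cases hx : e ᵥ* A = e
    · refine ih A hA fun q hq => ?_
      rcases Nat.lt_or_ge (q + (d + 1)) p with h | h
      · exact hfix q h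
      · have : q = q₀ := Fin.ext (by simp only [q₀]; omega)
        rw [this]; exact hx
    · have hv : e ᵥ* A - e ≠ 0 := sub_ne_zero.2 hx
      have hdot : ∀ y z : Fin p → ℝ, (y ᵥ* A) ⬝ᵥ (z ᵥ* A) = y ⬝ᵥ z := by
        intro y z
        rw [← Matrix.mulVec_transpose A z, Matrix.dotProduct_mulVec, Matrix.vecMul_vecMul, hA,
          Matrix.vecMul_one]
      have hA' : (A * refl (e ᵥ* A - e)) * (A * refl (e ᵥ* A - e))ᵀ = 1 := by
        rw [Matrix.transpose_mul, refl_transpose, Matrix.mul_assoc, ← Matrix.mul_assoc (refl _),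
          refl_mul_refl, Matrix.one_mul, hA]
      obtain ⟨l, hl, hprod⟩ := ih (A * refl (e ᵥ* A - e)) hA' (by
        intro q hq
        rw [← Matrix.vecMul_vecMul, vecMul_refl]
        rcases Nat.lt_or_ge (q + (d + 1)) p with h | h
        · have hne : q ≠ q₀ := by
            intro h'
            rw [h'] at h
            simp only [q₀] at h
            omega
          have h1 : (Pi.single q (1 : ℝ) : Fin p → ℝ) ⬝ᵥ e = 0 := by
            simp [e, hne]
          -- A vector fixed by `A` has the same product with `eA` as with `e`, so it is orthogonal
          -- to `eA - e`.
          have h2 : (Pi.single q 1 ᵥ* A) ⬝ᵥ (e ᵥ* A - e) = 0 := by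
            rw [dotProduct_sub, hdot, hfix q h, h1, sub_zero]
          rw [h2, hfix q h]
          simp
        · have hq0 : q = q₀ := Fin.ext (by simp only [q₀]; omega)
          rw [hq0]
          change e ᵥ* A - _ = e
          have hee : (e ᵥ* A) ⬝ᵥ (e ᵥ* A) = e ⬝ᵥ e := hdot e e
          -- As `eA` and `e` have equal length, the coefficient of the reflection is `1`, and `eA`
          -- goes to `eA - (eA - e) = e`.
          have h3 : 2 * ((e ᵥ* A) ⬝ᵥ (e ᵥ* A - e)) =
              (e ᵥ* A - e) ⬝ᵥ (e ᵥ* A - e) := by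
            simp only [dotProduct_sub, sub_dotProduct, hee]
            rw [dotProduct_comm e (e ᵥ* A)]
            ring
          rw [h3, div_self (dotProduct_self_ne_zero hv), one_smul, sub_sub_cancel])
      refine ⟨l ++ [e ᵥ* A - e], ?_, ?_⟩
      · intro v hv'
        rcases List.mem_append.1 hv' with h | h
        · exact hl v h
        · rw [List.mem_singleton.1 h]; exact hv
      · rw [List.map_append, List.prod_append, ← hprod, List.map_singleton, List.prod_singleton,
          Matrix.mul_assoc, refl_mul_refl, Matrix.mul_one]

lemma det_prod_refl {p : ℕ} (l : List (Fin p → ℝ)) (hl : ∀ v ∈ l, v ≠ 0) :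
    ((l.map refl).prod).det = (-1) ^ l.length := by
  induction l with
  | nil => simp
  | cons v l ih =>
    rw [List.map_cons, List.prod_cons, Matrix.det_mul, det_refl (hl v (by simp)),
      ih fun w hw => hl w (by simp [hw]), List.length_cons, pow_succ']

/-- The product of two reflections as an element of `SO p`. -/
def reflPair {p : ℕ} (w v : {v : Fin p → ℝ // v ≠ 0}) : SO p :=
  ⟨⟨refl w.1 * refl v.1, by rw [Matrix.det_mul, det_refl w.2, det_refl v.2]; norm_num⟩,
    mem_SO.2 (by
      change (refl w.1 * refl v.1)ᵀ * (refl w.1 * refl v.1) = 1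
      rw [Matrix.transpose_mul, refl_transpose, refl_transpose, Matrix.mul_assoc,
        ← Matrix.mul_assoc (refl w.1), refl_mul_refl, Matrix.one_mul, refl_mul_refl])⟩

/-- The nonzero vectors form a connected set in dimension at least two. Moving `w` to `v` there
deforms the pair to `refl v * refl v = 1`. -/
lemma reflPair_mem {p : ℕ} (hp : 2 ≤ p) (w v : {v : Fin p → ℝ // v ≠ 0}) :
    reflPair w v ∈ Subgroup.connectedComponentOfOne (SO p) := by
  have hconn : IsPreconnected ({0}ᶜ : Set (Fin p → ℝ)) := by
    refine (isConnected_compl_singleton_of_one_lt_rank ?_ 0).isPreconnected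
    rw [rank_fin_fun]
    exact_mod_cast hp
  have : PreconnectedSpace {v : Fin p → ℝ // v ≠ 0} :=
    isPreconnected_iff_preconnectedSpace.1 hconn
  have hc : Continuous fun w : {v : Fin p → ℝ // v ≠ 0} => reflPair w v := by
    refine Continuous.subtype_mk (Continuous.subtype_mk ?_ _) _
    refine Continuous.matrix_mul ?_ continuous_const
    exact (continuousOn_iff_continuous_domRestrict.1 (continuousOn_refl p))
  have h1 : (1 : SO p) ∈ Set.range fun w : {v : Fin p → ℝ // v ≠ 0} => reflPair w v := by
    refine ⟨v, Subtype.ext (Subtype.ext ?_)⟩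
    exact refl_mul_refl v.1
  exact (isPreconnected_range hc).subset_connectedComponent h1 (Set.mem_range_self w)

lemma exists_mem_component_of_even {p : ℕ} (hp : 2 ≤ p) :
    ∀ l : List (Fin p → ℝ), (∀ v ∈ l, v ≠ 0) → Even l.length →
      ∃ g ∈ Subgroup.connectedComponentOfOne (SO p),
        ((g : SpecialLinearGroup (Fin p) ℝ) : Matrix (Fin p) (Fin p) ℝ) = (l.map refl).prod
  | [], _, _ => ⟨1, one_mem _, by simp⟩
  | [_], _, h => by simp at h
  | w :: v :: l, hl, h => by
    have hev : Even l.length := by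
      simp only [List.length_cons] at h
      rw [Nat.even_iff] at h ⊢
      omega
    obtain ⟨g, hg, hgl⟩ := exists_mem_component_of_even hp l (fun x hx => hl x (by simp [hx])) hev
    refine ⟨reflPair ⟨w, hl w (by simp)⟩ ⟨v, hl v (by simp)⟩ * g,
      mul_mem (reflPair_mem hp _ _) hg, ?_⟩
    rw [List.map_cons, List.map_cons, List.prod_cons, List.prod_cons, ← hgl, ← Matrix.mul_assoc]
    rfl

lemma subsingleton_SO {p : ℕ} (hp : p < 2) : Subsingleton (SO p) := by
  refine ⟨fun g h => Subtype.ext (Subtype.ext ?_)⟩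
  have hg := g.1.2
  have hh := h.1.2
  interval_cases p
  · ext a; exact a.elim0
  · rw [Matrix.det_fin_one] at hg hh
    ext a b
    rw [Subsingleton.elim a 0, Subsingleton.elim b 0, hg, hh]

/-- Determinant one forces an even number of reflections, and pairs of reflections lie in the
identity component. Connectedness is what places `K` and `H` inside the identity component `G`. -/
instance instPreconnectedSpaceSO (p : ℕ) : PreconnectedSpace (SO p) := by
  rcases Nat.lt_or_ge p 2 with hp | hp
  · have := subsingleton_SO hp
    infer_instance
  have key : ∀ g : SO p, g ∈ connectedComponent (1 : SO p) := by
    intro g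
    have hg := mem_SO.1 g.2
    obtain ⟨l, hl, hprod⟩ := exists_list_refl p
      ((g : SpecialLinearGroup (Fin p) ℝ) : Matrix (Fin p) (Fin p) ℝ) (mul_eq_one_comm.1 hg)
      (fun q hq => by omega)
    have hdet := det_prod_refl l hl
    rw [← hprod, g.1.2] at hdet
    have hev : Even l.length := by
      by_contra h
      rw [(Nat.not_even_iff_odd.1 h).neg_one_pow] at hdet
      norm_num at hdet
    obtain ⟨g', hg', h⟩ := exists_mem_component_of_even hp l hl hev
    have : g = g' := Subtype.ext (Subtype.ext (hprod.trans h.symm))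
    rw [this]
    exact hg'
  refine ⟨?_⟩
  have : (Set.univ : Set (SO p)) = connectedComponent 1 := by
    ext g; simp [key g]
  rw [this]
  exact isPreconnected_connectedComponent

lemma isCompact_orthogonal (p : ℕ) :
    IsCompact {A : Matrix (Fin p) (Fin p) ℝ | Aᵀ * A = 1} := by
  have hbox : IsCompact (Set.univ.pi fun _ : Fin p => Set.univ.pi fun _ : Fin p =>
      Set.Icc (-1 : ℝ) 1) :=
    isCompact_univ_pi fun _ => isCompact_univ_pi fun _ => isCompact_Icc
  refine hbox.of_isClosed_subset ?_ ?_
  · exact isClosed_eq (by fun_prop) continuous_const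
  · intro (A : Matrix (Fin p) (Fin p) ℝ) hA a _ b _
    have h : (Aᵀ * A) b b = 1 := by
      rw [show Aᵀ * A = 1 from hA, Matrix.one_apply_eq]
    rw [Matrix.mul_apply] at h
    have h2 : A a b ^ 2 ≤ 1 := by
      rw [← h]
      have := Finset.single_le_sum (f := fun c => Aᵀ b c * A c b)
        (fun c _ => by rw [Matrix.transpose_apply]; exact mul_self_nonneg _) (Finset.mem_univ a)
      simpa [Matrix.transpose_apply, sq] using this
    exact abs_le.1 (sq_le_one_iff_abs_le_one _ |>.1 h2)

instance instCompactSpaceSO (p : ℕ) : CompactSpace (SO p) := by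
  refine isCompact_iff_compactSpace.1 ?_
  have : (SO p : Set (SpecialLinearGroup (Fin p) ℝ)) =
      (fun g : SpecialLinearGroup (Fin p) ℝ => (g : Matrix (Fin p) (Fin p) ℝ)) ⁻¹' {A | Aᵀ * A = 1} := by
    ext g
    exact mem_SO
  change IsCompact (SO p : Set (SpecialLinearGroup (Fin p) ℝ))
  rw [this]
  exact SpecialLinearGroup.isClosedEmbedding_val.isCompact_preimage (isCompact_orthogonal p)

/-- `SO (i + 1)` acts transitively on spheres when `i ≠ 0`. -/
lemma exists_SO_vecMul_eq {i : ℕ} (hi : i ≠ 0) (x : Fin (i + 1) → ℝ) :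
    ∃ g : SO (i + 1), Pi.single 0 (Real.sqrt (x ⬝ᵥ x)) ᵥ* mat g = x := by
  set r := Real.sqrt (x ⬝ᵥ x) with hr
  have hr2 : r * r = x ⬝ᵥ x := Real.mul_self_sqrt (by
    exact Finset.sum_nonneg fun a _ => mul_self_nonneg (x a))
  have he : (Pi.single 0 1 : Fin (i + 1) → ℝ) ≠ 0 := by
    simp
  have hneg : (Pi.single 0 r : Fin (i + 1) → ℝ) ᵥ* refl (Pi.single 0 1) = -Pi.single 0 r := by
    rw [vecMul_refl]
    ext a
    by_cases ha : a = 0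
    · subst ha; simp; ring
    · simp [ha]
  -- Two reflections are needed for determinant one. The first sends `r e₀` to `-r e₀`, the second,
  -- along `r e₀ + x`, sends this to `x`. If that vector vanishes, then `x = -r e₀` already and the
  -- second reflection is taken along `e₁`, which exists because `i ≠ 0`.
  by_cases hx : (Pi.single 0 r : Fin (i + 1) → ℝ) + x = 0
  · have h1 : (1 : Fin (i + 1)) ≠ 0 := by
      intro h
      simp [Fin.ext_iff, Nat.mod_eq_of_lt (show 1 < i + 1 by omega)] at h
    have he1 : (Pi.single 1 1 : Fin (i + 1) → ℝ) ≠ 0 := by simp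
    refine ⟨reflPair ⟨_, he⟩ ⟨_, he1⟩, ?_⟩
    change Pi.single 0 r ᵥ* (refl _ * refl _) = x
    rw [← Matrix.vecMul_vecMul, hneg, vecMul_refl]
    simp [h1]
    exact (eq_neg_of_add_eq_zero_right hx).symm
  · refine ⟨reflPair ⟨_, he⟩ ⟨_, hx⟩, ?_⟩
    change Pi.single 0 r ᵥ* (refl _ * refl _) = x
    rw [← Matrix.vecMul_vecMul, hneg, vecMul_refl]
    have h3 : 2 * (-(Pi.single 0 r : Fin (i + 1) → ℝ) ⬝ᵥ (Pi.single 0 r + x)) =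
        -((Pi.single 0 r + x) ⬝ᵥ (Pi.single 0 r + x)) := by
      simp only [dotProduct_add, add_dotProduct, neg_dotProduct, ← hr2]
      rw [dotProduct_comm x (Pi.single 0 r)]
      simp
      ring
    rw [h3, neg_div, div_self (dotProduct_self_ne_zero hx)]
    simp

/-! ### Block diagonal subgroups -/

/-- The index equivalence of a block decomposition. -/
abbrev blockEquiv {p q m : ℕ} (h : p + q = m) : Fin p ⊕ Fin q ≃ Fin m :=
  finSumFinEquiv.trans (finCongr h)

lemma blockEquiv_inl_val {p q m : ℕ} (h : p + q = m) (a : Fin p) :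
    (blockEquiv h (Sum.inl a) : ℕ) = a := by
  simp

lemma blockEquiv_inr_val {p q m : ℕ} (h : p + q = m) (b : Fin q) :
    (blockEquiv h (Sum.inr b) : ℕ) = p + b := by
  simp

lemma blockEquiv_inr_last {p j n : ℕ} (h : p + (j + 1) = n + 1) :
    blockEquiv h (Sum.inr (Fin.last j)) = Fin.last n :=
  Fin.ext (by rw [blockEquiv_inr_val, Fin.val_last, Fin.val_last]; omega)

lemma blockEquiv_inl_zero {i q n : ℕ} (h : i + 1 + q = n + 1) :
    blockEquiv h (Sum.inl 0) = 0 :=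
  Fin.ext (by rw [blockEquiv_inl_val]; rfl)

lemma coe_blockHom {p q m : ℕ} (h : p + q = m)
    (x : SpecialLinearGroup (Fin p) ℝ × SpecialLinearGroup (Fin q) ℝ) :
    ((blockHom h x : SpecialLinearGroup (Fin m) ℝ) : Matrix (Fin m) (Fin m) ℝ) =
      Matrix.reindex (blockEquiv h) (blockEquiv h)
        (Matrix.fromBlocks (x.1 : Matrix (Fin p) (Fin p) ℝ) 0 0
          (x.2 : Matrix (Fin q) (Fin q) ℝ)) := rfl

lemma continuous_blockHom {p q m : ℕ} (h : p + q = m) : Continuous (blockHom h) := by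
  refine Continuous.subtype_mk ?_ _
  refine Continuous.matrix_reindex ?_ _ _
  exact Continuous.matrix_fromBlocks ((continuous_val_SL p).comp continuous_fst) continuous_const
    continuous_const ((continuous_val_SL q).comp continuous_snd)

lemma gram_eq_reindex {p j n : ℕ} (h : p + (j + 1) = n + 1) :
    gram n = Matrix.reindex (blockEquiv h) (blockEquiv h)
      (Matrix.fromBlocks (1 : Matrix (Fin p) (Fin p) ℝ) 0 0 (gram j)) := by
  rw [← Matrix.diagonal_one, gram, gram, Matrix.fromBlocks_diagonal, Matrix.reindex_apply,
    Matrix.submatrix_diagonal_equiv]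
  congr 1
  ext a
  obtain ⟨b, rfl⟩ := (blockEquiv h).surjective a
  rw [Function.comp_apply, Equiv.symm_apply_apply]
  rcases b with b | b
  · have : blockEquiv h (Sum.inl b) ≠ Fin.last n := by
      intro hb
      rw [← blockEquiv_inr_last h] at hb
      simpa using (blockEquiv h).injective hb
    simp only [this, if_false, Sum.elim_inl]
  · have : blockEquiv h (Sum.inr b) = Fin.last n ↔ b = Fin.last j := by
      rw [← blockEquiv_inr_last h, (blockEquiv h).injective.eq_iff, Sum.inr.injEq]
    simp only [this, Sum.elim_inr]

lemma blockHom_mem_SOLorentz {p j n : ℕ} (h : p + (j + 1) = n + 1)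
    {A : SpecialLinearGroup (Fin p) ℝ} {D : SpecialLinearGroup (Fin (j + 1)) ℝ}
    (hA : A ∈ SO p) (hD : D ∈ SOLorentz j) : blockHom h (A, D) ∈ SOLorentz n := by
  rw [mem_SOLorentz, coe_blockHom, gram_eq_reindex h]
  simp only [Matrix.reindex_apply, Matrix.transpose_submatrix, Matrix.submatrix_mul_equiv,
    Matrix.fromBlocks_transpose, Matrix.fromBlocks_multiply, Matrix.mul_zero, Matrix.zero_mul,
    Matrix.transpose_zero, add_zero, zero_add, Matrix.mul_one, mem_SO.1 hA, mem_SOLorentz.1 hD]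

/-- The parameter space `SO(p) × SO(j,1)°` is connected and contains the identity. -/
lemma blockHom_mem_G {p j n : ℕ} (h : p + (j + 1) = n + 1)
    {A : SpecialLinearGroup (Fin p) ℝ} {D : SpecialLinearGroup (Fin (j + 1)) ℝ}
    (hA : A ∈ SO p) (hD : D ∈ SOLorentz₀ j) : blockHom h (A, D) ∈ G n := by
  refine mem_SOLorentz₀_of_preconnected
    (fun x : SO p × SOLorentz₀ j => blockHom h (x.1.1, x.2.1)) ?_ ?_ 1 ?_ (⟨A, hA⟩, ⟨D, hD⟩)
  · exact (continuous_blockHom h).comp (by fun_prop)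
  · exact fun x => blockHom_mem_SOLorentz h x.1.2 (SOLorentz₀_le j x.2.2)
  · exact map_one (blockHom h)

lemma K_le_G (n : ℕ) : K n ≤ G n := by
  rintro _ ⟨⟨A, D⟩, ⟨hA, hD⟩, rfl⟩
  have hD' : D = 1 := hD
  subst hD'
  exact blockHom_mem_G (j := 0) rfl hA (one_mem _)

lemma H_le_G {n i j : ℕ} (h : i + j + 1 = n) : H h ≤ G n := by
  rintro _ ⟨⟨A, D⟩, ⟨hA, hD⟩, rfl⟩
  exact blockHom_mem_G (by omega) hA hD

instance instCompactSpaceK (n : ℕ) : CompactSpace (K n) := by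
  refine isCompact_iff_compactSpace.1 ?_
  have : (K n : Set (SpecialLinearGroup (Fin (n + 1)) ℝ)) =
      Set.range fun A : SO n => blockHom (q := 1) rfl ((A : SpecialLinearGroup (Fin n) ℝ), 1) := by
    ext g
    constructor
    · rintro ⟨⟨A, D⟩, ⟨hA, hD⟩, rfl⟩
      have hD' : D = 1 := hD
      subst hD'
      exact ⟨⟨A, hA⟩, rfl⟩
    · rintro ⟨A, rfl⟩
      exact ⟨(A, 1), ⟨A.2, Subgroup.mem_bot.2 rfl⟩, rfl⟩
  change IsCompact (K n : Set (SpecialLinearGroup (Fin (n + 1)) ℝ))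
  rw [this]
  exact isCompact_range ((continuous_blockHom _).comp (by fun_prop))

lemma mat_K_last {n : ℕ} (k : K n) : mat k (Fin.last n) = Pi.single (Fin.last n) 1 := by
  obtain ⟨_, ⟨A, D⟩, ⟨hA, hD⟩, rfl⟩ := k
  have hD' : D = 1 := hD
  subst hD'
  ext b
  change ((blockHom _ (A, (1 : SpecialLinearGroup (Fin 1) ℝ)) :
    SpecialLinearGroup (Fin (n + 1)) ℝ) : Mat n) (Fin.last n) b = _
  rw [coe_blockHom]
  have hl := blockEquiv_inr_last (p := n) (j := 0) rfl
  rw [← hl]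
  obtain ⟨c, rfl⟩ := (blockEquiv (p := n) (q := 1) rfl).surjective b
  rw [Matrix.reindex_apply, Matrix.submatrix_apply, Equiv.symm_apply_apply]
  erw [Equiv.symm_apply_apply]
  rcases c with c | c
  · rw [Matrix.fromBlocks_apply₂₁, Pi.single_eq_of_ne]
    · rfl
    · intro h
      have := (blockEquiv (p := n) (q := 1) rfl).injective h
      simp at this
  · rw [Matrix.fromBlocks_apply₂₂, Subsingleton.elim c (Fin.last 0)]
    erw [Pi.single_eq_same]
    simp

/-- An element of `G` fixing the last coordinate functional is in `K`. -/
lemma mem_K_of_last {n : ℕ} {g : SpecialLinearGroup (Fin (n + 1)) ℝ} (hg : g ∈ SOLorentz n)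
    (hlast : (g : Mat n) (Fin.last n) = Pi.single (Fin.last n) 1) : g ∈ K n := by
  set e := blockEquiv (p := n) (q := 1) rfl with he
  have hl : e (Sum.inr 0) = Fin.last n := blockEquiv_inr_last (p := n) (j := 0) rfl
  have hrel := mem_SOLorentz.1 hg
  -- With `e` the last basis row, `e g = e` and `g B gᵀ = B` give `e B gᵀ = e B`. Since `e B = -e`,
  -- the last column is also a basis vector, and `g` is block diagonal.
  have hcol : (g : Mat n)ᵀ (Fin.last n) = Pi.single (Fin.last n) 1 := by
    have h1 := mul_gram_mul_transpose_of hrel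
    have h2 := congrArg (fun M => Pi.single (Fin.last n) 1 ᵥ* M) h1
    simp only [← Matrix.vecMul_vecMul] at h2
    have h3 : Pi.single (Fin.last n) (1 : ℝ) ᵥ* gram n = -Pi.single (Fin.last n) 1 := by
      ext b
      rw [Matrix.single_one_vecMul, gram]
      by_cases hb : b = Fin.last n
      · subst hb; simp
      · simp [hb, Matrix.diagonal_apply_ne _ (Ne.symm hb)]
    have h4 : Pi.single (Fin.last n) (1 : ℝ) ᵥ* (g : Mat n) = Pi.single (Fin.last n) 1 := by
      rw [Matrix.single_one_vecMul]; exact hlast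
    rw [h4, h3, Matrix.neg_vecMul] at h2
    have h5 := neg_injective h2
    rw [Matrix.single_one_vecMul] at h5
    exact h5
  let B := Matrix.reindex e.symm e.symm (g : Mat n)
  have hB : (g : Mat n) = Matrix.reindex e e B := by
    ext a b; simp [B]
  have h12 : B.toBlocks₁₂ = 0 := by
    ext a b
    have : (g : Mat n)ᵀ (Fin.last n) (e (Sum.inl a)) = 0 := by
      rw [hcol, ← hl, Pi.single_eq_of_ne]
      intro h; simpa using e.injective h
    rw [Subsingleton.elim b 0]
    simpa [B, Matrix.toBlocks₁₂, hl] using this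
  have h21 : B.toBlocks₂₁ = 0 := by
    ext a b
    have : (g : Mat n) (Fin.last n) (e (Sum.inl b)) = 0 := by
      rw [hlast, ← hl, Pi.single_eq_of_ne]
      intro h; simpa using e.injective h
    rw [Subsingleton.elim a 0]
    simpa [B, Matrix.toBlocks₂₁, hl] using this
  have h22 : B.toBlocks₂₂ = 1 := by
    ext a b
    have : (g : Mat n) (Fin.last n) (Fin.last n) = 1 := by
      rw [hlast, Pi.single_eq_same]
    rw [Subsingleton.elim a 0, Subsingleton.elim b 0]
    simpa [B, Matrix.toBlocks₂₂, hl] using this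
  have hBb : B = Matrix.fromBlocks B.toBlocks₁₁ 0 0 1 := by
    rw [← h12, ← h21, ← h22, Matrix.fromBlocks_toBlocks]
  set A := B.toBlocks₁₁ with hA
  have hdet : A.det = 1 := by
    have h1 : (g : Mat n).det = 1 := g.2
    rw [hB, hBb, Matrix.det_reindex_self, Matrix.det_fromBlocks_zero₂₁, Matrix.det_one,
      mul_one] at h1
    exact h1
  have hAA : Aᵀ * A = 1 := by
    have h1 := hrel
    rw [hB, hBb, gram_eq_reindex (p := n) (j := 0) rfl] at h1
    simp only [Matrix.reindex_apply, Matrix.transpose_submatrix, Matrix.fromBlocks_transpose] at h1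
    erw [Matrix.submatrix_mul_equiv, Matrix.submatrix_mul_equiv] at h1
    have h1' : Matrix.reindex e e (Matrix.fromBlocks Aᵀ 0ᵀ 0ᵀ 1ᵀ *
        Matrix.fromBlocks 1 0 0 (gram 0 : Matrix (Fin 1) (Fin 1) ℝ) * Matrix.fromBlocks A 0 0 1) =
        Matrix.reindex e e (Matrix.fromBlocks 1 0 0 (gram 0 : Matrix (Fin 1) (Fin 1) ℝ)) := h1
    have h2 := (Matrix.reindex e e).injective h1'
    simp only [Matrix.fromBlocks_multiply, Matrix.mul_zero, Matrix.zero_mul,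
      Matrix.transpose_zero, add_zero, zero_add, Matrix.mul_one] at h2
    exact (Matrix.fromBlocks_inj.1 h2).1
  refine ⟨(⟨A, hdet⟩, 1), ⟨mem_SO.2 hAA, Subgroup.mem_bot.2 rfl⟩, Subtype.ext ?_⟩
  rw [coe_blockHom, hB, hBb]
  rfl

/-! ### The hyperboloid -/

/-- The Lorentz quadratic form on row vectors. -/
def quad {n : ℕ} (v : Fin (n + 1) → ℝ) : ℝ := (v ᵥ* gram n) ⬝ᵥ v

/-- The last coordinate functional. -/
def lastVec (n : ℕ) : Fin (n + 1) → ℝ := Pi.single (Fin.last n) 1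

/-- The point of the upper sheet of the hyperboloid above `x`. -/
def lift {n : ℕ} (x : Fin n → ℝ) : Fin (n + 1) → ℝ :=
  Fin.snoc (α := fun _ => ℝ) x (Real.sqrt (1 + x ⬝ᵥ x))

lemma vecMul_gram_apply {n : ℕ} (v : Fin (n + 1) → ℝ) (a : Fin (n + 1)) :
    (v ᵥ* gram n) a = if a = Fin.last n then -v a else v a := by
  rw [gram, Matrix.vecMul_diagonal]
  split_ifs <;> simp

lemma quad_eq {n : ℕ} (v : Fin (n + 1) → ℝ) :
    quad v = (fun a : Fin n => v a.castSucc) ⬝ᵥ (fun a : Fin n => v a.castSucc) -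
      v (Fin.last n) ^ 2 := by
  rw [quad, dotProduct, Fin.sum_univ_castSucc]
  simp only [vecMul_gram_apply, (Fin.castSucc_lt_last _).ne, if_false, if_true, dotProduct]
  ring

lemma quad_vecMul {n : ℕ} (g : G n) (v : Fin (n + 1) → ℝ) : quad (v ᵥ* mat g) = quad v := by
  rw [quad, quad, ← Matrix.mulVec_transpose (mat g), Matrix.mulVec_transpose,
    ← Matrix.mulVec_transpose (mat g) v, Matrix.dotProduct_mulVec, Matrix.mulVec_transpose,
    Matrix.vecMul_vecMul, Matrix.vecMul_vecMul, ← Matrix.mul_assoc, mat_mul_gram_mul_transpose]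

lemma dotProduct_self_nonneg' {n : ℕ} (x : Fin n → ℝ) : 0 ≤ x ⬝ᵥ x :=
  Finset.sum_nonneg fun a _ => mul_self_nonneg (x a)

@[simp] lemma lift_castSucc {n : ℕ} (x : Fin n → ℝ) (a : Fin n) : lift x a.castSucc = x a := by
  simp [lift]

@[simp] lemma lift_last {n : ℕ} (x : Fin n → ℝ) :
    lift x (Fin.last n) = Real.sqrt (1 + x ⬝ᵥ x) := by
  simp [lift]

lemma one_le_lift_last {n : ℕ} (x : Fin n → ℝ) : 1 ≤ lift x (Fin.last n) := by
  rw [lift_last]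
  exact Real.one_le_sqrt.2 (by linarith [dotProduct_self_nonneg' x])

lemma quad_lift {n : ℕ} (x : Fin n → ℝ) : quad (lift x) = -1 := by
  rw [quad_eq]
  simp only [lift_castSucc, lift_last]
  rw [Real.sq_sqrt (by linarith [dotProduct_self_nonneg' x])]
  ring

lemma eq_lift {n : ℕ} {v : Fin (n + 1) → ℝ} (hv : quad v = -1) (hpos : 0 < v (Fin.last n)) :
    v = lift fun a => v a.castSucc := by
  ext a
  refine Fin.lastCases ?_ (fun b => ?_) a
  · rw [lift_last]
    rw [quad_eq] at hv
    rw [eq_comm, Real.sqrt_eq_iff_mul_self_eq_of_pos hpos]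
    linarith
  · rw [lift_castSucc]

lemma continuous_lift (n : ℕ) : Continuous (lift (n := n)) := by
  refine continuous_pi fun a => ?_
  refine Fin.lastCases ?_ (fun b => ?_) a
  · simp only [lift_last, dotProduct]
    fun_prop
  · simp only [lift_castSucc]
    fun_prop

/-- Elements of `G` preserve the open future cone. -/
lemma vecMul_last_pos {n : ℕ} (g : G n) {v : Fin (n + 1) → ℝ} (hv : quad v < 0)
    (hpos : 0 < v (Fin.last n)) : 0 < (v ᵥ* mat g) (Fin.last n) := by
  -- With last coordinate zero the form would be a sum of squares, contrary to `quad v < 0`. As `G`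
  -- is connected, the sign of the last coordinate is then constant on the orbit.
  have hne : ∀ g : G n, (v ᵥ* mat g) (Fin.last n) ≠ 0 := by
    intro g h0
    have h1 := quad_vecMul g v
    rw [quad_eq, h0] at h1
    have := dotProduct_self_nonneg' fun a : Fin n => (v ᵥ* mat g) a.castSucc
    linarith
  by_contra hle
  have hc : Continuous fun g : G n => (v ᵥ* mat g) (Fin.last n) :=
    (continuous_apply _).comp (Continuous.matrix_vecMul continuous_const continuous_mat)
  have h0 : (0 : ℝ) ∈ Set.range fun g : G n => (v ᵥ* mat g) (Fin.last n) :=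
    (isPreconnected_range hc).ordConnected.out ⟨g, rfl⟩ ⟨1, rfl⟩
      ⟨not_lt.1 hle, by simpa using hpos.le⟩
  obtain ⟨g', hg'⟩ := h0
  exact hne g' hg'

lemma lastVec_vecMul {n : ℕ} (A : Mat n) : lastVec n ᵥ* A = A (Fin.last n) := by
  rw [lastVec, Matrix.single_one_vecMul]; rfl

lemma quad_lastVec (n : ℕ) : quad (lastVec n) = -1 := by
  rw [quad_eq]
  simp [lastVec, dotProduct]

/-- The coordinates on the hyperboloid of the last row of `g`. -/
def row {n : ℕ} (g : G n) : Fin n → ℝ := fun a => mat g (Fin.last n) a.castSucc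

lemma mat_last_eq_lift {n : ℕ} (g : G n) : mat g (Fin.last n) = lift (row g) := by
  have h1 : quad (mat g (Fin.last n)) = -1 := by
    rw [← lastVec_vecMul (mat g), quad_vecMul, quad_lastVec]
  refine eq_lift h1 ?_
  rw [← lastVec_vecMul (mat g)]
  exact vecMul_last_pos g (by rw [quad_lastVec]; norm_num) (by simp [lastVec])

/-! ### Boosts -/

/-- The boost moving the base point of the hyperboloid to `v`. -/
def boost {n : ℕ} (v : Fin (n + 1) → ℝ) : Mat n :=
  gram n + (1 / (1 + v (Fin.last n))) • Matrix.vecMulVec (v + lastVec n) (v + lastVec n)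

lemma boost_transpose {n : ℕ} (v : Fin (n + 1) → ℝ) : (boost v)ᵀ = boost v := by
  rw [boost, Matrix.transpose_add, gram_transpose, Matrix.transpose_smul,
    Matrix.transpose_vecMulVec]

lemma quad_add_lastVec {n : ℕ} {v : Fin (n + 1) → ℝ} (hv : quad v = -1) :
    quad (v + lastVec n) = -2 * (1 + v (Fin.last n)) := by
  rw [quad_eq] at hv ⊢
  have h : ∀ a : Fin n, (v + lastVec n) a.castSucc = v a.castSucc := by
    intro a
    simp [lastVec]
  simp only [h]
  simp only [Pi.add_apply, lastVec, Pi.single_eq_same]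
  linarith

/-- Write `w` for `v + lastVec n` and `c` for `1 + v_last`. The two cross terms add up to `(2/c) w
wᵀ`, and the quadratic term `(1/c²) quad(w) w wᵀ` cancels them because `quad w = -2c`. -/
lemma boost_mul_gram_mul_boost {n : ℕ} {v : Fin (n + 1) → ℝ} (hv : quad v = -1)
    (hpos : 0 < v (Fin.last n)) : boost v * gram n * boost v = gram n := by
  have h0 : (1 + v (Fin.last n)) ≠ 0 := by positivity
  have h1 := quad_add_lastVec hv
  set w := v + lastVec n
  set c := 1 + v (Fin.last n)
  have hVV : Matrix.vecMulVec w w * gram n * Matrix.vecMulVec w w =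
      quad w • Matrix.vecMulVec w w := by
    rw [Matrix.vecMulVec_mul, Matrix.vecMulVec_mul_vecMulVec, Matrix.vecMulVec_smul, quad]
  simp only [boost, Matrix.add_mul, Matrix.mul_add, Matrix.smul_mul, Matrix.mul_smul,
    gram_mul_gram, Matrix.one_mul, Matrix.mul_assoc, Matrix.mul_one]
  rw [← Matrix.mul_assoc, hVV, h1]
  simp only [smul_smul]
  have hc : (1 / c) * ((1 / c) * (-2 * c)) = -2 * (1 / c) := by field_simp
  linear_combination (norm := module) hc • Matrix.vecMulVec w w

lemma boost_last {n : ℕ} {v : Fin (n + 1) → ℝ} (hpos : 0 < v (Fin.last n)) :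
    boost v (Fin.last n) = v := by
  ext b
  have h0 : (1 + v (Fin.last n)) ≠ 0 := by positivity
  rw [boost, Matrix.add_apply, Matrix.smul_apply, Matrix.vecMulVec_apply, gram]
  by_cases hb : b = Fin.last n
  · subst hb
    simp only [Matrix.diagonal_apply_eq, if_true, Pi.add_apply, lastVec, Pi.single_eq_same,
      smul_eq_mul]
    field_simp
    ring
  · rw [Matrix.diagonal_apply_ne _ (Ne.symm hb)]
    simp only [Pi.add_apply, lastVec, Pi.single_eq_same, smul_eq_mul, Pi.single_eq_of_ne hb]
    field_simp
    ring

lemma continuous_boost_lift (n : ℕ) : Continuous fun x : Fin n → ℝ => boost (lift x) := by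
  unfold boost
  have hl := continuous_lift n
  refine continuous_const.add (Continuous.fun_smul ?_ ?_)
  · refine continuous_const.div (continuous_const.add ((continuous_apply _).comp hl)) fun x => ?_
    have := one_le_lift_last x
    positivity
  · exact Continuous.matrix_vecMulVec (hl.add continuous_const) (hl.add continuous_const)

lemma lift_last_pos {n : ℕ} (x : Fin n → ℝ) : 0 < lift x (Fin.last n) :=
  lt_of_lt_of_le one_pos (one_le_lift_last x)

lemma lift_zero (n : ℕ) : lift (0 : Fin n → ℝ) = lastVec n := by
  ext a
  refine Fin.lastCases ?_ (fun b => ?_) a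
  · simp [lastVec]
  · simp [lastVec]

lemma boost_lastVec (n : ℕ) : boost (lastVec n) = 1 := by
  ext a b
  rw [boost, Matrix.add_apply, Matrix.smul_apply, Matrix.vecMulVec_apply, gram]
  by_cases hab : a = b
  · subst hab
    by_cases ha : a = Fin.last n
    · subst ha; norm_num [lastVec]
    · simp [lastVec, ha]
  · rw [Matrix.diagonal_apply_ne _ hab, Matrix.one_apply_ne hab]
    by_cases ha : a = Fin.last n
    · have hb : b ≠ Fin.last n := fun h => hab (ha.trans h.symm)
      simp [lastVec, hb]
    · simp [lastVec, ha]

lemma exists_mat_eq_boost {n : ℕ} (x : Fin n → ℝ) : ∃ g : G n, mat g = boost (lift x) := by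
  refine exists_mat_eq_of_preconnected (fun x : Fin n → ℝ => boost (lift x))
    (continuous_boost_lift n) (fun x => ?_) 0 ?_ x
  · rw [boost_transpose, boost_mul_gram_mul_boost (quad_lift x) (lift_last_pos x)]
  · rw [lift_zero, boost_lastVec]

/-- The boost to the point above `x`, as an element of `G`. -/
def boostG {n : ℕ} (x : Fin n → ℝ) : G n := (exists_mat_eq_boost x).choose

@[simp] lemma mat_boostG {n : ℕ} (x : Fin n → ℝ) : mat (boostG x) = boost (lift x) :=
  (exists_mat_eq_boost x).choose_spec

lemma continuous_boostG (n : ℕ) : Continuous (boostG (n := n)) := by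
  rw [isEmbedding_mat.continuous_iff]
  simpa [Function.comp_def] using continuous_boost_lift n

/-- The inclusion of `K` into `G`. -/
def inclK (n : ℕ) : K n →* G n := Subgroup.inclusion (K_le_G n)

@[simp] lemma mat_inclK {n : ℕ} (k : K n) : mat (inclK n k) = mat k := rfl

lemma continuous_inclK (n : ℕ) : Continuous (inclK n) := continuous_inclusion (K_le_G n)

lemma row_inclK_mul {n : ℕ} (k : K n) (g : G n) : row (inclK n k * g) = row g := by
  ext a
  rw [row, row, ← lastVec_vecMul (mat (inclK n k * g)), mat_mul, mat_inclK,
    ← Matrix.vecMul_vecMul, lastVec_vecMul, mat_K_last]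
  exact congrFun (lastVec_vecMul (mat g)) _

@[simp] lemma row_boostG {n : ℕ} (x : Fin n → ℝ) : row (boostG x) = x := by
  ext a
  rw [row, mat_boostG, boost_last (lift_last_pos x), lift_castSucc]

lemma continuous_row (n : ℕ) : Continuous (row (n := n)) :=
  continuous_pi fun _ => continuous_mat.matrix_elem _ _

/-- The decomposition of an element of `G` as the product of an element of `K` and a boost. -/
lemma exists_eq_inclK_mul_boostG {n : ℕ} (g : G n) : ∃ k : K n, g = inclK n k * boostG (row g) := by
  -- An element and the boost to its last row have the same last row, so their quotient fixes the
  -- last coordinate functional.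
  have hmem : ((g * (boostG (row g))⁻¹ : G n) : SpecialLinearGroup (Fin (n + 1)) ℝ) ∈ K n := by
    refine mem_K_of_last (SOLorentz₀_le n (g * (boostG (row g))⁻¹).2) ?_
    change mat (g * (boostG (row g))⁻¹) (Fin.last n) = lastVec n
    have h1 : lastVec n ᵥ* mat g = lastVec n ᵥ* mat (boostG (row g)) := by
      rw [lastVec_vecMul, lastVec_vecMul, mat_last_eq_lift, mat_boostG,
        boost_last (lift_last_pos _)]
    rw [← lastVec_vecMul (mat (g * (boostG (row g))⁻¹)), mat_mul, ← Matrix.vecMul_vecMul, h1, Matrix.vecMul_vecMul, ← mat_mul,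
      mul_inv_cancel, mat_one, Matrix.vecMul_one]
  refine ⟨⟨_, hmem⟩, ?_⟩
  have : inclK n ⟨_, hmem⟩ = g * (boostG (row g))⁻¹ := rfl
  rw [this, inv_mul_cancel_right]

/-! ### The Cartan involution -/

lemma exists_mat_eq_conj {n : ℕ} (g : G n) : ∃ g' : G n, mat g' = gram n * mat g * gram n := by
  refine exists_mat_eq_of_preconnected (fun g : G n => gram n * mat g * gram n)
    (by have := continuous_mat (S := G n); fun_prop) (fun g => ?_) 1 (by simp) g
  rw [Matrix.transpose_mul, Matrix.transpose_mul, gram_transpose]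
  calc gram n * ((mat g)ᵀ * gram n) * gram n * (gram n * mat g * gram n)
      = gram n * (((mat g)ᵀ * (gram n * (gram n * gram n)) * mat g)) * gram n := by
        simp only [Matrix.mul_assoc]
    _ = gram n := by
        rw [gram_mul_gram, Matrix.mul_one, mat_transpose_mul_gram_mul, gram_mul_gram,
          Matrix.one_mul]

/-- Conjugation by the Gram matrix. -/
def cartan {n : ℕ} (g : G n) : G n := (exists_mat_eq_conj g).choose

@[simp] lemma mat_cartan {n : ℕ} (g : G n) : mat (cartan g) = gram n * mat g * gram n :=
  (exists_mat_eq_conj g).choose_spec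

lemma cartan_cartan {n : ℕ} (g : G n) : cartan (cartan g) = g := by
  apply mat_injective
  change mat (cartan (cartan g)) = mat g
  rw [mat_cartan, mat_cartan]
  calc gram n * (gram n * mat g * gram n) * gram n
      = (gram n * gram n) * mat g * (gram n * gram n) := by simp only [Matrix.mul_assoc]
    _ = mat g := by simp

lemma cartan_mul {n : ℕ} (g h : G n) : cartan (g * h) = cartan g * cartan h := by
  apply mat_injective
  change mat (cartan (g * h)) = mat (cartan g * cartan h)
  rw [mat_mul, mat_cartan, mat_cartan, mat_cartan, mat_mul]
  calc gram n * (mat g * mat h) * gram n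
      = gram n * mat g * (gram n * gram n) * mat h * gram n := by
        rw [gram_mul_gram]; simp only [Matrix.mul_assoc, Matrix.one_mul]
    _ = _ := by simp only [Matrix.mul_assoc]

lemma continuous_cartan (n : ℕ) : Continuous (cartan (n := n)) := by
  rw [isEmbedding_mat.continuous_iff]
  have := continuous_mat (S := G n)
  simp only [Function.comp_def, mat_cartan]
  fun_prop

/-- Conjugation by the Gram matrix as an automorphism of `G`. -/
def cartanEquiv (n : ℕ) : G n ≃ₜ* G n where
  toFun := cartan
  invFun := cartan
  left_inv := cartan_cartan
  right_inv := cartan_cartan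
  map_mul' := cartan_mul
  continuous_toFun := continuous_cartan n
  continuous_invFun := continuous_cartan n

/-- A boost is symmetric and preserves the form, so `b B b = B`, which says that `B b B` is inverse
to `b`. This relation drives the unimodularity of `G`. -/
lemma cartan_boostG {n : ℕ} (x : Fin n → ℝ) : cartan (boostG x) = (boostG x)⁻¹ := by
  rw [eq_inv_iff_mul_eq_one]
  apply mat_injective
  change mat (cartan (boostG x) * boostG x) = mat 1
  rw [mat_mul, mat_cartan, mat_one, mat_boostG, Matrix.mul_assoc, Matrix.mul_assoc,
    ← Matrix.mul_assoc (boost _), boost_mul_gram_mul_boost (quad_lift x) (lift_last_pos x),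
    gram_mul_gram]

/-! ### The invariant measure on the hyperboloid -/

lemma lintegral_comp_smul_mul {m : ℕ} {r : ℝ} (hr : 0 < r) {f : (Fin m → ℝ) → ℝ≥0∞}
    (hf : Measurable f) :
    ∫⁻ x, f (r • x) * ENNReal.ofReal (r ^ m) = ∫⁻ y, f y := by
  have h1 : ∫⁻ x, f (r • x) = ENNReal.ofReal ((r ^ m)⁻¹) * ∫⁻ y, f y := by
    rw [← lintegral_map (f := f) (g := fun x : Fin m → ℝ => r • x) hf (measurable_const_smul r),
      Measure.map_addHaar_smul volume hr.ne', lintegral_smul_measure, Module.finrank_fin_fun,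
      abs_of_pos (by positivity), smul_eq_mul]
  have hfr : Measurable fun x : Fin m → ℝ => f (r • x) := hf.comp (measurable_const_smul r)
  rw [lintegral_mul_const _ hfr, h1, mul_right_comm,
    ← ENNReal.ofReal_mul (by positivity), inv_mul_cancel₀ (by positivity), ENNReal.ofReal_one,
    one_mul]

lemma lintegral_comp_vecMul {m : ℕ} {A : Matrix (Fin m) (Fin m) ℝ} (hA : A.det = 1)
    {f : (Fin m → ℝ) → ℝ≥0∞} (hf : Measurable f) :
    ∫⁻ x, f (x ᵥ* A) = ∫⁻ x, f x := by
  have hmeas : Measurable fun x : Fin m → ℝ => x ᵥ* A :=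
    (Continuous.matrix_vecMul continuous_id continuous_const).measurable
  have hmap : Measure.map (fun x : Fin m → ℝ => x ᵥ* A) volume = volume := by
    have h := Real.map_matrix_volume_pi_eq_smul_volume_pi (M := Aᵀ)
      (by rw [Matrix.det_transpose, hA]; exact one_ne_zero)
    rw [Matrix.det_transpose, hA, inv_one, abs_one, ENNReal.ofReal_one, one_smul] at h
    have hfun : (fun x : Fin m → ℝ => x ᵥ* A) = Matrix.toLin' Aᵀ := by
      ext1 x
      rw [Matrix.toLin'_apply, Matrix.mulVec_transpose]
    rw [hfun, h]
  rw [← lintegral_map (f := f) hf hmeas, hmap]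

/-- The measure `dx / √(1 + ‖x‖²)`, the invariant measure of hyperbolic space. -/
def hyp (n : ℕ) : Measure (Fin n → ℝ) :=
  volume.withDensity fun x => ENNReal.ofReal (1 / Real.sqrt (1 + x ⬝ᵥ x))

lemma continuous_dotProduct_self (n : ℕ) : Continuous fun x : Fin n → ℝ => x ⬝ᵥ x :=
  Continuous.dotProduct continuous_id continuous_id

lemma measurable_hyp_density (n : ℕ) :
    Measurable fun x : Fin n → ℝ => ENNReal.ofReal (1 / Real.sqrt (1 + x ⬝ᵥ x)) := by
  have := (continuous_dotProduct_self n).measurable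
  fun_prop

instance instSigmaFiniteHyp (n : ℕ) : SigmaFinite (hyp n) := by
  unfold hyp
  exact SigmaFinite.withDensity_ofReal _

lemma lintegral_hyp {n : ℕ} {F : (Fin n → ℝ) → ℝ≥0∞} (hF : Measurable F) :
    ∫⁻ x, F x ∂hyp n = ∫⁻ x, ENNReal.ofReal (1 / Real.sqrt (1 + x ⬝ᵥ x)) * F x := by
  rw [hyp, lintegral_withDensity_eq_lintegral_mul _ (measurable_hyp_density n) hF]
  rfl

/-- The part of the future cone between two hyperboloids. -/
def shell (n : ℕ) : Set (Fin (n + 1) → ℝ) :=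
  {v | 0 < v (Fin.last n) ∧ -4 < quad v ∧ quad v < -1}

lemma continuous_quad (n : ℕ) : Continuous (quad (n := n)) :=
  Continuous.dotProduct (Continuous.matrix_vecMul continuous_id continuous_const) continuous_id

lemma measurableSet_shell (n : ℕ) : MeasurableSet (shell n) := by
  have hq := (continuous_quad n).measurable
  exact (measurableSet_lt measurable_const (measurable_pi_apply _)).inter
    ((measurableSet_lt measurable_const hq).inter (measurableSet_lt hq measurable_const))

/-- The projection of a vector of the future cone to the hyperboloid, in coordinates. -/
def coneProj {n : ℕ} (v : Fin (n + 1) → ℝ) : Fin n → ℝ :=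
  fun a => v a.castSucc / Real.sqrt (-quad v)

lemma measurable_coneProj (n : ℕ) : Measurable (coneProj (n := n)) := by
  have hq := (continuous_quad n).measurable
  refine measurable_pi_iff.2 fun a => ?_
  unfold coneProj
  fun_prop

/-- The extension of a function on the hyperboloid to the cone shell. -/
def coneExt {n : ℕ} (F : (Fin n → ℝ) → ℝ≥0∞) : (Fin (n + 1) → ℝ) → ℝ≥0∞ :=
  (shell n).indicator fun v => F (coneProj v)

lemma measurable_coneExt {n : ℕ} {F : (Fin n → ℝ) → ℝ≥0∞} (hF : Measurable F) :
    Measurable (coneExt F) :=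
  (hF.comp (measurable_coneProj n)).indicator (measurableSet_shell n)

lemma quad_snoc {n : ℕ} (y : Fin n → ℝ) (t : ℝ) :
    quad (Fin.snoc (α := fun _ => ℝ) y t) = y ⬝ᵥ y - t ^ 2 := by
  rw [quad_eq]
  simp

/-- For fixed `y`, substitute `t = √(r² + ‖y‖²)`. Then `r = √(-quad)`, and the shell is exactly `1 <
r < 2`. -/
lemma lintegral_coneExt_snoc {n : ℕ} (F : (Fin n → ℝ) → ℝ≥0∞) (y : Fin n → ℝ) :
    ∫⁻ t : ℝ, coneExt F (Fin.snoc (α := fun _ => ℝ) y t) =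
      ∫⁻ r in Set.Ioo (1 : ℝ) 2,
        ENNReal.ofReal (r / Real.sqrt (r ^ 2 + y ⬝ᵥ y)) * F (r⁻¹ • y) := by
  set q := y ⬝ᵥ y with hq
  have hq0 : 0 ≤ q := dotProduct_self_nonneg' y
  let φ : ℝ → ℝ := fun r => Real.sqrt (r ^ 2 + q)
  have himage : φ '' Set.Ioo 1 2 = {t | 0 < t ∧ -4 < q - t ^ 2 ∧ q - t ^ 2 < -1} := by
    ext t
    constructor
    · rintro ⟨r, ⟨h1, h2⟩, rfl⟩
      have hs : φ r ^ 2 = r ^ 2 + q := Real.sq_sqrt (by positivity)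
      refine ⟨Real.sqrt_pos.2 (by positivity), ?_, ?_⟩ <;> rw [hs] <;> nlinarith
    · rintro ⟨h0, h1, h2⟩
      refine ⟨Real.sqrt (t ^ 2 - q), ⟨?_, ?_⟩, ?_⟩
      · rw [Real.lt_sqrt (by norm_num)]; linarith
      · rw [Real.sqrt_lt' (by norm_num)]; linarith
      · simp only [φ]
        rw [Real.sq_sqrt (by linarith), sub_add_cancel, Real.sqrt_sq h0.le]
  have hderiv : ∀ r ∈ Set.Ioo (1 : ℝ) 2,
      HasDerivWithinAt φ (r / Real.sqrt (r ^ 2 + q)) (Set.Ioo 1 2) r := by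
    intro r hr
    have hne : r ^ 2 + q ≠ 0 := by have := hr.1; positivity
    have h := ((hasDerivAt_pow 2 r).add_const q).sqrt hne
    refine (h.congr_deriv ?_).hasDerivWithinAt
    simp
    ring
  have hinj : Set.InjOn φ (Set.Ioo 1 2) := by
    intro r hr s hs h
    have h' := congrArg (fun z => z ^ 2) h
    simp only [φ] at h'
    rw [Real.sq_sqrt (by positivity), Real.sq_sqrt (by positivity)] at h'
    have h1 := hr.1
    have h2 := hs.1
    nlinarith
  have hcov := lintegral_image_eq_lintegral_abs_deriv_mul measurableSet_Ioo hderiv hinj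
    fun t => F ((Real.sqrt (t ^ 2 - q))⁻¹ • y)
  have hms : MeasurableSet (φ '' Set.Ioo 1 2) := by
    rw [himage]
    have hm : Measurable fun t : ℝ => q - t ^ 2 := by fun_prop
    exact (measurableSet_lt measurable_const measurable_id).inter
      ((measurableSet_lt measurable_const hm).inter (measurableSet_lt hm measurable_const))
  calc ∫⁻ t : ℝ, coneExt F (Fin.snoc (α := fun _ => ℝ) y t)
      = ∫⁻ t : ℝ, (φ '' Set.Ioo 1 2).indicator
          (fun t => F ((Real.sqrt (t ^ 2 - q))⁻¹ • y)) t := by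
        refine lintegral_congr fun t => ?_
        have hmem : (Fin.snoc (α := fun _ => ℝ) y t : Fin (n + 1) → ℝ) ∈ shell n ↔
            t ∈ φ '' Set.Ioo 1 2 := by
          rw [himage, shell, Set.mem_ofPred_eq, quad_snoc, Fin.snoc_last, Set.mem_ofPred_eq]
        by_cases ht : t ∈ φ '' Set.Ioo 1 2
        · rw [coneExt, Set.indicator_of_mem (hmem.2 ht), Set.indicator_of_mem ht]
          congr 1
          ext a
          simp only [coneProj, quad_snoc, Fin.snoc_castSucc, neg_sub, Pi.smul_apply, smul_eq_mul]
          rw [div_eq_inv_mul]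
        · rw [coneExt, Set.indicator_of_notMem (fun h => ht (hmem.1 h)),
            Set.indicator_of_notMem ht]
    _ = _ := by
        rw [lintegral_indicator hms, hcov]
        refine setLIntegral_congr_fun measurableSet_Ioo fun r hr => ?_
        have h1 := hr.1
        have hs : Real.sqrt (r ^ 2 + q) ^ 2 = r ^ 2 + q := Real.sq_sqrt (by positivity)
        simp only [φ]
        rw [hs, add_sub_cancel_right, Real.sqrt_sq (by linarith), abs_of_nonneg (by positivity)]

/-- After the substitution for `t`, rescaling `y = r x` contributes `r^n` and turns the density `r /
√(r² + ‖y‖²)` into `1 / √(1 + ‖x‖²)`. Lebesgue measure on the shell thus splits as `r^n dr` times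
the hyperbolic measure. -/
lemma lintegral_coneExt {n : ℕ} {F : (Fin n → ℝ) → ℝ≥0∞} (hF : Measurable F) :
    ∫⁻ v, coneExt F v =
      (∫⁻ r in Set.Ioo (1 : ℝ) 2, ENNReal.ofReal (r ^ n)) * ∫⁻ x, F x ∂hyp n := by
  have hq := (continuous_dotProduct_self n).measurable
  have h1 : ∫⁻ v, coneExt F v =
      ∫⁻ p : ℝ × (Fin n → ℝ), coneExt F (Fin.snoc (α := fun _ => ℝ) p.2 p.1) := by
    have hmp := (volume_preserving_piFinSuccAbove (fun _ : Fin (n + 1) => ℝ) (Fin.last n)).symm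
    rw [← hmp.lintegral_comp (measurable_coneExt hF)]
    refine lintegral_congr fun p => ?_
    congr 1
    simp [MeasurableEquiv.piFinSuccAbove]
    rfl
  have hsnoc : Measurable fun p : ℝ × (Fin n → ℝ) =>
      (Fin.snoc (α := fun _ => ℝ) p.2 p.1 : Fin (n + 1) → ℝ) := by
    refine measurable_pi_iff.2 fun a => ?_
    refine Fin.lastCases ?_ (fun b => ?_) a
    · simpa using measurable_fst
    · simpa [Function.comp_def] using (measurable_pi_apply b).comp measurable_snd
  have hce : Measurable fun p : ℝ × (Fin n → ℝ) =>
      coneExt F (Fin.snoc (α := fun _ => ℝ) p.2 p.1) := (measurable_coneExt hF).comp hsnoc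
  rw [h1, Measure.volume_eq_prod, lintegral_prod_symm _ hce.aemeasurable]
  simp only [lintegral_coneExt_snoc]
  have hjoint : Measurable fun p : (Fin n → ℝ) × ℝ =>
      ENNReal.ofReal (p.2 / Real.sqrt (p.2 ^ 2 + p.1 ⬝ᵥ p.1)) * F (p.2⁻¹ • p.1) := by
    refine Measurable.mul ?_ (hF.comp ?_)
    · have : Measurable fun p : (Fin n → ℝ) × ℝ => p.1 ⬝ᵥ p.1 := hq.comp measurable_fst
      fun_prop
    · exact (measurable_snd.inv).smul measurable_fst
  have hpow : Measurable fun r : ℝ => ENNReal.ofReal (r ^ n) := by fun_prop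
  rw [lintegral_lintegral_swap hjoint.aemeasurable, ← lintegral_mul_const _ hpow]
  refine setLIntegral_congr_fun measurableSet_Ioo ?_
  intro r hr
  have hr0 : 0 < r := by linarith [hr.1]
  dsimp only
  rw [← lintegral_comp_smul_mul hr0, lintegral_hyp hF, ← lintegral_const_mul]
  · refine lintegral_congr fun x => ?_
    rw [smul_smul, inv_mul_cancel₀ hr0.ne', one_smul, smul_dotProduct, dotProduct_smul,
      smul_eq_mul, smul_eq_mul]
    have : r ^ 2 + r * (r * (x ⬝ᵥ x)) = r ^ 2 * (1 + x ⬝ᵥ x) := by ring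
    rw [this, Real.sqrt_mul (by positivity), Real.sqrt_sq hr0.le]
    have h2 : r / (r * Real.sqrt (1 + x ⬝ᵥ x)) = 1 / Real.sqrt (1 + x ⬝ᵥ x) := by
      field_simp
    rw [h2]
    ring
  · exact (measurable_hyp_density n).mul hF
  · exact hjoint.comp (measurable_id.prodMk measurable_const)

/-- `G` acts linearly and preserves the form and the future cone, so radial projection to the
hyperboloid commutes with the action. -/
lemma coneExt_vecMul {n : ℕ} (F : (Fin n → ℝ) → ℝ≥0∞) (g : G n) (v : Fin (n + 1) → ℝ) :
    coneExt F (v ᵥ* mat g) = coneExt (fun x => F (row (boostG x * g))) v := by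
  by_cases hv : v ∈ shell n
  · have hvg : v ᵥ* mat g ∈ shell n := by
      refine ⟨vecMul_last_pos g (by linarith [hv.2.2]) hv.1, ?_⟩
      rw [quad_vecMul]
      exact hv.2
    rw [coneExt, coneExt, Set.indicator_of_mem hv, Set.indicator_of_mem hvg]
    congr 1
    set r := Real.sqrt (-quad v) with hr
    have hq : 0 < -quad v := by linarith [hv.2.2]
    have hr0 : 0 < r := Real.sqrt_pos.2 hq
    have hlift : lift (coneProj v) = r⁻¹ • v := by
      have h1 : quad (r⁻¹ • v) = -1 := by
        rw [quad, Matrix.smul_vecMul, smul_dotProduct, dotProduct_smul, ← quad, smul_eq_mul,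
          smul_eq_mul]
        have h2 : r * r = -quad v := Real.mul_self_sqrt hq.le
        field_simp
        linarith
      rw [eq_lift h1 (by simp only [Pi.smul_apply, smul_eq_mul]; exact mul_pos (by positivity) hv.1)]
      congr 1
      ext a
      rw [coneProj, Pi.smul_apply, smul_eq_mul, div_eq_inv_mul]
    ext a
    have h2 : mat (boostG (coneProj v) * g) (Fin.last n) = r⁻¹ • (v ᵥ* mat g) := by
      rw [← lastVec_vecMul (mat (boostG (coneProj v) * g)), mat_mul, ← Matrix.vecMul_vecMul,
        lastVec_vecMul, mat_boostG, boost_last (lift_last_pos _), hlift, Matrix.smul_vecMul]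
    rw [row, h2, coneProj, quad_vecMul, Pi.smul_apply, smul_eq_mul, div_eq_inv_mul]
  · have hvg : v ᵥ* mat g ∉ shell n := by
      intro h
      apply hv
      have hq : quad (v ᵥ* mat g) = quad v := quad_vecMul g v
      have h3 := vecMul_last_pos g⁻¹ (v := v ᵥ* mat g) (by linarith [h.2.2]) h.1
      rw [Matrix.vecMul_vecMul, ← mat_mul, mul_inv_cancel, mat_one, Matrix.vecMul_one] at h3
      exact ⟨h3, by rw [← hq]; exact h.2⟩
    rw [coneExt, coneExt, Set.indicator_of_notMem hv, Set.indicator_of_notMem hvg]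

/-- The hyperbolic measure is invariant under the right action of `G`. -/
lemma lintegral_hyp_row_mul {n : ℕ} (g : G n) {F : (Fin n → ℝ) → ℝ≥0∞} (hF : Measurable F) :
    ∫⁻ x, F (row (boostG x * g)) ∂hyp n = ∫⁻ x, F x ∂hyp n := by
  have hF' : Measurable fun x : Fin n → ℝ => F (row (boostG x * g)) :=
    hF.comp ((continuous_row n).comp ((continuous_boostG n).mul continuous_const)).measurable
  have h1 := lintegral_comp_vecMul (A := mat g) (g : SpecialLinearGroup (Fin (n + 1)) ℝ).2
    (measurable_coneExt hF)
  simp only [coneExt_vecMul] at h1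
  rw [lintegral_coneExt hF', lintegral_coneExt hF] at h1
  -- Both cone integrals carry the factor `∫₁² r^n dr`, which cancels once it is known to be nonzero
  -- and finite.
  refine (ENNReal.mul_right_inj ?_ ?_).1 h1
  · refine (setLIntegral_pos_iff (by fun_prop)).2 ?_ |>.ne'
    have : Function.support (fun r : ℝ => ENNReal.ofReal (r ^ n)) ∩ Set.Ioo 1 2 = Set.Ioo 1 2 := by
      refine Set.inter_eq_right.2 fun r hr => ?_
      have h1 : 0 < r := by linarith [hr.1]
      simpa using pow_pos h1 n
    rw [this, Real.volume_Ioo]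
    norm_num
  · have hle : ∫⁻ r in Set.Ioo (1 : ℝ) 2, ENNReal.ofReal (r ^ n) ≤
        ∫⁻ _ in Set.Ioo (1 : ℝ) 2, ENNReal.ofReal (2 ^ n) := by
      refine setLIntegral_mono measurable_const fun r hr => ENNReal.ofReal_le_ofReal ?_
      exact pow_le_pow_left₀ (by linarith [hr.1]) hr.2.le n
    refine (hle.trans_lt ?_).ne
    rw [setLIntegral_const, Real.volume_Ioo]
    exact ENNReal.mul_lt_top ENNReal.ofReal_lt_top ENNReal.ofReal_lt_top

/-! ### Haar measure on `G` -/

/-- A right translate of a Haar probability measure is again one, and such measures are unique. -/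
lemma isMulRightInvariant_of_compact {S : Type*} [Group S] [TopologicalSpace S]
    [IsTopologicalGroup S] [CompactSpace S] [MeasurableSpace S] [BorelSpace S] (κ : Measure S)
    [κ.IsHaarMeasure] [IsProbabilityMeasure κ] : κ.IsMulRightInvariant := by
  refine ⟨fun g => ?_⟩
  have : IsProbabilityMeasure (κ.map (· * g)) :=
    Measure.isProbabilityMeasure_map (measurable_mul_const g).aemeasurable
  exact Measure.isHaarMeasure_eq_of_isProbabilityMeasure _ _

/-- The product of `κ` on `K` and the hyperbolic measure, transported to `G`. -/
def lam {n : ℕ} (κ : Measure (K n)) : Measure (G n) :=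
  (κ.prod (hyp n)).map fun p => inclK n p.1 * boostG p.2

lemma continuous_inclK_mul_boostG (n : ℕ) :
    Continuous fun p : K n × (Fin n → ℝ) => inclK n p.1 * boostG p.2 :=
  ((continuous_inclK n).comp continuous_fst).mul ((continuous_boostG n).comp continuous_snd)

lemma lintegral_lam {n : ℕ} (κ : Measure (K n)) [SFinite κ] {f : G n → ℝ≥0∞} (hf : Measurable f) :
    ∫⁻ g, f g ∂lam κ = ∫⁻ x, ∫⁻ k, f (inclK n k * boostG x) ∂κ ∂hyp n := by
  have hm := (continuous_inclK_mul_boostG n).measurable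
  have hfm : Measurable fun p : K n × (Fin n → ℝ) => f (inclK n p.1 * boostG p.2) := hf.comp hm
  rw [lam, lintegral_map hf hm, lintegral_prod_symm _ hfm.aemeasurable]

/-- Averages over `K` only depend on the last row. -/
lemma lintegral_K_mul {n : ℕ} (κ : Measure (K n)) [κ.IsMulRightInvariant] (f : G n → ℝ≥0∞)
    (g : G n) :
    ∫⁻ k, f (inclK n k * g) ∂κ = ∫⁻ k, f (inclK n k * boostG (row g)) ∂κ := by
  obtain ⟨k₀, hk₀⟩ := exists_eq_inclK_mul_boostG g
  rw [← lintegral_mul_right_eq_self (fun k => f (inclK n k * boostG (row g))) k₀]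
  refine lintegral_congr fun k => ?_
  rw [map_mul, mul_assoc, ← hk₀]

lemma measurable_lintegral_K {n : ℕ} (κ : Measure (K n)) [SFinite κ] {f : G n → ℝ≥0∞}
    (hf : Measurable f) : Measurable fun x => ∫⁻ k, f (inclK n k * boostG x) ∂κ :=
  (hf.comp (continuous_inclK_mul_boostG n).measurable).lintegral_prod_left'

instance instIsMulRightInvariantK {n : ℕ} (κ : Measure (K n)) [κ.IsHaarMeasure] [IsProbabilityMeasure κ]
    : κ.IsMulRightInvariant := isMulRightInvariant_of_compact κ

/-- The average over `K` of `f(k b g)` depends only on the last row of `b g`, so the claim reduces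
to the invariance of the hyperbolic measure. -/
instance instIsMulRightInvariantLam {n : ℕ} (κ : Measure (K n)) [κ.IsHaarMeasure] [IsProbabilityMeasure κ]
    : (lam κ).IsMulRightInvariant := by
  refine ⟨fun g => Measure.ext_of_lintegral _ fun f hf => ?_⟩
  have hfg : Measurable fun x => f (x * g) := hf.comp (measurable_mul_const g)
  rw [lintegral_map hf (measurable_mul_const g), lintegral_lam κ hfg, lintegral_lam κ hf,
    ← lintegral_hyp_row_mul g (measurable_lintegral_K κ hf)]
  refine lintegral_congr fun x => ?_
  rw [← lintegral_K_mul κ f (boostG x * g)]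
  simp only [mul_assoc]

/-- Left invariance under `K` alone is immediate from the construction; it yields triviality of the
modular character on `K`. -/
lemma map_inclK_mul_lam {n : ℕ} (κ : Measure (K n)) [κ.IsHaarMeasure]
    (k₀ : K n) : (lam κ).map (inclK n k₀ * ·) = lam κ := by
  refine Measure.ext_of_lintegral _ fun f hf => ?_
  have hfg : Measurable fun x => f (inclK n k₀ * x) := hf.comp (measurable_const_mul _)
  rw [lintegral_map hf (measurable_const_mul _), lintegral_lam κ hfg, lintegral_lam κ hf]
  refine lintegral_congr fun x => ?_
  rw [← lintegral_mul_left_eq_self (fun k => f (inclK n k * boostG x)) k₀]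
  simp only [map_mul, mul_assoc]

lemma lam_preimage_row {n : ℕ} (κ : Measure (K n)) [κ.IsHaarMeasure] [IsProbabilityMeasure κ]
    {B : Set (Fin n → ℝ)} (hB : MeasurableSet B) :
    lam κ (row ⁻¹' B) = hyp n B := by
  have hB' : MeasurableSet (row ⁻¹' B : Set (G n)) := (continuous_row n).measurable hB
  rw [← lintegral_indicator_one hB', lintegral_lam κ (measurable_one.indicator hB'),
    ← lintegral_indicator_one hB]
  refine lintegral_congr fun x => ?_
  have : ∀ k : K n, (row ⁻¹' B).indicator (1 : G n → ℝ≥0∞) (inclK n k * boostG x) =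
      B.indicator 1 x := by
    intro k
    have : (row ⁻¹' B).indicator (1 : G n → ℝ≥0∞) (inclK n k * boostG x) =
      B.indicator 1 (row (inclK n k * boostG x)) := rfl
    rw [this, row_inclK_mul, row_boostG]
  simp [this]

/-! ### Compact balls in `G` and their measure -/

lemma isCompact_dotProduct_le (n : ℕ) (R : ℝ) : IsCompact {x : Fin n → ℝ | x ⬝ᵥ x ≤ R} := by
  have hbox : IsCompact (Set.univ.pi fun _ : Fin n => Set.Icc (-Real.sqrt R) (Real.sqrt R)) :=
    isCompact_univ_pi fun _ => isCompact_Icc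
  refine hbox.of_isClosed_subset ?_ ?_
  · exact isClosed_le (continuous_dotProduct_self n) continuous_const
  · intro x hx a _
    have h1 : x a * x a ≤ x ⬝ᵥ x :=
      Finset.single_le_sum (f := fun c => x c * x c) (fun c _ => mul_self_nonneg _)
        (Finset.mem_univ a)
    exact abs_le.1 (Real.abs_le_sqrt (by rw [sq]; exact h1.trans hx))

lemma isCompact_preimage_row (n : ℕ) (R : ℝ) :
    IsCompact (row ⁻¹' {x : Fin n → ℝ | x ⬝ᵥ x ≤ R} : Set (G n)) := by
  have h := ((isCompact_univ (X := K n)).prod (isCompact_dotProduct_le n R)).image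
    (continuous_inclK_mul_boostG n)
  convert h using 1
  ext g
  constructor
  · intro hg
    obtain ⟨k, hk⟩ := exists_eq_inclK_mul_boostG g
    exact ⟨(k, row g), ⟨Set.mem_univ _, hg⟩, hk.symm⟩
  · rintro ⟨⟨k, x⟩, ⟨-, hx⟩, rfl⟩
    rw [Set.mem_preimage, row_inclK_mul, row_boostG]
    exact hx

lemma preimage_row_mem_nhds_one (n : ℕ) :
    (row ⁻¹' {x : Fin n → ℝ | x ⬝ᵥ x ≤ 1} : Set (G n)) ∈ 𝓝 1 := by
  have hopen : IsOpen (row ⁻¹' {x : Fin n → ℝ | x ⬝ᵥ x < 1} : Set (G n)) :=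
    (isOpen_lt (continuous_dotProduct_self n) continuous_const).preimage (continuous_row n)
  refine mem_of_superset (hopen.mem_nhds ?_) fun g (hg : row g ⬝ᵥ row g < 1) => ?_
  swap
  · exact hg.le
  have h : row (1 : G n) = 0 := by
    ext a
    rw [row, mat_one, Matrix.one_apply_ne (Fin.castSucc_lt_last a).ne', Pi.zero_apply]
  rw [Set.mem_preimage, h]
  simp

instance instLocallyCompactSpaceG (n : ℕ) : LocallyCompactSpace (G n) :=
  (isCompact_preimage_row n 1).locallyCompactSpace_of_mem_nhds_of_group
    (preimage_row_mem_nhds_one n)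

lemma hyp_ball_lt_top (n : ℕ) (R : ℝ) : hyp n {x | x ⬝ᵥ x ≤ R} < ∞ := by
  have hc := isCompact_dotProduct_le n R
  rw [hyp, withDensity_apply _ hc.measurableSet]
  refine lt_of_le_of_lt (setLIntegral_mono measurable_const fun x _ =>
    (ENNReal.ofReal_le_ofReal (?_ : _ ≤ (1 : ℝ)))) ?_
  · rw [div_le_one (Real.sqrt_pos.2 (by linarith [dotProduct_self_nonneg' x]))]
    exact Real.one_le_sqrt.2 (by linarith [dotProduct_self_nonneg' x])
  · rw [setLIntegral_const]
    exact ENNReal.mul_lt_top ENNReal.ofReal_lt_top hc.measure_lt_top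

lemma hyp_ball_ne_zero (n : ℕ) : hyp n {x | x ⬝ᵥ x ≤ 1} ≠ 0 := by
  intro h0
  have hms := (isCompact_dotProduct_le n 1).measurableSet
  rw [hyp, withDensity_apply_eq_zero' (measurable_hyp_density n).aemeasurable] at h0
  have hset : {x : Fin n → ℝ | ENNReal.ofReal (1 / Real.sqrt (1 + x ⬝ᵥ x)) ≠ 0} = Set.univ := by
    ext x
    have : 0 < 1 + x ⬝ᵥ x := by linarith [dotProduct_self_nonneg' x]
    simpa using this
  rw [hset, Set.univ_inter] at h0
  have hopen : IsOpen {x : Fin n → ℝ | x ⬝ᵥ x < 1} :=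
    isOpen_lt (continuous_dotProduct_self n) continuous_const
  refine (hopen.measure_pos volume ⟨0, by simp⟩).ne' (measure_mono_null (fun x (hx : x ⬝ᵥ x < 1) => ?_) h0)
  exact hx.le

/-- Right invariance of `lam κ` becomes left invariance after inversion. A compact neighbourhood of
`1` of finite nonzero measure then suffices for a Haar measure. -/
lemma isHaarMeasure_lam_inv {n : ℕ} (κ : Measure (K n)) [κ.IsHaarMeasure] [IsProbabilityMeasure κ]
    : (lam κ).inv.IsHaarMeasure := by
  set C : Set (G n) := row ⁻¹' {x : Fin n → ℝ | x ⬝ᵥ x ≤ 1}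
  have hC : (lam κ).inv C⁻¹ = hyp n {x | x ⬝ᵥ x ≤ 1} := by
    rw [Measure.inv_apply, inv_inv,
      lam_preimage_row κ (isCompact_dotProduct_le n 1).measurableSet]
  refine Measure.isHaarMeasure_of_isCompact_nonempty_interior _ C⁻¹
    (isCompact_preimage_row n 1).inv ⟨1, ?_⟩ ?_ ?_
  · rw [mem_interior_iff_mem_nhds]
    exact inv_mem_nhds_one _ (preimage_row_mem_nhds_one n)
  · rw [hC]; exact hyp_ball_ne_zero n
  · rw [hC]; exact (hyp_ball_lt_top n 1).ne

/-- Inversion turns right translation of `(lam κ).inv` by `k` into left translation of `lam κ` by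
`k⁻¹`, which changes nothing. -/
lemma modularCharacterFun_inclK {n : ℕ} (κ : Measure (K n)) [κ.IsHaarMeasure] [IsProbabilityMeasure κ]
    (k : K n) :
    Measure.modularCharacterFun (inclK n k) = 1 := by
  have := isHaarMeasure_lam_inv κ
  have hmap : (lam κ).inv.map (· * inclK n k) = (lam κ).inv := by
    conv_rhs => rw [← map_inclK_mul_lam κ k⁻¹]
    simp only [Measure.inv_def]
    rw [Measure.map_map (measurable_mul_const _) measurable_inv,
      Measure.map_map measurable_inv (measurable_const_mul _)]
    congr 1
    ext1 g
    simp [map_inv]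
  rw [Measure.modularCharacterFun_eq_haarScalarFactor (lam κ).inv]
  have h : ∀ (ν : Measure (G n)) [ν.IsHaarMeasure], ν = (lam κ).inv →
      Measure.haarScalarFactor ν (lam κ).inv = 1 := by
    rintro ν _ rfl
    exact Measure.haarScalarFactor_self _
  exact h _ hmap

/-- The pushforward of a Haar measure under `φ` is again one, and `φ` intertwines right translation
by `g` with that by `φ g`. -/
lemma modularCharacterFun_equiv {S : Type*} [Group S] [TopologicalSpace S] [IsTopologicalGroup S]
    [LocallyCompactSpace S] (φ : S ≃ₜ* S) (g : S) :
    Measure.modularCharacterFun (φ g) = Measure.modularCharacterFun g := by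
  borelize S
  let ν : Measure S := Measure.haar
  have hφ : Measurable φ := φ.continuous_toFun.measurable
  have : (ν.map φ).IsHaarMeasure := φ.isHaarMeasure_map ν
  rw [Measure.modularCharacterFun_eq_haarScalarFactor (ν.map φ),
    Measure.modularCharacterFun_eq_haarScalarFactor ν]
  have hmap : (ν.map φ).map (· * φ g) = (ν.map (· * g)).map φ := by
    rw [Measure.map_map (measurable_mul_const _) hφ, Measure.map_map hφ (measurable_mul_const _)]
    congr 1
    ext1 x
    simp
  rw [← Measure.haarScalarFactor_map (ν.map (· * g)) ν φ]
  congr 1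

/-- On a boost `b` the Cartan involution gives `Δ(b⁻¹) = Δ(b)`, hence `Δ(b)² = 1`, and `Δ(b) = 1` by
nonnegativity. The factor in `K` contributes nothing. -/
lemma modularCharacterFun_G {n : ℕ} (κ : Measure (K n)) [κ.IsHaarMeasure] [IsProbabilityMeasure κ]
    (g : G n) : Measure.modularCharacterFun g = 1 := by
  obtain ⟨k, hk⟩ := exists_eq_inclK_mul_boostG g
  rw [hk, Measure.modularCharacterFun_map_mul, modularCharacterFun_inclK κ, one_mul]
  set b := boostG (row g)
  have h1 : Measure.modularCharacterFun b⁻¹ = Measure.modularCharacterFun b := by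
    rw [← cartan_boostG]
    exact modularCharacterFun_equiv (cartanEquiv n) b
  have h2 : Measure.modularCharacterFun b * Measure.modularCharacterFun b = 1 := by
    nth_rewrite 2 [← h1]
    rw [← Measure.modularCharacterFun_map_mul, mul_inv_cancel, Measure.modularCharacterFun_map_one]
  exact (pow_eq_one_iff_of_nonneg zero_le two_ne_zero).1 ((sq _).trans h2)

/-- `G` is unimodular; `lam κ` is a Haar measure. -/
instance instIsHaarMeasureLam {n : ℕ} (κ : Measure (K n)) [κ.IsHaarMeasure] [IsProbabilityMeasure κ]
    : (lam κ).IsHaarMeasure := by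
  have := isHaarMeasure_lam_inv κ
  have hr : (lam κ).inv.IsMulRightInvariant := by
    refine ⟨fun g => ?_⟩
    have h := Measure.isMulLeftInvariant_eq_smul ((lam κ).inv.map (· * g)) (lam κ).inv
    rwa [← Measure.modularCharacterFun_eq_haarScalarFactor, modularCharacterFun_G κ, one_smul] at h
  have hl : (lam κ).IsMulLeftInvariant := by
    rw [← (lam κ).inv_inv]
    infer_instance
  have hC := lam_preimage_row κ (isCompact_dotProduct_le n 1).measurableSet
  refine Measure.isHaarMeasure_of_isCompact_nonempty_interior _ _
    (isCompact_preimage_row n 1) ⟨1, mem_interior_iff_mem_nhds.2 (preimage_row_mem_nhds_one n)⟩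
    ?_ ?_
  · rw [hC]; exact hyp_ball_ne_zero n
  · rw [hC]; exact (hyp_ball_lt_top n 1).ne

/-- Every Haar measure on `G` is a positive multiple of `lam κ`. -/
lemma exists_eq_smul_lam {n : ℕ} (κ : Measure (K n)) [κ.IsHaarMeasure] [IsProbabilityMeasure κ]
    (μ : Measure (G n)) [μ.IsHaarMeasure] :
    ∃ c : NNReal, c ≠ 0 ∧ μ = c • lam κ :=
  ⟨_, (Measure.haarScalarFactor_pos_of_isHaarMeasure μ (lam κ)).ne',
    Measure.isMulLeftInvariant_eq_smul μ (lam κ)⟩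

/-! ### Coordinates on hyperbolic space -/

lemma horo_bijective {q : ℝ} (hq : 0 ≤ q) :
    Function.Bijective fun s : ℝ => Real.sinh s - Real.exp (-s) * q / 2 := by
  constructor
  · have hmono : StrictMono fun s : ℝ => Real.sinh s - Real.exp (-s) * q / 2 := by
      intro s t hst
      have h1 := Real.sinh_lt_sinh.2 hst
      have h2 : Real.exp (-t) * q ≤ Real.exp (-s) * q :=
        mul_le_mul_of_nonneg_right (Real.exp_le_exp.2 (by linarith)) hq
      simp only
      linarith
    exact hmono.injective
  · intro t
    have hsq : Real.sqrt (t ^ 2 + 1 + q) ^ 2 = t ^ 2 + 1 + q := Real.sq_sqrt (by positivity)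
    have hpos : 0 < t + Real.sqrt (t ^ 2 + 1 + q) := by
      have h1 : |t| < Real.sqrt (t ^ 2 + 1 + q) := by
        rw [Real.lt_sqrt (abs_nonneg t), sq_abs]
        linarith
      linarith [neg_abs_le t]
    -- With `E = e^s` the equation reads `E² - 2tE - (1 + q) = 0`; this is the logarithm of its
    -- positive root.
    refine ⟨Real.log (t + Real.sqrt (t ^ 2 + 1 + q)), ?_⟩
    simp only [Real.sinh_eq, Real.exp_neg, Real.exp_log hpos]
    field_simp
    nlinarith

/-- The derivative `cosh s + e^{-s} q / 2` of the substitution equals `√(1 + t² + q)` and cancels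
the hyperbolic density. -/
lemma lintegral_horo {q : ℝ} (hq : 0 ≤ q) (f : ℝ → ℝ≥0∞) :
    ∫⁻ s, f (Real.sinh s - Real.exp (-s) * q / 2) =
      ∫⁻ t, ENNReal.ofReal (1 / Real.sqrt (1 + (t ^ 2 + q))) * f t := by
  set φ : ℝ → ℝ := fun s => Real.sinh s - Real.exp (-s) * q / 2 with hφ
  have hb := horo_bijective hq
  have hderiv : ∀ s ∈ Set.univ, HasDerivWithinAt φ (Real.cosh s + Real.exp (-s) * q / 2)
      Set.univ s := by
    intro s _
    have h1 : HasDerivAt (fun s : ℝ => Real.exp (-s)) (-Real.exp (-s)) s := by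
      simpa using (hasDerivAt_neg s).exp
    have h2 := (Real.hasDerivAt_sinh s).sub ((h1.mul_const q).div_const 2)
    exact (h2.congr_deriv (by ring)).hasDerivWithinAt
  have hcov := lintegral_image_eq_lintegral_abs_deriv_mul MeasurableSet.univ hderiv
    hb.1.injOn fun t => ENNReal.ofReal (1 / Real.sqrt (1 + (t ^ 2 + q))) * f t
  rw [Set.image_univ, hb.2.range_eq, setLIntegral_univ, setLIntegral_univ] at hcov
  rw [hcov]
  refine lintegral_congr fun s => ?_
  have hpos : 0 < Real.cosh s + Real.exp (-s) * q / 2 := by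
    have := Real.cosh_pos s
    positivity
  have hsq : 1 + (φ s ^ 2 + q) = (Real.cosh s + Real.exp (-s) * q / 2) ^ 2 := by
    have h1 := Real.cosh_sq s
    have h2 : Real.exp (-s) * (Real.cosh s + Real.sinh s) = 1 := by
      rw [Real.cosh_add_sinh, ← Real.exp_add]
      simp
    simp only [hφ]
    linear_combination (-1) * h1 - q * h2
  rw [hsq, Real.sqrt_sq hpos.le, abs_of_pos hpos, ← mul_assoc, ← ENNReal.ofReal_mul hpos.le,
    mul_one_div_cancel hpos.ne', ENNReal.ofReal_one, one_mul]

lemma measurable_hyp_density_mul {n : ℕ} {F : (Fin n → ℝ) → ℝ≥0∞} (hF : Measurable F) :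
    Measurable fun x : Fin n → ℝ => ENNReal.ofReal (1 / Real.sqrt (1 + x ⬝ᵥ x)) * F x :=
  (measurable_hyp_density n).mul hF

lemma measurable_cons {m : ℕ} {α : Type*} [MeasurableSpace α] {t : α → ℝ} {z : α → Fin m → ℝ}
    (ht : Measurable t) (hz : Measurable z) :
    Measurable fun p => (Fin.cons (α := fun _ => ℝ) (t p) (z p) : Fin (m + 1) → ℝ) := by
  refine measurable_pi_iff.2 fun a => ?_
  refine Fin.cases ?_ (fun b => ?_) a
  · simpa using ht
  · simpa using (measurable_pi_iff.1 hz b)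

/-- At fixed `s`, substitute `z = e^s x`; the weight `e^{ms}` is precisely the Jacobian. -/
lemma lintegral_horo_slice {m : ℕ} {F : (Fin (m + 1) → ℝ) → ℝ≥0∞} (hF : Measurable F) (s : ℝ) :
    ∫⁻ x : Fin m → ℝ,
      F (Fin.cons (α := fun _ => ℝ) (Real.sinh s - Real.exp s * (x ⬝ᵥ x) / 2) (Real.exp s • x)) *
        ENNReal.ofReal (Real.exp (m * s)) =
      ∫⁻ z : Fin m → ℝ,
        F (Fin.cons (α := fun _ => ℝ) (Real.sinh s - Real.exp (-s) * (z ⬝ᵥ z) / 2) z) := by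
  have hq := (continuous_dotProduct_self m).measurable
  have hcons : Measurable fun z : Fin m → ℝ => (Fin.cons (α := fun _ => ℝ)
      (Real.sinh s - Real.exp (-s) * (z ⬝ᵥ z) / 2) z : Fin (m + 1) → ℝ) :=
    measurable_cons (measurable_const.sub ((measurable_const.mul hq).div_const 2)) measurable_id
  rw [← lintegral_comp_smul_mul (Real.exp_pos s) (f := fun z : Fin m → ℝ => F (Fin.cons
    (α := fun _ => ℝ) (Real.sinh s - Real.exp (-s) * (z ⬝ᵥ z) / 2) z)) (hF.comp hcons)]
  refine lintegral_congr fun x => ?_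
  have h1 : Real.exp (-s) * ((Real.exp s • x) ⬝ᵥ (Real.exp s • x)) = Real.exp s * (x ⬝ᵥ x) := by
    rw [smul_dotProduct, dotProduct_smul, smul_eq_mul, smul_eq_mul, Real.exp_neg]
    have := Real.exp_pos s
    field_simp
  rw [Real.exp_nat_mul, h1]

/-- Horospherical coordinates. -/
lemma lintegral_hyp_horo {m : ℕ} {F : (Fin (m + 1) → ℝ) → ℝ≥0∞} (hF : Measurable F) :
    ∫⁻ x : Fin m → ℝ, ∫⁻ s : ℝ,
      F (Fin.cons (α := fun _ => ℝ) (Real.sinh s - Real.exp s * (x ⬝ᵥ x) / 2) (Real.exp s • x)) *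
        ENNReal.ofReal (Real.exp (m * s)) = ∫⁻ y, F y ∂hyp (m + 1) := by
  have hq := (continuous_dotProduct_self m).measurable
  have hq1 : Measurable fun p : (Fin m → ℝ) × ℝ => p.1 ⬝ᵥ p.1 := hq.comp measurable_fst
  have hm1 : Measurable fun p : (Fin m → ℝ) × ℝ =>
      F (Fin.cons (α := fun _ => ℝ) (Real.sinh p.2 - Real.exp p.2 * (p.1 ⬝ᵥ p.1) / 2)
        (Real.exp p.2 • p.1)) * ENNReal.ofReal (Real.exp (m * p.2)) := by
    refine Measurable.mul (hF.comp (measurable_cons ?_ ?_)) (by fun_prop)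
    · exact (Real.measurable_sinh.comp measurable_snd).sub
        (((Real.measurable_exp.comp measurable_snd).mul hq1).div_const 2)
    · exact (Real.measurable_exp.comp measurable_snd).smul measurable_fst
  have hm2 : Measurable fun p : (Fin m → ℝ) × ℝ =>
      F (Fin.cons (α := fun _ => ℝ) (Real.sinh p.2 - Real.exp (-p.2) * (p.1 ⬝ᵥ p.1) / 2) p.1) := by
    refine hF.comp (measurable_cons ?_ measurable_fst)
    exact (Real.measurable_sinh.comp measurable_snd).sub
        (((Real.measurable_exp.comp measurable_snd.neg).mul hq1).div_const 2)
  -- The two substitutions need opposite orders of integration: `x` is rescaled for fixed `s`, then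
  -- `s` is replaced by the first coordinate for fixed `z`.
  rw [lintegral_lintegral_swap hm1.aemeasurable]
  simp only [lintegral_horo_slice hF]
  rw [← lintegral_lintegral_swap hm2.aemeasurable, lintegral_hyp hF]
  have hmp := (volume_preserving_piFinSuccAbove (fun _ : Fin (m + 1) => ℝ) 0).symm
  have hm4 : Measurable fun p : ℝ × (Fin m → ℝ) =>
      ENNReal.ofReal (1 / Real.sqrt (1 +
        (MeasurableEquiv.piFinSuccAbove (fun _ : Fin (m + 1) => ℝ) 0).symm p ⬝ᵥ
        (MeasurableEquiv.piFinSuccAbove (fun _ : Fin (m + 1) => ℝ) 0).symm p)) *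
        F ((MeasurableEquiv.piFinSuccAbove (fun _ : Fin (m + 1) => ℝ) 0).symm p) :=
    (measurable_hyp_density_mul hF).comp (MeasurableEquiv.measurable _)
  rw [← hmp.lintegral_comp (measurable_hyp_density_mul hF), Measure.volume_eq_prod,
    lintegral_prod_symm _ hm4.aemeasurable]
  refine lintegral_congr fun z => ?_
  rw [lintegral_horo (dotProduct_self_nonneg' z)
    fun t => F (Fin.cons (α := fun _ => ℝ) t z)]
  refine lintegral_congr fun t => ?_
  have hc : (MeasurableEquiv.piFinSuccAbove (fun _ : Fin (m + 1) => ℝ) 0).symm (t, z) =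
      Fin.cons (α := fun _ => ℝ) t z := by
    simp [MeasurableEquiv.piFinSuccAbove]
    rfl
  rw [hc]
  congr 5
  simp only [dotProduct]
  rw [Fin.sum_univ_succ]
  simp [sq]

/-- The vector with blocks `x` and `y`. -/
def glue {p q n : ℕ} (h : p + q = n) (x : Fin p → ℝ) (y : Fin q → ℝ) : Fin n → ℝ :=
  fun a => Sum.elim x y ((blockEquiv h).symm a)

lemma glue_inl {p q n : ℕ} (h : p + q = n) (x : Fin p → ℝ) (y : Fin q → ℝ) (a : Fin p) :
    glue h x y (blockEquiv h (Sum.inl a)) = x a := by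
  rw [glue, Equiv.symm_apply_apply, Sum.elim_inl]

lemma glue_inr {p q n : ℕ} (h : p + q = n) (x : Fin p → ℝ) (y : Fin q → ℝ) (b : Fin q) :
    glue h x y (blockEquiv h (Sum.inr b)) = y b := by
  rw [glue, Equiv.symm_apply_apply, Sum.elim_inr]

lemma glue_dotProduct_self {p q n : ℕ} (h : p + q = n) (x : Fin p → ℝ) (y : Fin q → ℝ) :
    glue h x y ⬝ᵥ glue h x y = x ⬝ᵥ x + y ⬝ᵥ y := by
  rw [dotProduct, ← (blockEquiv h).sum_comp, Fintype.sum_sum_type]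
  simp only [glue_inl, glue_inr, dotProduct]

lemma measurable_glue {p q n : ℕ} (h : p + q = n) {α : Type*} [MeasurableSpace α]
    {x : α → Fin p → ℝ} {y : α → Fin q → ℝ} (hx : Measurable x) (hy : Measurable y) :
    Measurable fun t => glue h (x t) (y t) := by
  refine measurable_pi_iff.2 fun a => ?_
  obtain ⟨b, rfl⟩ := (blockEquiv h).surjective a
  rcases b with b | b
  · simp only [glue_inl]; exact measurable_pi_iff.1 hx b
  · simp only [glue_inr]; exact measurable_pi_iff.1 hy b

lemma lintegral_glue {p q n : ℕ} (h : p + q = n) {F : (Fin n → ℝ) → ℝ≥0∞} (hF : Measurable F) :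
    ∫⁻ z, F z = ∫⁻ x, ∫⁻ y, F (glue h x y) := by
  have h1 := volume_measurePreserving_piCongrLeft (fun _ : Fin n => ℝ) (blockEquiv h)
  have h2 := volume_measurePreserving_sumPiEquivProdPi_symm (fun _ : Fin p ⊕ Fin q => ℝ)
  have h3 := h1.comp h2
  have hfun : ∀ z : (Fin p → ℝ) × (Fin q → ℝ),
      ((MeasurableEquiv.piCongrLeft (fun _ : Fin n => ℝ) (blockEquiv h)) ∘
        (MeasurableEquiv.sumPiEquivProdPi fun _ : Fin p ⊕ Fin q => ℝ).symm) z =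
      glue h z.1 z.2 := by
    intro z
    ext a
    obtain ⟨b, rfl⟩ := (blockEquiv h).surjective a
    rw [Function.comp_apply, MeasurableEquiv.piCongrLeft_apply_apply]
    rcases b with b | b
    · rw [glue_inl]; rfl
    · rw [glue_inr]; rfl
  rw [← h3.lintegral_comp hF, Measure.volume_eq_prod]
  simp only [hfun]
  have hm : Measurable fun z : (Fin p → ℝ) × (Fin q → ℝ) => F (glue h z.1 z.2) :=
    hF.comp (measurable_glue h measurable_fst measurable_snd)
  rw [lintegral_prod _ hm.aemeasurable]

/-- Fibering hyperbolic `n`-space over `ℝ^p` with hyperbolic fibres. -/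
lemma lintegral_hyp_glue {p j n : ℕ} (h : p + j = n) {F : (Fin n → ℝ) → ℝ≥0∞}
    (hF : Measurable F) :
    ∫⁻ z, F z ∂hyp n = ∫⁻ x : Fin p → ℝ,
      ENNReal.ofReal (Real.sqrt (1 + x ⬝ᵥ x) ^ j / Real.sqrt (1 + x ⬝ᵥ x)) *
        ∫⁻ y, F (glue h x (Real.sqrt (1 + x ⬝ᵥ x) • y)) ∂hyp j := by
  rw [lintegral_hyp hF, lintegral_glue h (measurable_hyp_density_mul hF)]
  refine lintegral_congr fun x => ?_
  have hpos : 0 < 1 + x ⬝ᵥ x := by linarith [dotProduct_self_nonneg' x]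
  set c := Real.sqrt (1 + x ⬝ᵥ x) with hc
  have hc0 : 0 < c := Real.sqrt_pos.2 hpos
  have hc2 : c ^ 2 = 1 + x ⬝ᵥ x := Real.sq_sqrt hpos.le
  have hm : Measurable fun y : Fin j → ℝ => glue h x y :=
    measurable_glue h measurable_const measurable_id
  have hFc : Measurable fun y : Fin j → ℝ => F (glue h x (c • y)) :=
    hF.comp (hm.comp (measurable_const_smul c))
  have hdm : Measurable fun y : Fin j → ℝ =>
      ENNReal.ofReal (1 / Real.sqrt (1 + glue h x y ⬝ᵥ glue h x y)) * F (glue h x y) :=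
    (measurable_hyp_density_mul hF).comp hm
  -- Scaling the second block by `c` gives the Jacobian `c^j` and the factorization `1 + ‖x‖² + ‖c
  -- y‖² = c² (1 + ‖y‖²)`, so the density splits off `1 / c`.
  rw [lintegral_hyp hFc, ← lintegral_const_mul _ (measurable_hyp_density_mul hFc),
    ← lintegral_comp_smul_mul hc0 hdm]
  refine lintegral_congr fun y => ?_
  rw [glue_dotProduct_self, smul_dotProduct, dotProduct_smul, smul_eq_mul, smul_eq_mul,
    ← add_assoc, ← hc2]
  have h1 : c ^ 2 + c * (c * (y ⬝ᵥ y)) = c ^ 2 * (1 + y ⬝ᵥ y) := by ring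
  have hy : 0 < 1 + y ⬝ᵥ y := by linarith [dotProduct_self_nonneg' y]
  have hy' := Real.sqrt_pos.2 hy
  rw [h1, Real.sqrt_mul (by positivity), Real.sqrt_sq hc0.le, mul_right_comm, ← mul_assoc,
    ← ENNReal.ofReal_mul (by positivity), ← ENNReal.ofReal_mul (by positivity)]
  congr 2
  field_simp

/-! ### Polar coordinates -/

lemma lintegral_fun_norm {E : Type*} [NormedAddCommGroup E] [NormedSpace ℝ E] [MeasurableSpace E]
    [BorelSpace E] [FiniteDimensional ℝ E] [Nontrivial E] (μ : Measure E) [μ.IsAddHaarMeasure]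
    {f : ℝ → ℝ≥0∞} (hf : Measurable f) :
    ∫⁻ x, f ‖x‖ ∂μ = μ.toSphere Set.univ *
      ∫⁻ r in Set.Ioi (0 : ℝ), ENNReal.ofReal (r ^ (Module.finrank ℝ E - 1)) * f r := by
  have hfs : Measurable fun r : Set.Ioi (0 : ℝ) => f r := hf.comp measurable_subtype_coe
  have hfs2 : Measurable fun p : Metric.sphere (0 : E) 1 × Set.Ioi (0 : ℝ) => f p.2 :=
    hfs.comp measurable_snd
  have hd : Measurable fun r : Set.Ioi (0 : ℝ) =>
      ENNReal.ofReal ((r : ℝ) ^ (Module.finrank ℝ E - 1)) := by fun_prop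
  calc ∫⁻ x, f ‖x‖ ∂μ
      = ∫⁻ x : ({(0)}ᶜ : Set E), f ‖x.1‖ ∂(μ.comap (↑)) := by
        rw [lintegral_subtype_comap (measurableSet_singleton _).compl fun x => f ‖x‖,
          restrict_compl_singleton]
    _ = ∫⁻ p, f p.2 ∂μ.toSphere.prod (.volumeIoiPow (Module.finrank ℝ E - 1)) := by
        rw [← μ.measurePreserving_homeomorphUnitSphereProd.lintegral_comp hfs2]
        simp
    _ = μ.toSphere Set.univ *
        ∫⁻ r : Set.Ioi (0 : ℝ), f r ∂.volumeIoiPow (Module.finrank ℝ E - 1) := by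
        rw [lintegral_prod _ hfs2.aemeasurable]
        simp [mul_comm]
    _ = _ := by
        rw [Measure.volumeIoiPow, lintegral_withDensity_eq_lintegral_mul _ hd hfs]
        simp only [Pi.mul_apply]
        rw [lintegral_subtype_comap measurableSet_Ioi
          fun r : ℝ => ENNReal.ofReal (r ^ (Module.finrank ℝ E - 1)) * f r]

/-- The constant is the area of the unit sphere. Lengths are Euclidean here, so the integral is
transported from `EuclideanSpace`. -/
lemma exists_lintegral_radial (i : ℕ) : ∃ C : ℝ≥0∞, C ≠ 0 ∧ C ≠ ∞ ∧
    ∀ f : ℝ → ℝ≥0∞, Measurable f → ∫⁻ x : Fin (i + 1) → ℝ, f (Real.sqrt (x ⬝ᵥ x)) =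
      C * ∫⁻ r in Set.Ioi (0 : ℝ), ENNReal.ofReal (r ^ i) * f r := by
  let E := EuclideanSpace ℝ (Fin (i + 1))
  refine ⟨(volume : Measure E).toSphere Set.univ, ?_, measure_ne_top _ _, fun f hf => ?_⟩
  · rw [Ne, Measure.measure_univ_eq_zero]
    exact Measure.toSphere_ne_zero _
  · have h1 := lintegral_fun_norm (volume : Measure E) hf
    rw [finrank_euclideanSpace_fin, Nat.add_sub_cancel] at h1
    rw [← h1]
    have hm : Measurable fun x : Fin (i + 1) → ℝ => f (Real.sqrt (x ⬝ᵥ x)) :=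
      hf.comp (continuous_dotProduct_self _).measurable.sqrt
    rw [← (PiLp.volume_preserving_ofLp (Fin (i + 1))).lintegral_comp hm]
    refine lintegral_congr fun x => ?_
    rw [EuclideanSpace.norm_eq]
    simp [dotProduct, sq]

/-- Polar coordinates with the sphere swept out by `SO (i + 1)`. -/
lemma exists_lintegral_polar {i : ℕ} (hi : i ≠ 0) (ρ : Measure (SO (i + 1))) [ρ.IsHaarMeasure]
    [IsProbabilityMeasure ρ] : ∃ C : ℝ≥0∞, C ≠ 0 ∧ C ≠ ∞ ∧
    ∀ F : (Fin (i + 1) → ℝ) → ℝ≥0∞, Measurable F → ∫⁻ x, F x =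
      C * ∫⁻ A, ∫⁻ r in Set.Ioi (0 : ℝ), ENNReal.ofReal (r ^ i) * F (r • mat A 0) ∂volume ∂ρ := by
  obtain ⟨C, hC0, hCt, hC⟩ := exists_lintegral_radial i
  refine ⟨C, hC0, hCt, fun F hF => ?_⟩
  have hmat : Continuous fun A : SO (i + 1) => mat A := continuous_mat
  have hvm : Continuous fun p : (Fin (i + 1) → ℝ) × SO (i + 1) => p.1 ᵥ* mat p.2 :=
    Continuous.matrix_vecMul continuous_fst (hmat.comp continuous_snd)
  have hFvm : Measurable fun p : (Fin (i + 1) → ℝ) × SO (i + 1) => F (p.1 ᵥ* mat p.2) :=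
    hF.comp hvm.measurable
  let Φ : ℝ → ℝ≥0∞ := fun r => ∫⁻ A, F (Pi.single 0 r ᵥ* mat A) ∂ρ
  have hsm : Measurable fun p : ℝ × SO (i + 1) => F (Pi.single 0 p.1 ᵥ* mat p.2) := by
    refine hF.comp (Continuous.measurable ?_)
    refine Continuous.matrix_vecMul ?_ (hmat.comp continuous_snd)
    exact (continuous_single (A := fun _ : Fin (i + 1) => ℝ) 0).comp continuous_fst
  have hΦ : Measurable Φ := hsm.lintegral_prod_right'
  -- Lebesgue measure is rotation invariant, so `F` may be averaged over `SO(i+1)`. By transitivity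
  -- on spheres the average depends only on the length of `x`.
  have h1 : ∫⁻ x, F x = ∫⁻ x : Fin (i + 1) → ℝ, Φ (Real.sqrt (x ⬝ᵥ x)) := by
    calc ∫⁻ x, F x = ∫⁻ _ : SO (i + 1), ∫⁻ x, F x ∂volume ∂ρ := by simp
      _ = ∫⁻ A, ∫⁻ x, F (x ᵥ* mat A) ∂volume ∂ρ := by
          refine lintegral_congr fun A => ?_
          rw [lintegral_comp_vecMul A.1.2 hF]
      _ = ∫⁻ x, ∫⁻ A, F (x ᵥ* mat A) ∂ρ :=
          (lintegral_lintegral_swap hFvm.aemeasurable).symm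
      _ = _ := by
          refine lintegral_congr fun x => ?_
          obtain ⟨A₀, hA₀⟩ := exists_SO_vecMul_eq hi x
          change _ = ∫⁻ A, F (Pi.single 0 (Real.sqrt (x ⬝ᵥ x)) ᵥ* mat A) ∂ρ
          rw [← lintegral_mul_left_eq_self
            (fun A => F (Pi.single 0 (Real.sqrt (x ⬝ᵥ x)) ᵥ* mat A)) A₀]
          refine lintegral_congr fun A => ?_
          rw [mat_mul, ← Matrix.vecMul_vecMul, hA₀]
  rw [h1, hC Φ hΦ]
  congr 1
  have h2 : ∀ r : ℝ, ENNReal.ofReal (r ^ i) * Φ r =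
      ∫⁻ A, ENNReal.ofReal (r ^ i) * F (r • mat A 0) ∂ρ := by
    intro r
    have hmr : Measurable fun A : SO (i + 1) => F (Pi.single 0 r ᵥ* mat A) :=
      hsm.comp measurable_prodMk_left
    rw [← lintegral_const_mul _ hmr]
    refine lintegral_congr fun A => ?_
    rw [Matrix.single_vecMul]
    rfl
  simp only [h2]
  refine lintegral_lintegral_swap ?_
  refine Measurable.aemeasurable ?_
  have : Measurable fun p : ℝ × SO (i + 1) => ENNReal.ofReal (p.1 ^ i) *
      F (Pi.single 0 p.1 ᵥ* mat p.2) := Measurable.mul (by fun_prop) hsm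
  convert this using 3 with p
  rw [Matrix.single_vecMul]
  rfl

lemma lintegral_sinh (f : ℝ → ℝ≥0∞) :
    ∫⁻ r in Set.Ioi (0 : ℝ), f r =
      ∫⁻ s in Set.Ioi (0 : ℝ), ENNReal.ofReal (Real.cosh s) * f (Real.sinh s) := by
  have himage : Real.sinh '' Set.Ioi 0 = Set.Ioi 0 := by
    ext r
    constructor
    · rintro ⟨s, hs, rfl⟩
      exact Real.sinh_pos_iff.2 hs
    · intro hr
      exact ⟨Real.arsinh r, Real.arsinh_pos_iff.2 hr, Real.sinh_arsinh r⟩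
  have h := lintegral_image_eq_lintegral_abs_deriv_mul measurableSet_Ioi
    (fun s _ => (Real.hasDerivAt_sinh s).hasDerivWithinAt (s := Set.Ioi 0))
    Real.sinh_injective.injOn f
  rw [himage] at h
  rw [h]
  simp only [abs_of_pos (Real.cosh_pos _)]

/-- Hyperbolic measure in `SO (i + 1) × ℝ × ℍ^j` coordinates, for `i ≠ 0`. -/
lemma exists_lintegral_hyp_polar {i j n : ℕ} (hi : i ≠ 0) (h : i + 1 + j = n)
    (ρ : Measure (SO (i + 1))) [ρ.IsHaarMeasure] [IsProbabilityMeasure ρ] :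
    ∃ C : ℝ≥0∞, C ≠ 0 ∧ C ≠ ∞ ∧ ∀ F : (Fin n → ℝ) → ℝ≥0∞, Measurable F →
      ∫⁻ z, F z ∂hyp n = C * ∫⁻ A, ∫⁻ s in Set.Ioi (0 : ℝ),
        ENNReal.ofReal (Real.sinh s ^ i * Real.cosh s ^ j) *
          ∫⁻ y, F (glue h (Real.sinh s • mat A 0) (Real.cosh s • y)) ∂hyp j ∂volume ∂ρ := by
  obtain ⟨C, hC0, hCt, hC⟩ := exists_lintegral_polar hi ρ
  refine ⟨C, hC0, hCt, fun F hF => ?_⟩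
  have hq := (continuous_dotProduct_self (i + 1)).measurable
  have hq1 : Measurable fun p : (Fin (i + 1) → ℝ) × (Fin j → ℝ) => p.1 ⬝ᵥ p.1 :=
    hq.comp measurable_fst
  have hjoint : Measurable fun p : (Fin (i + 1) → ℝ) × (Fin j → ℝ) =>
      F (glue h p.1 (Real.sqrt (1 + p.1 ⬝ᵥ p.1) • p.2)) := by
    refine hF.comp (measurable_glue h measurable_fst ?_)
    exact (measurable_const.add hq1).sqrt.smul measurable_snd
  rw [lintegral_hyp_glue h hF, hC]
  · congr 1
    refine lintegral_congr fun A => ?_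
    rw [lintegral_sinh]
    refine setLIntegral_congr_fun measurableSet_Ioi fun s hs => ?_
    have hrow : mat A 0 ⬝ᵥ mat A 0 = 1 := by
      have h1 := mul_eq_one_comm.1 (mem_SO.1 A.2)
      have h2 := congrFun (congrFun h1 0) 0
      rw [Matrix.one_apply_eq] at h2
      exact h2
    -- With `r = sinh s` the fibre scale is `cosh s`, and the factor `cosh s` from `dr` cancels the
    -- denominator in the fibration formula.
    have hc : Real.sqrt (1 + (Real.sinh s • mat A 0) ⬝ᵥ (Real.sinh s • mat A 0)) =
        Real.cosh s := by
      rw [smul_dotProduct, dotProduct_smul, hrow, smul_eq_mul, smul_eq_mul, mul_one]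
      rw [show 1 + Real.sinh s * Real.sinh s = Real.cosh s ^ 2 by rw [Real.cosh_sq]; ring,
        Real.sqrt_sq (Real.cosh_pos s).le]
    have hs0 : 0 < Real.sinh s := Real.sinh_pos_iff.2 hs
    have hc0 := Real.cosh_pos s
    rw [hc, ← mul_assoc, ← mul_assoc, ← ENNReal.ofReal_mul (by positivity),
      ← ENNReal.ofReal_mul (by positivity)]
    congr 2
    field_simp
  · exact Measurable.mul (by fun_prop) hjoint.lintegral_prod_right'

/-- For `i = 0` the sphere consists of two points and `SO(1)` is trivial, so the two half-lines must
be kept apart. This is the origin of the two terms in that case. -/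
lemma lintegral_fin_one {F : (Fin 1 → ℝ) → ℝ≥0∞} (hF : Measurable F) :
    ∫⁻ x, F x = ∫⁻ r in Set.Ioi (0 : ℝ), (F (fun _ => r) + F (fun _ => -r)) := by
  have hmp : MeasurePreserving (MeasurableEquiv.funUnique (Fin 1) ℝ).symm volume volume := by
    convert (volume_preserving_funUnique (Fin 1) ℝ).symm
  have hc : Measurable fun (r : ℝ) (_ : Fin 1) => r := measurable_pi_iff.2 fun _ => measurable_id
  have hFc : Measurable fun r : ℝ => F fun _ => r := hF.comp hc
  have h1 : ∫⁻ x, F x = ∫⁻ r : ℝ, F fun _ => r := by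
    rw [← hmp.lintegral_comp hF]
    rfl
  rw [h1, lintegral_add_left hFc, ← lintegral_add_compl _ (measurableSet_Ioi (a := (0 : ℝ)))]
  congr 1
  rw [Set.compl_Ioi, ← setLIntegral_congr (Iio_ae_eq_Iic (a := (0 : ℝ)))]
  have hneg := (Measure.measurePreserving_neg (volume : Measure ℝ)).setLIntegral_comp_preimage
    (measurableSet_Iio (a := (0 : ℝ))) hFc
  rw [← hneg]
  congr 2
  ext r
  simp

/-- Hyperbolic measure in `ℝ × ℍ^j` coordinates. -/
lemma lintegral_hyp_fermi {j n : ℕ} (h : 0 + 1 + j = n) {F : (Fin n → ℝ) → ℝ≥0∞}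
    (hF : Measurable F) :
    ∫⁻ z, F z ∂hyp n = ∫⁻ s in Set.Ioi (0 : ℝ), ENNReal.ofReal (Real.cosh s ^ j) *
      (∫⁻ y, F (glue h (fun _ => Real.sinh s) (Real.cosh s • y)) ∂hyp j +
        ∫⁻ y, F (glue h (fun _ => -Real.sinh s) (Real.cosh s • y)) ∂hyp j) := by
  have hq := (continuous_dotProduct_self (0 + 1)).measurable
  have hq1 : Measurable fun p : (Fin (0 + 1) → ℝ) × (Fin j → ℝ) => p.1 ⬝ᵥ p.1 :=
    hq.comp measurable_fst
  have hjoint : Measurable fun p : (Fin (0 + 1) → ℝ) × (Fin j → ℝ) =>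
      F (glue h p.1 (Real.sqrt (1 + p.1 ⬝ᵥ p.1) • p.2)) := by
    refine hF.comp (measurable_glue h measurable_fst ?_)
    exact (measurable_const.add hq1).sqrt.smul measurable_snd
  rw [lintegral_hyp_glue h hF, lintegral_fin_one, lintegral_sinh]
  · refine setLIntegral_congr_fun measurableSet_Ioi fun s _ => ?_
    have hc1 : Real.sqrt (1 + (fun _ : Fin (0 + 1) => Real.sinh s) ⬝ᵥ fun _ => Real.sinh s) =
        Real.cosh s := by
      rw [show 1 + (fun _ : Fin (0 + 1) => Real.sinh s) ⬝ᵥ (fun _ => Real.sinh s) =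
        Real.cosh s ^ 2 by rw [Real.cosh_sq]; simp [dotProduct]; ring,
        Real.sqrt_sq (Real.cosh_pos s).le]
    have hc2 : Real.sqrt (1 + (fun _ : Fin (0 + 1) => -Real.sinh s) ⬝ᵥ fun _ => -Real.sinh s) =
        Real.cosh s := by
      rw [← hc1]
      simp [dotProduct]
    have hc0 := Real.cosh_pos s
    rw [hc1, hc2, ← mul_add, ← mul_assoc, ← ENNReal.ofReal_mul (by positivity)]
    congr 2
    field_simp
  · exact Measurable.mul (by fun_prop) hjoint.lintegral_prod_right'

/-! ### The one-parameter group `a(s)` -/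

lemma lift_single_sinh (m : ℕ) (s : ℝ) :
    lift (Pi.single (0 : Fin (m + 1)) (Real.sinh s)) =
      Pi.single 0 (Real.sinh s) + Pi.single (Fin.last (m + 1)) (Real.cosh s) := by
  ext b
  refine Fin.lastCases ?_ (fun c => ?_) b
  · rw [lift_last]
    have : Real.sqrt (1 + Real.sinh s * Real.sinh s) = Real.cosh s := by
      rw [show 1 + Real.sinh s * Real.sinh s = Real.cosh s ^ 2 by rw [Real.cosh_sq]; ring,
        Real.sqrt_sq (Real.cosh_pos s).le]
    simp [this]
  · rw [lift_castSucc, Pi.add_apply, Pi.single_eq_of_ne (Fin.castSucc_lt_last c).ne, add_zero]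
    by_cases hc : c = 0
    · subst hc; simp
    · rw [Pi.single_eq_of_ne hc, Pi.single_eq_of_ne]
      simpa using hc

/-- `a(s)` is the boost to the point `(sinh s, 0, cosh s)`; the entries agree because `sinh² s =
(cosh s - 1)(cosh s + 1)`. Membership in `G` and the last row of `a(s)` follow at once. -/
lemma a_eq_boost (m : ℕ) (s : ℝ) :
    a (m + 1) s = boost (lift (Pi.single (0 : Fin (m + 1)) (Real.sinh s))) := by
  rw [lift_single_sinh]
  have hl : (0 : Fin (m + 1 + 1)) ≠ Fin.last (m + 1) := (Fin.last_pos).ne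
  have hc : 1 + Real.cosh s ≠ 0 := by have := Real.cosh_pos s; positivity
  have hcs : Real.sinh s * Real.sinh s = (Real.cosh s - 1) * (1 + Real.cosh s) := by
    have := Real.cosh_sq s
    linarith
  ext p q
  simp only [a, boost, gram, Matrix.add_apply, Matrix.smul_apply, Matrix.vecMulVec_apply,
    Matrix.single_apply, Pi.add_apply, lastVec, smul_eq_mul, Pi.single_eq_same,
    Pi.single_eq_of_ne hl.symm, zero_add]
  by_cases hp0 : p = 0
  · subst hp0
    by_cases hq0 : q = 0
    · subst hq0
      simp [hl, hl.symm]
      field_simp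
      linarith
    · by_cases hql : q = Fin.last (m + 1)
      · subst hql
        simp [hl, hl.symm]
        field_simp
        ring
      · simp [hl, hl.symm, hq0, hql, Ne.symm hq0, Ne.symm hql]
  · by_cases hpl : p = Fin.last (m + 1)
    · subst hpl
      by_cases hq0 : q = 0
      · subst hq0
        simp [hl, hl.symm]
        field_simp
        ring
      · by_cases hql : q = Fin.last (m + 1)
        · subst hql
          simp [hl, hl.symm]
          field_simp
          ring
        · simp [hl, hl.symm, hq0, hql, Ne.symm hq0, Ne.symm hql]
    · by_cases hpq : p = q
      · subst hpq
        simp [hp0, hpl, Ne.symm hp0, Ne.symm hpl]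
      · simp [hp0, hpl, Ne.symm hp0, Ne.symm hpl, hpq]

/-- `a(s)` as an element of `G`. -/
def aG (m : ℕ) (s : ℝ) : G (m + 1) := boostG (Pi.single 0 (Real.sinh s))

@[simp] lemma mat_aG (m : ℕ) (s : ℝ) : mat (aG m s) = a (m + 1) s := by
  rw [aG, mat_boostG, a_eq_boost]

lemma continuous_aG (m : ℕ) : Continuous (aG m) :=
  (continuous_boostG _).comp ((continuous_single (A := fun _ : Fin (m + 1) => ℝ) 0).comp
    Real.continuous_sinh)

lemma row_aG_mul {m : ℕ} (s : ℝ) (g : G (m + 1)) (b : Fin (m + 1)) :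
    row (aG m s * g) b = Real.sinh s * mat g 0 b.castSucc +
      Real.cosh s * mat g (Fin.last (m + 1)) b.castSucc := by
  have h1 : mat (aG m s * g) (Fin.last (m + 1)) =
      (Pi.single 0 (Real.sinh s) + Pi.single (Fin.last (m + 1)) (Real.cosh s)) ᵥ* mat g := by
    rw [← lastVec_vecMul (mat (aG m s * g)), mat_mul, ← Matrix.vecMul_vecMul, lastVec_vecMul,
      mat_aG, a_eq_boost, boost_last (lift_last_pos _), lift_single_sinh]
  rw [row, h1, Matrix.add_vecMul, Matrix.single_vecMul, Matrix.single_vecMul]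
  rfl

/-! ### The unipotent group -/

/-- The vector `(0, x, 0)`. -/
def midVec {m : ℕ} (x : Fin m → ℝ) : Fin (m + 1 + 1) → ℝ :=
  fun b => ∑ l, x l * (Pi.single (mid (n := m + 1) l) 1 : Fin (m + 1 + 1) → ℝ) b

lemma mid_eq {m : ℕ} (l : Fin m) : mid (n := m + 1) l = l.succ.castSucc := Fin.ext rfl

@[simp] lemma midVec_zero {m : ℕ} (x : Fin m → ℝ) : midVec x 0 = 0 := by
  refine Finset.sum_eq_zero fun l _ => ?_
  rw [Pi.single_eq_of_ne, mul_zero]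
  rw [mid_eq, ← Fin.castSucc_zero]
  exact fun h => (Fin.succ_ne_zero l) (Fin.castSucc_injective _ h).symm

@[simp] lemma midVec_last {m : ℕ} (x : Fin m → ℝ) : midVec x (Fin.last (m + 1)) = 0 := by
  refine Finset.sum_eq_zero fun l _ => ?_
  rw [Pi.single_eq_of_ne, mul_zero]
  rw [mid_eq]
  exact (Fin.castSucc_lt_last _).ne'

@[simp] lemma midVec_mid {m : ℕ} (x : Fin m → ℝ) (l : Fin m) :
    midVec x l.succ.castSucc = x l := by
  rw [midVec, Finset.sum_eq_single l]
  · rw [mid_eq, Pi.single_eq_same, mul_one]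
  · intro l' _ hne
    rw [mid_eq, Pi.single_eq_of_ne, mul_zero]
    intro h
    exact hne (Fin.succ_injective _ (Fin.castSucc_injective _ h)).symm
  · simp

lemma sum_ends {m : ℕ} (f : Fin (m + 1 + 1) → ℝ) :
    ∑ b, f b = f 0 + ∑ l : Fin m, f l.succ.castSucc + f (Fin.last (m + 1)) := by
  rw [Fin.sum_univ_castSucc, Fin.sum_univ_succ]
  rfl

/-- `e₁ + eₙ₊₁`. -/
def endAdd (m : ℕ) : Fin (m + 1 + 1) → ℝ := Pi.single 0 1 + Pi.single (Fin.last (m + 1)) 1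

/-- `eₙ₊₁ - e₁`. -/
def endSub (m : ℕ) : Fin (m + 1 + 1) → ℝ := Pi.single (Fin.last (m + 1)) 1 - Pi.single 0 1

/-- In this rank-one form the invariance of the Lorentz form and the last row of `a(s) u(x)` reduce
to a few dot products of `endAdd`, `endSub` and `midVec x`. -/
lemma u_eq {m : ℕ} (x : EuclideanSpace ℝ (Fin m)) :
    u (m + 1) x = 1 + Matrix.vecMulVec (endAdd m) (midVec x) +
      Matrix.vecMulVec (midVec x) (endSub m) +
      (((x : Fin m → ℝ) ⬝ᵥ x) / 2) • Matrix.vecMulVec (endAdd m) (endSub m) := by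
  have hnorm : ‖x‖ ^ 2 = (x : Fin m → ℝ) ⬝ᵥ x := by
    rw [EuclideanSpace.norm_sq_eq]
    simp [dotProduct, sq]
  have hE : ∀ p q a b : Fin (m + 1 + 1), (E p q : Mat (m + 1)) a b =
      (Pi.single p 1 : Fin (m + 1 + 1) → ℝ) a * (Pi.single q 1 : Fin (m + 1 + 1) → ℝ) b := by
    intro p q a b
    simp only [E, Matrix.single_apply, Pi.single_apply, eq_comm (a := a), eq_comm (a := b)]
    by_cases hp : p = a <;> by_cases hq : q = b <;> simp [hp, hq]
  ext p q
  simp only [u, Matrix.add_apply, Matrix.smul_apply, Matrix.vecMulVec_apply, Matrix.sum_apply,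
    Matrix.sub_apply, Matrix.neg_apply, hE, smul_eq_mul, endAdd, endSub, Pi.add_apply,
    Pi.sub_apply, midVec]
  rw [Finset.mul_sum, Finset.sum_mul]
  have hsum : (∑ l : Fin m, x.ofLp l *
      ((Pi.single 0 1 : Fin (m + 1 + 1) → ℝ) p * (Pi.single (mid (n := m + 1) l) 1 :
        Fin (m + 1 + 1) → ℝ) q - (Pi.single (mid (n := m + 1) l) 1 : Fin (m + 1 + 1) → ℝ) p *
        (Pi.single 0 1 : Fin (m + 1 + 1) → ℝ) q +
        (Pi.single (mid (n := m + 1) l) 1 : Fin (m + 1 + 1) → ℝ) p *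
        (Pi.single (Fin.last (m + 1)) 1 : Fin (m + 1 + 1) → ℝ) q +
        (Pi.single (Fin.last (m + 1)) 1 : Fin (m + 1 + 1) → ℝ) p *
        (Pi.single (mid (n := m + 1) l) 1 : Fin (m + 1 + 1) → ℝ) q)) =
      ∑ l : Fin m, ((Pi.single 0 1 : Fin (m + 1 + 1) → ℝ) p +
        (Pi.single (Fin.last (m + 1)) 1 : Fin (m + 1 + 1) → ℝ) p) *
        (x.ofLp l * (Pi.single (mid (n := m + 1) l) 1 : Fin (m + 1 + 1) → ℝ) q) +
      ∑ l : Fin m, x.ofLp l * (Pi.single (mid (n := m + 1) l) 1 : Fin (m + 1 + 1) → ℝ) p *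
        ((Pi.single (Fin.last (m + 1)) 1 : Fin (m + 1 + 1) → ℝ) q -
        (Pi.single 0 1 : Fin (m + 1 + 1) → ℝ) q) := by
    rw [← Finset.sum_add_distrib]
    refine Finset.sum_congr rfl fun l _ => ?_
    ring
  erw [hsum]
  erw [hnorm]
  ring

lemma zero_ne_last (m : ℕ) : (0 : Fin (m + 1 + 1)) ≠ Fin.last (m + 1) := Fin.last_pos.ne

lemma endAdd_dotProduct_endSub (m : ℕ) : endAdd m ⬝ᵥ endSub m = 0 := by
  rw [dotProduct, sum_ends]
  simp [endAdd, endSub, zero_ne_last m, (zero_ne_last m).symm, (Fin.castSucc_lt_last _).ne]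

lemma endAdd_dotProduct_midVec {m : ℕ} (x : Fin m → ℝ) : endAdd m ⬝ᵥ midVec x = 0 := by
  rw [dotProduct, sum_ends]
  simp [endAdd, (Fin.castSucc_lt_last _).ne]

lemma midVec_dotProduct_endSub {m : ℕ} (x : Fin m → ℝ) : midVec x ⬝ᵥ endSub m = 0 := by
  rw [dotProduct, sum_ends]
  simp [endSub, (Fin.castSucc_lt_last _).ne]

lemma midVec_dotProduct_midVec {m : ℕ} (x : Fin m → ℝ) : midVec x ⬝ᵥ midVec x = x ⬝ᵥ x := by
  rw [dotProduct, sum_ends]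
  simp only [midVec_zero, midVec_mid, midVec_last, mul_zero, zero_add, add_zero, dotProduct]

lemma endAdd_vecMul_gram (m : ℕ) : endAdd m ᵥ* gram (m + 1) = -endSub m := by
  ext b
  rw [vecMul_gram_apply]
  by_cases hb : b = Fin.last (m + 1)
  · subst hb; simp [endAdd, endSub, (zero_ne_last m).symm]
  · simp [endAdd, endSub, hb]

lemma midVec_vecMul_gram {m : ℕ} (x : Fin m → ℝ) : midVec x ᵥ* gram (m + 1) = midVec x := by
  ext b
  rw [vecMul_gram_apply]
  by_cases hb : b = Fin.last (m + 1)
  · subst hb; simp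
  · simp [hb]

lemma u_transpose_mul_gram_mul {m : ℕ} (x : EuclideanSpace ℝ (Fin m)) :
    (u (m + 1) x)ᵀ * gram (m + 1) * u (m + 1) x = gram (m + 1) := by
  rw [u_eq]
  set q := (x : Fin m → ℝ) ⬝ᵥ x with hq
  have h1 := endAdd_dotProduct_endSub m
  have h2 := endAdd_dotProduct_midVec (x : Fin m → ℝ)
  have h3 := midVec_dotProduct_endSub (x : Fin m → ℝ)
  have h4 := midVec_dotProduct_midVec (x : Fin m → ℝ)
  have h5 := endAdd_vecMul_gram m
  have h6 := midVec_vecMul_gram (x : Fin m → ℝ)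
  have h1' : endSub m ⬝ᵥ endAdd m = 0 := by rw [dotProduct_comm]; exact h1
  have h2' : midVec (x : Fin m → ℝ) ⬝ᵥ endAdd m = 0 := by rw [dotProduct_comm]; exact h2
  have h3' : endSub m ⬝ᵥ midVec (x : Fin m → ℝ) = 0 := by rw [dotProduct_comm]; exact h3
  have h5' : gram (m + 1) *ᵥ endAdd m = -endSub m := by
    rw [← Matrix.vecMul_transpose, gram_transpose, h5]
  have h6' : gram (m + 1) *ᵥ midVec (x : Fin m → ℝ) = midVec (x : Fin m → ℝ) := by
    rw [← Matrix.vecMul_transpose, gram_transpose, h6]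
  have hL : (1 + Matrix.vecMulVec (endAdd m) (midVec x) + Matrix.vecMulVec (midVec x) (endSub m) +
      (q / 2) • Matrix.vecMulVec (endAdd m) (endSub m))ᵀ * gram (m + 1) =
      gram (m + 1) - Matrix.vecMulVec (midVec x) (endSub m) +
        Matrix.vecMulVec (endSub m) (midVec x) -
        (q / 2) • Matrix.vecMulVec (endSub m) (endSub m) := by
    simp only [Matrix.transpose_add, Matrix.transpose_one, Matrix.transpose_vecMulVec,
      Matrix.transpose_smul, Matrix.add_mul, Matrix.one_mul, Matrix.smul_mul,
      Matrix.vecMulVec_mul, h5, h6, Matrix.vecMulVec_neg]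
    module
  rw [hL]
  simp only [Matrix.add_mul, Matrix.sub_mul, Matrix.mul_add, Matrix.mul_one, Matrix.smul_mul,
    Matrix.mul_smul, Matrix.vecMulVec_mul_vecMulVec, h1', h2', h3', h4, ← hq, zero_smul,
    Matrix.vecMulVec_zero]
  simp only [Matrix.mul_vecMulVec, h5', h6', Matrix.neg_vecMulVec, Matrix.vecMulVec_smul]
  module

lemma continuous_u (m : ℕ) : Continuous fun x : EuclideanSpace ℝ (Fin m) => u (m + 1) x := by
  unfold u
  refine (continuous_const.add (continuous_finsetSum _ fun l _ => ?_)).add ?_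
  · exact Continuous.fun_smul (by fun_prop) continuous_const
  · exact Continuous.fun_smul (by fun_prop) continuous_const

lemma exists_mat_eq_u {m : ℕ} (x : EuclideanSpace ℝ (Fin m)) :
    ∃ g : G (m + 1), mat g = u (m + 1) x :=
  exists_mat_eq_of_preconnected (fun x : EuclideanSpace ℝ (Fin m) => u (m + 1) x)
    (continuous_u m) u_transpose_mul_gram_mul 0 (by simp [u]) x

/-- `u(x)` as an element of `G`. -/
def uG {m : ℕ} (x : EuclideanSpace ℝ (Fin m)) : G (m + 1) := (exists_mat_eq_u x).choose

@[simp] lemma mat_uG {m : ℕ} (x : EuclideanSpace ℝ (Fin m)) : mat (uG x) = u (m + 1) x :=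
  (exists_mat_eq_u x).choose_spec

lemma continuous_uG (m : ℕ) : Continuous (uG (m := m)) := by
  rw [isEmbedding_mat.continuous_iff]
  simpa [Function.comp_def] using continuous_u m

/-- These are the horospherical coordinates of `lintegral_hyp_horo`; the sums of `sinh` and `cosh`
combine to `e^s`. -/
lemma row_aG_mul_uG {m : ℕ} (s : ℝ) (x : EuclideanSpace ℝ (Fin m)) :
    row (aG m s * uG x) = Fin.cons (α := fun _ => ℝ)
      (Real.sinh s - Real.exp s * ((x : Fin m → ℝ) ⬝ᵥ x) / 2) (Real.exp s • (x : Fin m → ℝ)) := by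
  have hl := (zero_ne_last m).symm
  have hexp := Real.cosh_add_sinh s
  ext b
  rw [row_aG_mul, mat_uG, u_eq]
  simp only [Matrix.add_apply, Matrix.smul_apply, Matrix.vecMulVec_apply, endAdd, endSub,
    Pi.add_apply, Pi.sub_apply, smul_eq_mul]
  refine Fin.cases ?_ (fun l => ?_) b
  · have h0 : (1 : Mat (m + 1)) 0 (Fin.castSucc 0) = 1 := Matrix.one_apply_eq _
    have h1 : (1 : Mat (m + 1)) (Fin.last (m + 1)) (Fin.castSucc 0) = 0 := Matrix.one_apply_ne hl
    simp only [h0, h1, Fin.castSucc_zero, midVec_zero, midVec_last, Pi.single_eq_same,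
      Pi.single_eq_of_ne hl, Pi.single_eq_of_ne hl.symm, Fin.cons_zero]
    linear_combination (-((x : Fin m → ℝ) ⬝ᵥ x) / 2) * hexp
  · have hb0 : (l.succ.castSucc : Fin (m + 1 + 1)) ≠ 0 := by simp
    have hbl : (l.succ.castSucc : Fin (m + 1 + 1)) ≠ Fin.last (m + 1) :=
      (Fin.castSucc_lt_last _).ne
    simp only [midVec_zero, midVec_last, midVec_mid, Pi.single_eq_same,
      Pi.single_eq_of_ne hl, Pi.single_eq_of_ne hl.symm, Pi.single_eq_of_ne hb0,
      Pi.single_eq_of_ne hbl, Matrix.one_apply_ne hb0.symm, Matrix.one_apply_ne hbl.symm,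
      Fin.cons_succ, Pi.smul_apply, smul_eq_mul]
    linear_combination (x l) * hexp

/-! ### Haar measures on the subgroups -/

lemma exists_isHaarMeasure_isProbabilityMeasure (S : Type*) [Group S] [TopologicalSpace S]
    [IsTopologicalGroup S] [CompactSpace S] [MeasurableSpace S] [BorelSpace S] :
    ∃ κ : Measure S, κ.IsHaarMeasure ∧ IsProbabilityMeasure κ := by
  refine ⟨Measure.haarMeasure ⊤, inferInstance, ⟨?_⟩⟩
  exact Measure.haarMeasure_self (K₀ := (⊤ : TopologicalSpace.PositiveCompacts S))

/-! ### Fubini rearrangements and averaging over `K` -/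

lemma lintegral_lam_row {n : ℕ} (κ : Measure (K n)) [κ.IsHaarMeasure] [IsProbabilityMeasure κ]
    {F : (Fin n → ℝ) → ℝ≥0∞} (hF : Measurable F) :
    ∫⁻ g, F (row g) ∂lam κ = ∫⁻ y, F y ∂hyp n := by
  have hm : Measurable fun g : G n => F (row g) := hF.comp (continuous_row n).measurable
  rw [lintegral_lam κ hm]
  refine lintegral_congr fun x => ?_
  simp [row_inclK_mul]

lemma lintegral_triple {X Y Z : Type*} [MeasurableSpace X] [MeasurableSpace Y] [MeasurableSpace Z]
    (κ : Measure X) (ν : Measure Y) (τ : Measure Z) [SFinite κ] [SFinite ν] [SFinite τ]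
    {F : X → Y → Z → ℝ≥0∞} (hF : Measurable fun p : (X × Y) × Z => F p.1.1 p.1.2 p.2) :
    ∫⁻ x, ∫⁻ y, ∫⁻ z, F x y z ∂τ ∂ν ∂κ = ∫⁻ p, F p.1.1 p.1.2 p.2 ∂((κ.prod ν).prod τ) := by
  rw [lintegral_prod _ hF.aemeasurable, lintegral_prod _ hF.lintegral_prod_right'.aemeasurable]

lemma lintegral_rotate {X Y Z : Type*} [MeasurableSpace X] [MeasurableSpace Y] [MeasurableSpace Z]
    (κ : Measure X) (ν : Measure Y) (τ : Measure Z) [SFinite κ] [SFinite ν] [SFinite τ]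
    {F : X → Y → Z → ℝ≥0∞} (hF : Measurable fun p : (X × Y) × Z => F p.1.1 p.1.2 p.2) :
    ∫⁻ x, ∫⁻ y, ∫⁻ z, F x y z ∂τ ∂ν ∂κ = ∫⁻ y, ∫⁻ z, ∫⁻ x, F x y z ∂κ ∂τ ∂ν := by
  have h1 : Measurable fun p : X × Y => ∫⁻ z, F p.1 p.2 z ∂τ := hF.lintegral_prod_right'
  rw [lintegral_lintegral_swap h1.aemeasurable]
  refine lintegral_congr fun y => lintegral_lintegral_swap (Measurable.aemeasurable ?_)
  exact hF.comp ((measurable_fst.prodMk measurable_const).prodMk measurable_snd)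

lemma lintegral_prod_rotate {X Y Z : Type*} [MeasurableSpace X] [MeasurableSpace Y]
    [MeasurableSpace Z] (κ : Measure X) (ν : Measure Y) (τ : Measure Z) [SFinite κ] [SFinite ν]
    [SFinite τ] {F : X → Y → Z → ℝ≥0∞}
    (hF : Measurable fun p : (X × Y) × Z => F p.1.1 p.1.2 p.2) :
    ∫⁻ p, ∫⁻ z, F p.1 p.2 z ∂τ ∂(κ.prod ν) = ∫⁻ x, ∫⁻ z, ∫⁻ y, F x y z ∂ν ∂τ ∂κ := by
  have h1 : Measurable fun p : X × Y => ∫⁻ z, F p.1 p.2 z ∂τ := hF.lintegral_prod_right'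
  rw [lintegral_prod _ h1.aemeasurable]
  refine lintegral_congr fun x => lintegral_lintegral_swap (Measurable.aemeasurable ?_)
  exact hF.comp ((measurable_const.prodMk measurable_fst).prodMk measurable_snd)

/-- Averaging over `K` turns a function on `G` into a function of the last row. -/
lemma lintegral_K_family {n : ℕ} (κ : Measure (K n)) [κ.IsHaarMeasure] [IsProbabilityMeasure κ]
    {Y : Type*} [MeasurableSpace Y] (ν : Measure Y) [SFinite ν] (τ : Measure ℝ) [SFinite τ]
    {γ : Y → ℝ → G n} (hγ : Measurable fun p : Y × ℝ => γ p.1 p.2)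
    {f : G n → ℝ≥0∞} (hf : Measurable f) {W : ℝ → ℝ≥0∞} (hW : Measurable W) :
    ∫⁻ k, ∫⁻ y, ∫⁻ s, f (inclK n k * γ y s) * W s ∂τ ∂ν ∂κ =
      ∫⁻ y, ∫⁻ s, (∫⁻ k, f (inclK n k * boostG (row (γ y s))) ∂κ) * W s ∂τ ∂ν := by
  have hK := (continuous_inclK n).measurable
  have hm : Measurable fun p : (K n × Y) × ℝ => f (inclK n p.1.1 * γ p.1.2 p.2) * W p.2 := by
    have h1 : Measurable fun p : (K n × Y) × ℝ => γ p.1.2 p.2 :=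
      hγ.comp ((measurable_snd.comp measurable_fst).prodMk measurable_snd)
    have h2 : Measurable fun p : (K n × Y) × ℝ => inclK n p.1.1 :=
      hK.comp (measurable_fst.comp measurable_fst)
    exact (hf.comp (h2.mul h1)).mul (hW.comp measurable_snd)
  rw [lintegral_rotate κ ν τ hm]
  refine lintegral_congr fun y => lintegral_congr fun s => ?_
  have hm3 : Measurable fun k : K n => f (inclK n k * γ y s) :=
    hf.comp (hK.mul_const _)
  rw [lintegral_mul_const _ hm3, lintegral_K_mul κ f (γ y s)]

/-! ### The groups `H` -/

/-- The block diagonal parametrization of `H`. -/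
def blockH {n i j : ℕ} (h : i + j + 1 = n) : SO (i + 1) × SOLorentz₀ j →* H h :=
  ((blockHom (p := i + 1) (q := j + 1) (m := n + 1) (by omega)).comp
    ((SO (i + 1)).subtype.prodMap (SOLorentz₀ j).subtype)).codRestrict (H h)
    fun x => Subgroup.mem_map.2 ⟨(x.1.1, x.2.1), Subgroup.mem_prod.2 ⟨x.1.2, x.2.2⟩, rfl⟩

lemma mat_blockH {n i j : ℕ} (h : i + j + 1 = n) (h' : i + 1 + (j + 1) = n + 1)
    (x : SO (i + 1) × SOLorentz₀ j) :
    mat (blockH h x) = Matrix.reindex (blockEquiv h') (blockEquiv h')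
      (Matrix.fromBlocks (mat x.1) 0 0 (mat x.2)) := rfl

lemma surjective_blockH {n i j : ℕ} (h : i + j + 1 = n) : Function.Surjective (blockH h) := by
  rintro ⟨_, ⟨A, D⟩, ⟨hA, hD⟩, rfl⟩
  exact ⟨(⟨A, hA⟩, ⟨D, hD⟩), rfl⟩

lemma continuous_blockH {n i j : ℕ} (h : i + j + 1 = n) : Continuous (blockH h) :=
  Continuous.subtype_mk ((continuous_blockHom _).comp
    (continuous_subtype_val.prodMap continuous_subtype_val)) _

/-- The two diagonal blocks can be read off continuously. This transports local compactness and Haar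
measure from the product to `H`. -/
lemma isEmbedding_blockH {n i j : ℕ} (h : i + j + 1 = n) : IsEmbedding (blockH h) := by
  have h' : i + 1 + (j + 1) = n + 1 := by omega
  let r : Mat n → Mat i × Mat j := fun A =>
    ((Matrix.reindex (blockEquiv h').symm (blockEquiv h').symm A).toBlocks₁₁,
      (Matrix.reindex (blockEquiv h').symm (blockEquiv h').symm A).toBlocks₂₂)
  have hr : Continuous r := by
    refine Continuous.prodMk ?_ ?_ <;>
    · refine continuous_pi fun a => continuous_pi fun b => ?_
      exact (continuous_id.matrix_elem _ _)
  have hcomp : (fun b : H h => r (mat b)) ∘ blockH h = fun x => (mat x.1, mat x.2) := by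
    ext1 x
    simp only [Function.comp_apply, mat_blockH h h', r, Matrix.reindex_apply, Equiv.symm_symm,
      Matrix.submatrix_submatrix, Equiv.symm_comp_self, Matrix.submatrix_id_id,
      Matrix.toBlocks_fromBlocks₁₁, Matrix.toBlocks_fromBlocks₂₂]
  refine IsEmbedding.of_comp (continuous_blockH h) (hr.comp continuous_mat) ?_
  have := (isEmbedding_mat (S := SO (i + 1))).prodMap (isEmbedding_mat (S := SOLorentz₀ j))
  rw [show (r ∘ fun g : H h => mat g) ∘ blockH h = _ from hcomp]
  exact this

lemma isClosedEmbedding_blockH {n i j : ℕ} (h : i + j + 1 = n) : IsClosedEmbedding (blockH h) :=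
  ⟨isEmbedding_blockH h, by rw [(surjective_blockH h).range_eq]; exact isClosed_univ⟩

instance instLocallyCompactSpaceH {n i j : ℕ} (h : i + j + 1 = n) : LocallyCompactSpace (H h) :=
  ((isEmbedding_blockH h).toHomeomorphOfSurjective (surjective_blockH h)).symm.isClosedEmbedding
    |>.locallyCompactSpace

/-- The inclusion of `H` in `G`. -/
def inclH {n i j : ℕ} (h : i + j + 1 = n) : H h →* G n := Subgroup.inclusion (H_le_G h)

@[simp] lemma mat_inclH {n i j : ℕ} (h : i + j + 1 = n) (b : H h) : mat (inclH h b) = mat b := rfl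

lemma continuous_inclH {n i j : ℕ} (h : i + j + 1 = n) : Continuous (inclH h) :=
  continuous_inclusion (H_le_G h)

/-- The last row of `a(s)` combines the first and last basis vectors with coefficients `sinh s` and
`cosh s`. These select the first row of the orthogonal block and the last row of the Lorentz block.
-/
lemma row_aG_mul_blockH {m i j : ℕ} (h : i + j + 1 = m + 1) (h' : i + 1 + j = m + 1) (s : ℝ)
    (x : SO (i + 1) × SOLorentz₀ j) :
    row (aG m s * inclH h (blockH h x)) =
      glue h' (Real.sinh s • mat x.1 0) (Real.cosh s • row x.2) := by
  have h'' : i + 1 + (j + 1) = m + 1 + 1 := by omega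
  ext b
  rw [row_aG_mul, mat_inclH, mat_blockH h h'', ← blockEquiv_inl_zero h'',
    ← blockEquiv_inr_last h'']
  obtain ⟨b, rfl⟩ := (blockEquiv h').surjective b
  rcases b with b | b
  · have hb : (blockEquiv h' (Sum.inl b)).castSucc = blockEquiv h'' (Sum.inl b) :=
      Fin.ext (by rw [Fin.val_castSucc, blockEquiv_inl_val, blockEquiv_inl_val])
    rw [hb, glue_inl]
    simp only [Matrix.reindex_apply, Matrix.submatrix_apply, Equiv.symm_apply_apply,
      Matrix.fromBlocks_apply₁₁, Matrix.fromBlocks_apply₂₁, Matrix.zero_apply, mul_zero, add_zero,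
      Pi.smul_apply, smul_eq_mul]
  · have hb : (blockEquiv h' (Sum.inr b)).castSucc = blockEquiv h'' (Sum.inr b.castSucc) :=
      Fin.ext (by rw [Fin.val_castSucc, blockEquiv_inr_val, blockEquiv_inr_val, Fin.val_castSucc])
    rw [hb, glue_inr]
    simp only [Matrix.reindex_apply, Matrix.submatrix_apply, Equiv.symm_apply_apply,
      Matrix.fromBlocks_apply₁₂, Matrix.fromBlocks_apply₂₂, Matrix.zero_apply, mul_zero, zero_add,
      Pi.smul_apply, smul_eq_mul, row]

/-- The product Haar measure on `H`. -/
def prodH {n i j : ℕ} (h : i + j + 1 = n) (ρ : Measure (SO (i + 1))) (η : Measure (K j)) :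
    Measure (H h) := (ρ.prod (lam η)).map (blockH h)

lemma isHaarMeasure_prodH {n i j : ℕ} (h : i + j + 1 = n) (ρ : Measure (SO (i + 1)))
    [ρ.IsHaarMeasure] [IsProbabilityMeasure ρ] (η : Measure (K j)) [η.IsHaarMeasure]
    [IsProbabilityMeasure η] : (prodH h ρ η).IsHaarMeasure :=
  Measure.isHaarMeasure_map _ (blockH h) (continuous_blockH h) (surjective_blockH h)
    (isClosedEmbedding_blockH h).tendsto_cocompact

/-- The reparametrization `σ` is the identity for the terms `a(s) h`, and negation for the terms
`a(s) w h`, which have the last row of `a(-s) h`. -/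
lemma lintegral_prodH {m i j : ℕ} (h : i + j + 1 = m + 1) (h' : i + 1 + j = m + 1)
    (ρ : Measure (SO (i + 1))) [ρ.IsHaarMeasure] [IsProbabilityMeasure ρ] (η : Measure (K j))
    [η.IsHaarMeasure] [IsProbabilityMeasure η] {F : (Fin (m + 1) → ℝ) → ℝ≥0∞} (hF : Measurable F)
    {W : ℝ → ℝ≥0∞} (hW : Measurable W) {σ : ℝ → ℝ} (hσ : Measurable σ) :
    ∫⁻ b, ∫⁻ s in Set.Ioi (0 : ℝ), F (row (aG m (σ s) * inclH h b)) * W s ∂volume ∂prodH h ρ η =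
      ∫⁻ A, ∫⁻ s in Set.Ioi (0 : ℝ), W s * ∫⁻ y, F (glue h' (Real.sinh (σ s) • mat A 0)
        (Real.cosh (σ s) • y)) ∂hyp j ∂volume ∂ρ := by
  have hm : Measurable fun p : H h × ℝ => F (row (aG m (σ p.2) * inclH h p.1)) * W p.2 := by
    have h1 : Measurable fun p : H h × ℝ => aG m (σ p.2) :=
      (continuous_aG m).measurable.comp (hσ.comp measurable_snd)
    have h2 : Measurable fun p : H h × ℝ => inclH h p.1 :=
      (continuous_inclH h).measurable.comp measurable_fst
    exact (hF.comp ((continuous_row _).measurable.comp (h1.mul h2))).mul (hW.comp measurable_snd)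
  have hb : Measurable (blockH h) := (continuous_blockH h).measurable
  have hm1 : Measurable fun b : H h => ∫⁻ s in Set.Ioi (0 : ℝ),
      F (row (aG m (σ s) * inclH h b)) * W s := hm.lintegral_prod_right'
  rw [prodH, lintegral_map hm1 hb]
  simp only [row_aG_mul_blockH h h']
  have hA : Measurable fun p : (SO (i + 1) × SOLorentz₀ j) × ℝ => mat p.1.1 0 :=
    measurable_pi_iff.2 fun c => ((continuous_mat (S := SO (i + 1))).matrix_elem 0 c).measurable.comp
      (measurable_fst.comp measurable_fst)
  have hB : Measurable fun p : (SO (i + 1) × SOLorentz₀ j) × ℝ => row p.1.2 :=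
    (continuous_row j).measurable.comp (measurable_snd.comp measurable_fst)
  have hs : Measurable fun p : (SO (i + 1) × SOLorentz₀ j) × ℝ => σ p.2 := hσ.comp measurable_snd
  have hg : Measurable fun p : (SO (i + 1) × SOLorentz₀ j) × ℝ =>
      glue h' (Real.sinh (σ p.2) • mat p.1.1 0) (Real.cosh (σ p.2) • row p.1.2) :=
    measurable_glue h' ((Real.measurable_sinh.comp hs).smul hA)
      ((Real.measurable_cosh.comp hs).smul hB)
  have hm2 : Measurable fun p : (SO (i + 1) × SOLorentz₀ j) × ℝ =>
      F (glue h' (Real.sinh (σ p.2) • mat p.1.1 0) (Real.cosh (σ p.2) • row p.1.2)) * W p.2 :=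
    (hF.comp hg).mul (hW.comp measurable_snd)
  refine (lintegral_prod_rotate ρ (lam η) (volume.restrict (Set.Ioi 0)) (F := fun A B s =>
    F (glue h' (Real.sinh (σ s) • mat A 0) (Real.cosh (σ s) • row B)) * W s) hm2).trans ?_
  refine lintegral_congr fun A => lintegral_congr fun s => ?_
  have hm4 : Measurable fun y : Fin j → ℝ =>
      F (glue h' (Real.sinh (σ s) • mat A 0) (Real.cosh (σ s) • y)) :=
    hF.comp (measurable_glue h' measurable_const (measurable_const_smul _))
  have hm5 : Measurable fun B : SOLorentz₀ j =>
      F (glue h' (Real.sinh (σ s) • mat A 0) (Real.cosh (σ s) • row B)) :=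
    hm4.comp (continuous_row j).measurable
  rw [lintegral_mul_const _ hm5, mul_comm, lintegral_lam_row η hm4]

/-! ### Integration formulas -/

/-- The measure is Lebesgue measure times the ratio `c` of `μ` to `lam κ`. After averaging over `K`,
the formula is integration in horospherical coordinates. -/
lemma exists_haar_decompU {m : ℕ} (μ : Measure (G (m + 1))) [μ.IsHaarMeasure]
    (κ : Measure (K (m + 1))) [κ.IsHaarMeasure] [IsProbabilityMeasure κ] :
    ∃ ν : Measure (EuclideanSpace ℝ (Fin (m + 1 - 1))), ν.IsAddHaarMeasure ∧ DecompU μ κ ν := by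
  obtain ⟨c, hc0, rfl⟩ := exists_eq_smul_lam κ μ
  let V : Measure (EuclideanSpace ℝ (Fin m)) := volume
  refine ⟨(c : ℝ≥0∞) • V, Measure.IsAddHaarMeasure.smul _ (by simpa using hc0) (by simp),
    fun f hf => ?_⟩
  have hfm : Measurable fun g : G (m + 1) => f (mat g) := hf.comp measurable_mat
  have hγ : Measurable fun p : EuclideanSpace ℝ (Fin m) × ℝ => aG m p.2 * uG p.1 :=
    (((continuous_aG m).comp continuous_snd).mul ((continuous_uG m).comp continuous_fst)).measurable
  have hW : Measurable fun s : ℝ => ENNReal.ofReal (Real.exp (m * s)) := by fun_prop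
  have key := lintegral_K_family κ ((c : ℝ≥0∞) • V) volume
    (γ := fun x s => aG m s * uG x) hγ hfm hW
  have hF := measurable_lintegral_K κ hfm
  have hmat : ∀ (k : K (m + 1)) (x : EuclideanSpace ℝ (Fin m)) (s : ℝ),
      mat (inclK (m + 1) k * (aG m s * uG x)) = mat k * a (m + 1) s * u (m + 1) x := by
    intro k x s
    rw [mat_mul, mat_mul, mat_inclK, mat_aG, mat_uG, Matrix.mul_assoc]
  have hexp : ∀ s : ℝ, Real.exp (((m + 1 : ℕ) - 1 : ℝ) * s) = Real.exp (m * s) := by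
    intro s; push_cast; ring_nf
  simp only [hmat] at key
  simp only [hexp]
  refine Eq.trans ?_ key.symm
  rw [lintegral_smul_measure, lintegral_smul_measure, lintegral_lam κ hfm,
    ← lintegral_hyp_horo hF]
  simp only [row_aG_mul_uG]
  exact congrArg _ ((PiLp.volume_preserving_ofLp (Fin m)).lintegral_comp_emb
    (MeasurableEquiv.toLp 2 (Fin m → ℝ)).symm.measurableEmbedding _).symm

/-- The normalization of the product Haar measure on `H` is `c * C`: the ratio of `μ` to `lam κ`
times the constant from polar coordinates. -/
lemma exists_haar_decompPos {m i j : ℕ} (h : i + j + 1 = m + 1) (hi : i ≠ 0)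
    (μ : Measure (G (m + 1))) [μ.IsHaarMeasure]
    (κ : Measure (K (m + 1))) [κ.IsHaarMeasure] [IsProbabilityMeasure κ] :
    ∃ ν : Measure (H h), ν.IsHaarMeasure ∧ DecompPos h μ κ ν := by
  have h' : i + 1 + j = m + 1 := by omega
  obtain ⟨c, hc0, rfl⟩ := exists_eq_smul_lam κ μ
  obtain ⟨ρ, hρ, hρ'⟩ := exists_isHaarMeasure_isProbabilityMeasure (SO (i + 1))
  obtain ⟨η, hη, hη'⟩ := exists_isHaarMeasure_isProbabilityMeasure (K j)
  obtain ⟨C, hC0, hCt, hC⟩ := exists_lintegral_hyp_polar hi h' ρ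
  have hH := isHaarMeasure_prodH h ρ η
  refine ⟨((c : ℝ≥0∞) * C) • prodH h ρ η, Measure.IsHaarMeasure.smul _
    (mul_ne_zero (by simpa using hc0) hC0) (ENNReal.mul_ne_top (by simp) hCt), fun f hf => ?_⟩
  have hfm : Measurable fun g : G (m + 1) => f (mat g) := hf.comp measurable_mat
  have hγ : Measurable fun p : H h × ℝ => aG m p.2 * inclH h p.1 :=
    (((continuous_aG m).comp continuous_snd).mul
      ((continuous_inclH h).comp continuous_fst)).measurable
  have hW : Measurable fun s : ℝ => ENNReal.ofReal (Real.sinh s ^ i * Real.cosh s ^ j) := by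
    fun_prop
  have key := lintegral_K_family κ (((c : ℝ≥0∞) * C) • prodH h ρ η)
    (volume.restrict (Set.Ioi 0)) (γ := fun b s => aG m s * inclH h b) hγ hfm hW
  have hF := measurable_lintegral_K κ hfm
  have hmat : ∀ (k : K (m + 1)) (b : H h) (s : ℝ),
      mat (inclK (m + 1) k * (aG m s * inclH h b)) = mat k * a (m + 1) s * mat b := by
    intro k b s
    rw [mat_mul, mat_mul, mat_inclK, mat_aG, mat_inclH, Matrix.mul_assoc]
  simp only [hmat] at key
  refine Eq.trans ?_ key.symm
  have e1 := lintegral_prodH h h' ρ η hF hW measurable_id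
  simp only [id] at e1
  rw [lintegral_smul_measure, lintegral_smul_measure, lintegral_lam κ hfm, hC _ hF, e1,
    smul_eq_mul, mul_assoc]
  rfl

/-! ### The element `w` -/

lemma wMat_transpose_mul_gram_mul (n : ℕ) : (wMat n)ᵀ * gram n * wMat n = gram n := by
  rw [wMat, gram, Matrix.diagonal_transpose, Matrix.diagonal_mul_diagonal,
    Matrix.diagonal_mul_diagonal]
  congr 1
  ext p
  split_ifs <;> norm_num

lemma det_wMat (m : ℕ) : (wMat (m + 1)).det = 1 := by
  rw [wMat, Matrix.det_diagonal, Fin.prod_univ_succ, Fin.prod_univ_succ]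
  simp

/-- `w` as an element of `K`. -/
def wK {m : ℕ} (hm : m ≠ 0) : K (m + 1) :=
  ⟨⟨wMat (m + 1), det_wMat m⟩, mem_K_of_last
    (mem_SOLorentz.2 (wMat_transpose_mul_gram_mul (m + 1))) (by
      ext b
      change wMat (m + 1) (Fin.last (m + 1)) b = _
      by_cases hb : b = Fin.last (m + 1)
      · subst hb
        -- `m ≠ 0` keeps the last coordinate outside the block `-I₂`.
        rw [wMat, Matrix.diagonal_apply_eq, Pi.single_eq_same, if_neg]
        rw [Fin.val_last]; omega
      · rw [wMat, Matrix.diagonal_apply_ne _ (Ne.symm hb), Pi.single_eq_of_ne hb])⟩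

@[simp] lemma mat_wK {m : ℕ} (hm : m ≠ 0) : mat (wK hm) = wMat (m + 1) := rfl

/-- `w` negates the first coordinate and fixes the last, so conjugation by it changes the sign of
`sinh s`. -/
lemma a_mul_wMat {m : ℕ} (hm : m ≠ 0) (s : ℝ) :
    a (m + 1) s * wMat (m + 1) = wMat (m + 1) * a (m + 1) (-s) := by
  have hl : ¬ ((Fin.last (m + 1) : Fin (m + 1 + 1)) : ℕ) < 2 := by rw [Fin.val_last]; omega
  have h0 : ((0 : Fin (m + 1 + 1)) : ℕ) < 2 := by simp
  ext p q
  simp only [wMat, Matrix.mul_diagonal, Matrix.diagonal_mul, a, Matrix.add_apply,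
    Matrix.smul_apply, Matrix.single_apply, smul_eq_mul, Real.cosh_neg, Real.sinh_neg]
  by_cases hp0 : (0 : Fin (m + 1 + 1)) = p
  · subst hp0
    by_cases hq0 : (0 : Fin (m + 1 + 1)) = q
    · subst hq0
      simp [(zero_ne_last m).symm]
    · by_cases hql : Fin.last (m + 1) = q
      · subst hql
        simp only [h0, hl, if_true, if_false, (zero_ne_last m).symm, hq0]
        simp
      · simp [hq0, hql, Matrix.one_apply_ne hq0]
  · by_cases hpl : Fin.last (m + 1) = p
    · subst hpl
      by_cases hq0 : (0 : Fin (m + 1 + 1)) = q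
      · subst hq0
        simp [hm, (zero_ne_last m).symm, Matrix.one_apply_ne (zero_ne_last m).symm]
      · by_cases hql : Fin.last (m + 1) = q
        · subst hql
          simp
        · simp [hq0, hql, hp0, Matrix.one_apply_ne hql]
    · simp only [hp0, hpl, false_and, if_false]
      by_cases hpq : p = q
      · subst hpq; simp
      · simp [Matrix.one_apply_ne hpq]

lemma lintegral_add_mul_triple {X Y Z : Type*} [MeasurableSpace X] [MeasurableSpace Y]
    [MeasurableSpace Z] (κ : Measure X) (ν : Measure Y) (τ : Measure Z) [SFinite κ] [SFinite ν]
    [SFinite τ] {F F' : X → Y → Z → ℝ≥0∞} {W : Z → ℝ≥0∞}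
    (hF : Measurable fun p : (X × Y) × Z => F p.1.1 p.1.2 p.2)
    (hF' : Measurable fun p : (X × Y) × Z => F' p.1.1 p.1.2 p.2) (hW : Measurable W) :
    ∫⁻ x, ∫⁻ y, ∫⁻ z, (F x y z + F' x y z) * W z ∂τ ∂ν ∂κ =
      ∫⁻ x, ∫⁻ y, ∫⁻ z, F x y z * W z ∂τ ∂ν ∂κ + ∫⁻ x, ∫⁻ y, ∫⁻ z, F' x y z * W z ∂τ ∂ν ∂κ := by
  have h1 : Measurable fun p : (X × Y) × Z => F p.1.1 p.1.2 p.2 * W p.2 :=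
    hF.mul (hW.comp measurable_snd)
  have h2 : Measurable fun p : (X × Y) × Z => F' p.1.1 p.1.2 p.2 * W p.2 :=
    hF'.mul (hW.comp measurable_snd)
  have h3 : Measurable fun p : (X × Y) × Z => (F p.1.1 p.1.2 p.2 + F' p.1.1 p.1.2 p.2) * W p.2 :=
    (hF.add hF').mul (hW.comp measurable_snd)
  rw [lintegral_triple κ ν τ (F := fun x y z => F x y z * W z) h1,
    lintegral_triple κ ν τ (F := fun x y z => F' x y z * W z) h2,
    lintegral_triple κ ν τ (F := fun x y z => (F x y z + F' x y z) * W z) h3,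
    ← lintegral_add_left h1]
  simp only [add_mul]

lemma measurable_comp_mul {X Y Z : Type*} [MeasurableSpace X] [TopologicalSpace X]
    [MeasurableSpace Y] [TopologicalSpace Y] [MeasurableSpace Z] [TopologicalSpace Z]
    [OpensMeasurableSpace X] [OpensMeasurableSpace Y] [OpensMeasurableSpace Z]
    [SecondCountableTopology X] [SecondCountableTopology Y] [SecondCountableTopology Z] {n : ℕ}
    {A : X → Mat n} {B : Z → Mat n} {D : Y → Mat n} (hA : Continuous A) (hB : Continuous B)
    (hD : Continuous D) {f : Mat n → ℝ≥0∞} (hf : Measurable f) :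
    Measurable fun p : (X × Y) × Z => f (A p.1.1 * B p.2 * D p.1.2) := by
  have hc : Continuous fun p : (X × Y) × Z => A p.1.1 * B p.2 * D p.1.2 :=
    ((hA.comp (continuous_fst.comp continuous_fst)).matrix_mul
      (hB.comp continuous_snd)).matrix_mul (hD.comp (continuous_snd.comp continuous_fst))
  exact hf.comp hc.measurable

lemma continuous_a (m : ℕ) : Continuous (a (m + 1)) := by
  have := continuous_mat.comp (continuous_aG m)
  simpa [Function.comp_def] using this

/-- Since `a(s) w = w a(-s)` with `w ∈ K`, the term with `w` has the last row of `a(-s) h`. The two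
terms together cover both sides of the hyperplane in `lintegral_hyp_fermi`. -/
lemma exists_haar_decompZero {m j : ℕ} (hm : m ≠ 0) (h : 0 + j + 1 = m + 1)
    (μ : Measure (G (m + 1))) [μ.IsHaarMeasure]
    (κ : Measure (K (m + 1))) [κ.IsHaarMeasure] [IsProbabilityMeasure κ] :
    ∃ ν : Measure (H h), ν.IsHaarMeasure ∧ DecompZero h μ κ ν := by
  have h' : 0 + 1 + j = m + 1 := by omega
  have hj : m + 1 - 1 = j := by omega
  obtain ⟨c, hc0, rfl⟩ := exists_eq_smul_lam κ μ
  obtain ⟨ρ, hρ, hρ'⟩ := exists_isHaarMeasure_isProbabilityMeasure (SO (0 + 1))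
  obtain ⟨η, hη, hη'⟩ := exists_isHaarMeasure_isProbabilityMeasure (K j)
  have hH := isHaarMeasure_prodH h ρ η
  have hH' : ((c : ℝ≥0∞) • prodH h ρ η).IsHaarMeasure :=
    Measure.IsHaarMeasure.smul _ (by simpa using hc0) (by simp)
  refine ⟨(c : ℝ≥0∞) • prodH h ρ η, hH', fun f hf => ?_⟩
  have hfm : Measurable fun g : G (m + 1) => f (mat g) := hf.comp measurable_mat
  have hγ : Measurable fun p : H h × ℝ => aG m p.2 * inclH h p.1 :=
    (((continuous_aG m).comp continuous_snd).mul
      ((continuous_inclH h).comp continuous_fst)).measurable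
  have hγ' : Measurable fun p : H h × ℝ =>
      inclK (m + 1) (wK hm) * (aG m (-p.2) * inclH h p.1) :=
    (continuous_const.mul (((continuous_aG m).comp continuous_snd.neg).mul
      ((continuous_inclH h).comp continuous_fst))).measurable
  have hW : Measurable fun s : ℝ => ENNReal.ofReal (Real.cosh s ^ j) := by fun_prop
  have key := lintegral_K_family κ ((c : ℝ≥0∞) • prodH h ρ η)
    (volume.restrict (Set.Ioi 0)) (γ := fun b s => aG m s * inclH h b) hγ hfm hW
  have key' := lintegral_K_family κ ((c : ℝ≥0∞) • prodH h ρ η)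
    (volume.restrict (Set.Ioi 0))
    (γ := fun b s => inclK (m + 1) (wK hm) * (aG m (-s) * inclH h b)) hγ' hfm hW
  have hF := measurable_lintegral_K κ hfm
  have hmat : ∀ (k : K (m + 1)) (b : H h) (s : ℝ),
      mat (inclK (m + 1) k * (aG m s * inclH h b)) = mat k * a (m + 1) s * mat b := by
    intro k b s
    rw [mat_mul, mat_mul, mat_inclK, mat_aG, mat_inclH, Matrix.mul_assoc]
  have hmat' : ∀ (k : K (m + 1)) (b : H h) (s : ℝ),
      mat (inclK (m + 1) k * (inclK (m + 1) (wK hm) * (aG m (-s) * inclH h b))) =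
        mat k * (a (m + 1) s * wMat (m + 1)) * mat b := by
    intro k b s
    rw [mat_mul, mat_mul, mat_mul, mat_inclK, mat_inclK, mat_aG, mat_inclH, mat_wK,
      a_mul_wMat hm, Matrix.mul_assoc, Matrix.mul_assoc]
  simp only [hmat] at key
  simp only [hmat', row_inclK_mul] at key'
  have hone : ∀ (A : SO (0 + 1)) (r : ℝ), r • mat A 0 = fun _ => r := by
    intro A r
    have := subsingleton_SO (p := 0 + 1) (by norm_num)
    rw [Subsingleton.elim A 1]
    ext b
    have hsub : Subsingleton (Fin (0 + 1)) := inferInstanceAs (Subsingleton (Fin 1))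
    rw [Subsingleton.elim b 0]
    simp
  have e1 := lintegral_prodH h h' ρ η hF hW measurable_id
  have e2 := lintegral_prodH h h' ρ η hF hW measurable_neg
  simp only [hone, lintegral_const, measure_univ, mul_one, Real.sinh_neg, Real.cosh_neg, id] at e1 e2
  simp only [Matrix.mul_assoc _ (a (m + 1) _) (wMat (m + 1)), hj]
  rw [lintegral_add_mul_triple κ ((c : ℝ≥0∞) • prodH h ρ η) (volume.restrict (Set.Ioi 0))
    (F := fun k b s => f (mat k * a (m + 1) s * mat b))
    (F' := fun k b s => f (mat k * (a (m + 1) s * wMat (m + 1)) * mat b))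
    (measurable_comp_mul continuous_mat (continuous_a m) continuous_mat hf)
    (measurable_comp_mul continuous_mat ((continuous_a m).matrix_mul continuous_const)
      continuous_mat hf) hW]
  refine Eq.trans ?_ (congrArg₂ (· + ·) key key').symm
  rw [lintegral_smul_measure, lintegral_smul_measure, lintegral_smul_measure, lintegral_lam κ hfm,
    lintegral_hyp_fermi h' hF, e1, e2, ← smul_add, ← lintegral_add_left]
  · simp only [mul_add]
    rfl
  · have hg : Measurable fun p : ℝ × (Fin j → ℝ) =>
        glue h' (fun _ => Real.sinh p.1) (Real.cosh p.1 • p.2) :=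
      measurable_glue h' (measurable_pi_iff.2 fun _ => by fun_prop) (by fun_prop)
    exact hW.mul (hF.comp hg).lintegral_prod_right'

/-! ### Sublevel sets of exponentially growing functions -/

lemma setLIntegral_exp_mul_Iic {d : ℕ} (hd : d ≠ 0) (b : ℝ) :
    ∫⁻ t in Set.Iic b, ENNReal.ofReal (Real.exp (d * t)) =
      ENNReal.ofReal (Real.exp (d * b) / d) := by
  have hd' : (0 : ℝ) < d := by positivity
  rw [← ofReal_integral_eq_lintegral_ofReal (integrableOn_exp_mul_Iic hd' b)
    (ae_of_all _ fun t => (Real.exp_pos _).le), integral_exp_mul_Iic hd']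

lemma exp_natCast_mul_neg_log {d : ℕ} {l : ℝ} (hl : 0 < l) :
    Real.exp (d * -Real.log l) = 1 / l ^ d := by
  rw [Real.exp_nat_mul, Real.exp_neg, Real.exp_log hl, inv_pow, one_div]

lemma exp_mul_le_one_iff {l : ℝ} (hl : 0 < l) (t : ℝ) :
    Real.exp t * l ≤ 1 ↔ t ≤ -Real.log l := by
  rw [← Real.log_inv, Real.le_log_iff_exp_le (inv_pos.2 hl), le_inv_comm₀ (Real.exp_pos t) hl,
    ← one_div, le_div_iff₀ (Real.exp_pos t), mul_comm]

section Fibre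

variable {d : ℕ} {w : ℝ → ℝ} {W : ℝ} {m : ℝ → ℝ} {l c : ℝ}

/-- The substitution `s = t + log T` absorbs the normalization `T^d`, since `e^{ds} = T^d e^{dt}`.
-/
lemma fibre_shift {T : ℝ} (hT : 0 < T) :
    (∫⁻ s, (Set.Iic T).indicator 1 (m s) * ENNReal.ofReal (w s)) / ENNReal.ofReal (T ^ d) =
      ∫⁻ t, (Set.Iic T).indicator 1 (m (t + Real.log T)) *
        ENNReal.ofReal (w (t + Real.log T) / T ^ d) := by
  have hTd : 0 < T ^ d := pow_pos hT d
  have h0 : ENNReal.ofReal (T ^ d) ≠ 0 := by simpa using hTd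
  rw [← lintegral_add_right_eq_self (μ := volume) _ (Real.log T), ENNReal.div_eq_inv_mul,
    ← lintegral_const_mul' _ _ (ENNReal.inv_ne_top.2 h0)]
  refine lintegral_congr fun t => ?_
  rw [mul_left_comm, ENNReal.ofReal_div_of_pos hTd, ENNReal.div_eq_inv_mul]

/-- After the shift the lower bound on `m` confines `t` to a half-line independent of `T`, on which
the weight is at most `e^{dt}`. -/
lemma fibre_shift_le (hc : 0 < c) (hl : 0 < l) (hm : ∀ s, c * (Real.exp s * l) ≤ m s)
    (hw : ∀ s, w s ≤ Real.exp (d * s)) {T : ℝ} (hT : 0 < T) (t : ℝ) :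
    (Set.Iic T).indicator (1 : ℝ → ℝ≥0∞) (m (t + Real.log T)) *
        ENNReal.ofReal (w (t + Real.log T) / T ^ d) ≤
      (Set.Iic (-Real.log (c * l))).indicator (fun t => ENNReal.ofReal (Real.exp (d * t))) t := by
  by_cases h : m (t + Real.log T) ≤ T
  · have h1 := (hm (t + Real.log T)).trans h
    rw [Real.exp_add, Real.exp_log hT] at h1
    have h2 : Real.exp t * (c * l) ≤ 1 := by
      refine le_of_mul_le_mul_right ?_ hT
      linarith
    rw [Set.indicator_of_mem (show m (t + Real.log T) ∈ Set.Iic T from h),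
      Set.indicator_of_mem (show t ∈ Set.Iic _ from (exp_mul_le_one_iff (mul_pos hc hl) t).1 h2),
      Pi.one_apply, one_mul]
    refine ENNReal.ofReal_le_ofReal ?_
    rw [div_le_iff₀ (pow_pos hT d)]
    refine (hw _).trans (le_of_eq ?_)
    rw [mul_add, Real.exp_add, Real.exp_nat_mul (Real.log T), Real.exp_log hT]
  · rw [Set.indicator_of_notMem (show m (t + Real.log T) ∉ Set.Iic T from h), zero_mul]
    exact zero_le

lemma fibre_le (hd : d ≠ 0) (hc : 0 < c) (hl : 0 < l) (hm : ∀ s, c * (Real.exp s * l) ≤ m s)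
    (hw : ∀ s, w s ≤ Real.exp (d * s)) {T : ℝ} (hT : 0 < T) :
    (∫⁻ s, (Set.Iic T).indicator 1 (m s) * ENNReal.ofReal (w s)) / ENNReal.ofReal (T ^ d) ≤
      ENNReal.ofReal (1 / (c * l) ^ d / d) := by
  rw [fibre_shift hT]
  refine (lintegral_mono (fibre_shift_le hc hl hm hw hT)).trans (le_of_eq ?_)
  rw [lintegral_indicator measurableSet_Iic, setLIntegral_exp_mul_Iic hd,
    exp_natCast_mul_neg_log (mul_pos hc hl)]

/-- Dominated convergence: `m(t + log T) / T` tends to `e^t l`, so the indicator tends to that of `t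
≤ -log l`, while the weight tends to `W e^{dt}`. -/
lemma fibre_tendsto (hd : d ≠ 0) (hc : 0 < c) (hl : 0 < l) (hmm : Measurable m)
    (hm : ∀ s, c * (Real.exp s * l) ≤ m s)
    (hml : Tendsto (fun s => Real.exp (-s) * m s) atTop (𝓝 l)) (hwm : Measurable w)
    (hw : ∀ s, w s ≤ Real.exp (d * s))
    (hwW : Tendsto (fun s => Real.exp (-(d * s)) * w s) atTop (𝓝 W)) (hW : 0 ≤ W) :
    Tendsto (fun T : ℝ => (∫⁻ s, (Set.Iic T).indicator 1 (m s) * ENNReal.ofReal (w s)) /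
      ENNReal.ofReal (T ^ d)) atTop (𝓝 (ENNReal.ofReal (W / d * (1 / l ^ d)))) := by
  have hlim : ENNReal.ofReal (W / d * (1 / l ^ d)) =
      ∫⁻ t, (Set.Iic (-Real.log l)).indicator
        (fun t => ENNReal.ofReal W * ENNReal.ofReal (Real.exp (d * t))) t := by
    rw [lintegral_indicator measurableSet_Iic, lintegral_const_mul' _ _ ENNReal.ofReal_ne_top,
      setLIntegral_exp_mul_Iic hd, exp_natCast_mul_neg_log hl, ← ENNReal.ofReal_mul hW]
    congr 1
    ring
  rw [hlim]
  have hev : ∀ᶠ T : ℝ in atTop, 0 < T := eventually_gt_atTop 0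
  have hshift : ∀ t : ℝ, Tendsto (fun T : ℝ => t + Real.log T) atTop atTop := fun t =>
    tendsto_atTop_add_const_left _ t Real.tendsto_log_atTop
  refine Tendsto.congr' (hev.mono fun T hT => (fibre_shift hT).symm) ?_
  refine tendsto_lintegral_filter_of_dominated_convergence
    ((Set.Iic (-Real.log (c * l))).indicator fun t => ENNReal.ofReal (Real.exp (d * t)))
    ?_ ?_ ?_ ?_
  · refine Eventually.of_forall fun T => ?_
    have h1 : Measurable fun t : ℝ => t + Real.log T := measurable_add_const _
    have h2 : Measurable fun t : ℝ => (Set.Iic T).indicator (1 : ℝ → ℝ≥0∞) (m (t + Real.log T)) :=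
      (measurable_one.indicator measurableSet_Iic).comp (hmm.comp h1)
    exact h2.mul (((hwm.comp h1).div_const _).ennreal_ofReal)
  · exact hev.mono fun T hT => ae_of_all _ (fibre_shift_le hc hl hm hw hT)
  · rw [lintegral_indicator measurableSet_Iic, setLIntegral_exp_mul_Iic hd]
    exact ENNReal.ofReal_ne_top
  · have hne : ∀ᵐ t : ℝ ∂volume, t ≠ -Real.log l := by
      rw [ae_iff]
      simp
    filter_upwards [hne] with t ht
    have h1 : Tendsto (fun T : ℝ => m (t + Real.log T) / T) atTop (𝓝 (Real.exp t * l)) := by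
      refine Tendsto.congr' (hev.mono fun T hT => ?_) ((hml.comp (hshift t)).const_mul (Real.exp t))
      rw [Function.comp_apply, neg_add, Real.exp_add, Real.exp_neg (Real.log T), Real.exp_log hT,
        ← mul_assoc, ← mul_assoc, ← Real.exp_add]
      simp [div_eq_inv_mul]
    have h2 : Tendsto (fun T : ℝ => w (t + Real.log T) / T ^ d) atTop
        (𝓝 (Real.exp (d * t) * W)) := by
      refine Tendsto.congr' (hev.mono fun T hT => ?_)
        ((hwW.comp (hshift t)).const_mul (Real.exp (d * t)))
      rw [Function.comp_apply, mul_add, neg_add, Real.exp_add, Real.exp_neg (d * Real.log T),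
        Real.exp_nat_mul (Real.log T), Real.exp_log hT, ← mul_assoc, ← mul_assoc, ← Real.exp_add]
      simp [div_eq_inv_mul]
    rcases lt_or_gt_of_ne ht with hlt | hgt
    · rw [Set.indicator_of_mem (show t ∈ Set.Iic _ from hlt.le), mul_comm,
        ← ENNReal.ofReal_mul (Real.exp_pos _).le]
      have h3 : Real.exp t * l < 1 :=
        lt_of_le_of_ne ((exp_mul_le_one_iff hl t).2 hlt.le) fun h => by
          apply ht
          rw [← Real.log_inv, ← Real.log_exp t]
          congr 1
          field_simp
          exact h
      refine Tendsto.congr' ?_ ((ENNReal.continuous_ofReal.tendsto _).comp h2)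
      filter_upwards [hev, h1.eventually (gt_mem_nhds h3)] with T hT hT1
      rw [div_lt_one hT] at hT1
      rw [Set.indicator_of_mem (show m (t + Real.log T) ∈ Set.Iic T from hT1.le), Pi.one_apply,
        one_mul, Function.comp_apply]
    · rw [Set.indicator_of_notMem (show t ∉ Set.Iic _ from not_le.2 hgt)]
      have h3 : 1 < Real.exp t * l := not_le.1 fun h => not_le.2 hgt ((exp_mul_le_one_iff hl t).1 h)
      refine Tendsto.congr' ?_ tendsto_const_nhds
      filter_upwards [hev, h1.eventually (lt_mem_nhds h3)] with T hT hT1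
      rw [one_lt_div hT] at hT1
      rw [Set.indicator_of_notMem (show m (t + Real.log T) ∉ Set.Iic T from not_le.2 hT1), zero_mul]

end Fibre

/-- If the volume of the sublevel sets is `O(T ^ d)` then it is asymptotic to a multiple of
`T ^ d`. -/
lemma sublevel_asymptotics {X : Type*} [MeasurableSpace X] (π : Measure X) [SFinite π] {d : ℕ}
    (hd : d ≠ 0) {M : X → ℝ → ℝ} (hM : Measurable fun p : X × ℝ => M p.1 p.2) {L : X → ℝ}
    (hLm : Measurable L) (hL : ∀ x, 0 < L x) {c : ℝ} (hc : 0 < c)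
    (hML : ∀ x s, c * (Real.exp s * L x) ≤ M x s)
    (hlim : ∀ x, Tendsto (fun s => Real.exp (-s) * M x s) atTop (𝓝 (L x)))
    {w : ℝ → ℝ} (hwm : Measurable w) (hw : ∀ s, w s ≤ Real.exp (d * s)) {W : ℝ} (hW : 0 < W)
    (hwW : Tendsto (fun s => Real.exp (-(d * s)) * w s) atTop (𝓝 W))
    {B : ℝ≥0∞} (hB : B ≠ ∞)
    (hV : ∀ᶠ T : ℝ in atTop, (∫⁻ x, ∫⁻ s, (Set.Iic T).indicator 1 (M x s) *
      ENNReal.ofReal (w s) ∂volume ∂π) / ENNReal.ofReal (T ^ d) ≤ B) :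
    Integrable (fun x => 1 / L x ^ d) π ∧
      Tendsto (fun T : ℝ => (∫⁻ x, ∫⁻ s, (Set.Iic T).indicator 1 (M x s) *
        ENNReal.ofReal (w s) ∂volume ∂π) / ENNReal.ofReal (T ^ d)) atTop
        (𝓝 (ENNReal.ofReal (W / d * ∫ x, 1 / L x ^ d ∂π))) := by
  have hd' : (0 : ℝ) < d := by positivity
  have hev : ∀ᶠ T : ℝ in atTop, 0 < T := eventually_gt_atTop 0
  set J : ℝ → X → ℝ≥0∞ := fun T x => (∫⁻ s, (Set.Iic T).indicator 1 (M x s) *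
    ENNReal.ofReal (w s)) / ENNReal.ofReal (T ^ d) with hJ
  have hI : ∀ T, Measurable fun x => ∫⁻ s, (Set.Iic T).indicator 1 (M x s) *
      ENNReal.ofReal (w s) := by
    intro T
    have h1 : Measurable fun p : X × ℝ => (Set.Iic T).indicator (1 : ℝ → ℝ≥0∞) (M p.1 p.2) *
        ENNReal.ofReal (w p.2) :=
      ((measurable_one.indicator measurableSet_Iic).comp hM).mul
        (hwm.comp measurable_snd).ennreal_ofReal
    exact h1.lintegral_prod_right'
  have hJm : ∀ T, Measurable (J T) := fun T => (hI T).div_const _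
  have hVJ : ∀ T, (∫⁻ x, ∫⁻ s, (Set.Iic T).indicator 1 (M x s) *
      ENNReal.ofReal (w s) ∂volume ∂π) / ENNReal.ofReal (T ^ d) = ∫⁻ x, J T x ∂π := by
    intro T
    simp only [hJ, div_eq_mul_inv]
    rw [lintegral_mul_const _ (hI T)]
  have hMx : ∀ x, Measurable (M x) := fun x => hM.comp measurable_prodMk_left
  have hJt : ∀ x, Tendsto (fun T => J T x) atTop (𝓝 (ENNReal.ofReal (W / d * (1 / L x ^ d)))) :=
    fun x => fibre_tendsto hd hc (hL x) (hMx x) (hML x) (hlim x) hwm hw hwW hW.le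
  simp only [hVJ] at hV ⊢
  have hLd : Measurable fun x => 1 / L x ^ d := (hLm.pow_const d).const_div 1
  have hpos : ∀ x, 0 ≤ 1 / L x ^ d := fun x => by have := hL x; positivity
  have hsplit : ∀ C : ℝ, 0 ≤ C → ∫⁻ x, ENNReal.ofReal (C * (1 / L x ^ d)) ∂π =
      ENNReal.ofReal C * ∫⁻ x, ENNReal.ofReal (1 / L x ^ d) ∂π := by
    intro C hC
    simp only [ENNReal.ofReal_mul hC]
    exact lintegral_const_mul _ hLd.ennreal_ofReal
  -- Fatou's lemma bounds the integral of the fibre limits by the assumed bound `B` on the total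
  -- volume. This gives integrability of `1 / L^d`.
  have hfin : ∫⁻ x, ENNReal.ofReal (1 / L x ^ d) ∂π ≠ ∞ := by
    have h1 : ∫⁻ x, ENNReal.ofReal (W / d * (1 / L x ^ d)) ∂π ≤ B := by
      calc ∫⁻ x, ENNReal.ofReal (W / d * (1 / L x ^ d)) ∂π
          = ∫⁻ x, liminf (fun T => J T x) atTop ∂π :=
            lintegral_congr fun x => ((hJt x).liminf_eq).symm
        _ ≤ liminf (fun T => ∫⁻ x, J T x ∂π) atTop := lintegral_liminf_le hJm
        _ ≤ B := liminf_le_of_frequently_le' hV.frequently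
    rw [hsplit _ (by positivity)] at h1
    intro htop
    rw [htop, ENNReal.mul_top (by simpa using by positivity)] at h1
    exact hB (top_le_iff.1 h1)
  have hint : Integrable (fun x => 1 / L x ^ d) π := by
    refine ⟨hLd.aestronglyMeasurable, ?_⟩
    rw [hasFiniteIntegral_iff_ofReal (ae_of_all _ hpos)]
    exact lt_top_iff_ne_top.2 hfin
  refine ⟨hint, ?_⟩
  rw [ENNReal.ofReal_mul (by positivity), ofReal_integral_eq_lintegral_ofReal hint
    (ae_of_all _ hpos), ← hsplit _ (by positivity)]
  -- The majorant is the uniform fibre bound `fibre_le`, a constant times `1 / L^d`, integrable by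
  -- the previous step.
  refine tendsto_lintegral_filter_of_dominated_convergence
    (fun x => ENNReal.ofReal (1 / c ^ d / d * (1 / L x ^ d))) (Eventually.of_forall hJm)
    (hev.mono fun T hT => ae_of_all _ fun x => ?_) ?_ (ae_of_all _ hJt)
  · refine (fibre_le hd hc (hL x) (hML x) hw hT).trans (ENNReal.ofReal_le_ofReal (le_of_eq ?_))
    rw [mul_pow]
    field_simp
  · rw [hsplit _ (by positivity)]
    exact ENNReal.mul_ne_top ENNReal.ofReal_ne_top hfin

/-! ### Norms on matrices -/

/-- The sum of the absolute values of the entries. -/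
def entrySum {n : ℕ} (A : Mat n) : ℝ := ∑ p, ∑ q, |A p q|

lemma entrySum_nonneg {n : ℕ} (A : Mat n) : 0 ≤ entrySum A :=
  Finset.sum_nonneg fun _ _ => Finset.sum_nonneg fun _ _ => abs_nonneg _

lemma continuous_entrySum (n : ℕ) : Continuous (entrySum (n := n)) :=
  continuous_finsetSum _ fun p _ => continuous_finsetSum _ fun q _ =>
    (continuous_id.matrix_elem p q).abs

lemma abs_le_entrySum {n : ℕ} (A : Mat n) (p q : Fin (n + 1)) : |A p q| ≤ entrySum A :=
  (Finset.single_le_sum (f := fun q => |A p q|) (fun _ _ => abs_nonneg _) (Finset.mem_univ q)).trans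
    (Finset.single_le_sum (f := fun p => ∑ q, |A p q|)
      (fun _ _ => Finset.sum_nonneg fun _ _ => abs_nonneg _) (Finset.mem_univ p))

lemma entrySum_eq_zero {n : ℕ} {A : Mat n} (h : entrySum A = 0) : A = 0 := by
  ext p q
  have := abs_le_entrySum A p q
  rw [h] at this
  simpa using this

lemma entrySum_smul {n : ℕ} (t : ℝ) (A : Mat n) : entrySum (t • A) = |t| * entrySum A := by
  simp only [entrySum, Matrix.smul_apply, smul_eq_mul, abs_mul, Finset.mul_sum]

lemma entrySum_mul_le {n : ℕ} (A B : Mat n) : entrySum (A * B) ≤ entrySum A * entrySum B := by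
  have h1 : ∀ p q, |(A * B) p q| ≤ ∑ r, |A p r| * |B r q| := by
    intro p q
    rw [Matrix.mul_apply]
    refine (Finset.abs_sum_le_sum_abs _ _).trans (le_of_eq ?_)
    simp only [abs_mul]
  have h2 : ∀ r, ∑ q, |B r q| ≤ entrySum B := fun r =>
    Finset.single_le_sum (f := fun p => ∑ q, |B p q|)
      (fun _ _ => Finset.sum_nonneg fun _ _ => abs_nonneg _) (Finset.mem_univ r)
  calc entrySum (A * B) ≤ ∑ p, ∑ q, ∑ r, |A p r| * |B r q| :=
        Finset.sum_le_sum fun p _ => Finset.sum_le_sum fun q _ => h1 p q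
    _ = ∑ p, ∑ r, |A p r| * ∑ q, |B r q| := by
        refine Finset.sum_congr rfl fun p _ => ?_
        rw [Finset.sum_comm]
        simp only [Finset.mul_sum]
    _ ≤ ∑ p, ∑ r, |A p r| * entrySum B :=
        Finset.sum_le_sum fun p _ => Finset.sum_le_sum fun r _ =>
          mul_le_mul_of_nonneg_left (h2 r) (abs_nonneg _)
    _ = entrySum A * entrySum B := by
        simp only [← Finset.sum_mul]
        rfl

lemma exists_seminorm_le {n : ℕ} (N : Seminorm ℝ (Mat n)) :
    ∃ C : ℝ, 0 < C ∧ ∀ A, N A ≤ C * entrySum A := by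
  refine ⟨1 + ∑ p, ∑ q, N (E p q), ?_, fun A => ?_⟩
  · have : 0 ≤ ∑ p, ∑ q, N (E p q) :=
      Finset.sum_nonneg fun _ _ => Finset.sum_nonneg fun _ _ => apply_nonneg _ _
    linarith
  · have hE : ∀ p q, N (E p q) ≤ 1 + ∑ p, ∑ q, N (E p q) := by
      intro p q
      have h1 := Finset.single_le_sum (f := fun q => N (E p q)) (fun _ _ => apply_nonneg _ _)
        (Finset.mem_univ q)
      have h2 := Finset.single_le_sum (f := fun p => ∑ q, N (E p q))
        (fun _ _ => Finset.sum_nonneg fun _ _ => apply_nonneg _ _) (Finset.mem_univ p)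
      linarith
    have hsum : ∀ (s : Finset (Fin (n + 1))) (f : Fin (n + 1) → Mat n),
        N (∑ x ∈ s, f x) ≤ ∑ x ∈ s, N (f x) := fun s f =>
      Finset.le_sum_of_subadditive N (map_zero N).le (map_add_le_add N) s f
    conv_lhs => rw [Matrix.matrix_eq_sum_single A]
    refine (hsum _ _).trans ?_
    rw [entrySum, Finset.mul_sum]
    refine Finset.sum_le_sum fun p _ => (hsum _ _).trans ?_
    rw [Finset.mul_sum]
    refine Finset.sum_le_sum fun q _ => ?_
    have : Matrix.single p q (A p q) = A p q • (E p q : Mat n) := by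
      rw [Matrix.smul_single, smul_eq_mul, mul_one]
    rw [this, map_smul_eq_mul, Real.norm_eq_abs, mul_comm]
    exact mul_le_mul_of_nonneg_right (hE p q) (abs_nonneg _)

lemma continuous_seminorm {n : ℕ} (N : Seminorm ℝ (Mat n)) : Continuous N := by
  obtain ⟨C, hC, hN⟩ := exists_seminorm_le N
  rw [continuous_iff_continuousAt]
  intro A
  have h1 : Tendsto (fun B : Mat n => C * entrySum (B - A)) (𝓝 A) (𝓝 0) := by
    have hc : Continuous fun B : Mat n => C * entrySum (B - A) :=
      continuous_const.mul ((continuous_entrySum n).comp (continuous_id.sub continuous_const))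
    have := hc.tendsto A
    simpa [entrySum] using this
  rw [ContinuousAt, tendsto_iff_dist_tendsto_zero]
  refine squeeze_zero (fun _ => dist_nonneg) (fun B => ?_) h1
  rw [Real.dist_eq]
  exact (abs_sub_map_le_sub N B A).trans (hN _)

/-- `N` is continuous and positive on the compact set `entrySum A = 1`; the reciprocal of its
minimum there is the constant. -/
lemma exists_entrySum_le {n : ℕ} (N : Seminorm ℝ (Mat n)) (hN : ∀ A, N A = 0 → A = 0) :
    ∃ C : ℝ, 0 < C ∧ ∀ A, entrySum A ≤ C * N A := by
  have hcpt : IsCompact {A : Mat n | entrySum A = 1} := by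
    have hbox : IsCompact (Set.univ.pi fun _ : Fin (n + 1) =>
        Set.univ.pi fun _ : Fin (n + 1) => Set.Icc (-1 : ℝ) 1) :=
      isCompact_univ_pi fun _ => isCompact_univ_pi fun _ => isCompact_Icc
    refine IsCompact.of_isClosed_subset (X := Mat n) hbox
      (isClosed_eq (continuous_entrySum n) continuous_const) fun A hA p _ q _ => ?_
    have hA' : entrySum A = 1 := hA
    exact abs_le.1 (hA' ▸ abs_le_entrySum A p q)
  have hne : {A : Mat n | entrySum A = 1}.Nonempty := by
    refine ⟨(entrySum (1 : Mat n))⁻¹ • 1, ?_⟩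
    have h1 : entrySum (1 : Mat n) ≠ 0 := fun h => one_ne_zero (entrySum_eq_zero h)
    have h2 := entrySum_nonneg (1 : Mat n)
    rw [Set.mem_ofPred_eq, entrySum_smul, abs_of_nonneg (inv_nonneg.2 h2), inv_mul_cancel₀ h1]
  obtain ⟨A₀, hA₀, hmin⟩ := hcpt.exists_isMinOn hne (continuous_seminorm N).continuousOn
  have hA₀' : entrySum A₀ = 1 := hA₀
  have hpos : 0 < N A₀ := by
    refine lt_of_le_of_ne (apply_nonneg N A₀) fun h => ?_
    rw [hN A₀ h.symm] at hA₀'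
    simp [entrySum] at hA₀'
  refine ⟨(N A₀)⁻¹, inv_pos.2 hpos, fun A => ?_⟩
  by_cases hA : entrySum A = 0
  · rw [hA]
    exact mul_nonneg (inv_pos.2 hpos).le (apply_nonneg N A)
  · have hA' : 0 < entrySum A := lt_of_le_of_ne (entrySum_nonneg A) (Ne.symm hA)
    have hmem : (entrySum A)⁻¹ • A ∈ {A : Mat n | entrySum A = 1} := by
      rw [Set.mem_ofPred_eq, entrySum_smul, abs_of_pos (inv_pos.2 hA'), inv_mul_cancel₀ hA]
    have h1 : N A₀ ≤ N ((entrySum A)⁻¹ • A) := hmin hmem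
    rw [map_smul_eq_mul, Real.norm_eq_abs, abs_of_pos (inv_pos.2 hA'), ← div_eq_inv_mul,
      le_div_iff₀ hA'] at h1
    rw [← div_eq_inv_mul, le_div_iff₀ hpos, mul_comm]
    exact h1

/-! ### Volume of norm balls -/

/-- Every entry of the last row is at most a multiple of the norm. The factor `n + 1` is a crude
choice, enough because `n ≤ (n + 1)²`. -/
lemma exists_normBall_subset {n : ℕ} (N : Seminorm ℝ (Mat n)) (hN : ∀ A, N A = 0 → A = 0) :
    ∃ D : ℝ, 0 < D ∧ ∀ T, 0 ≤ T → normBall N T ⊆ row ⁻¹' {x | x ⬝ᵥ x ≤ (D * T) ^ 2} := by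
  obtain ⟨C, hC, hCN⟩ := exists_entrySum_le N hN
  refine ⟨(n + 1) * C, by positivity, fun T hT g hg => ?_⟩
  have hg' : N (mat g) ≤ T := hg
  have h1 : ∀ b, |row g b| ≤ C * T := fun b =>
    (abs_le_entrySum (mat g) _ _).trans ((hCN _).trans (mul_le_mul_of_nonneg_left hg' hC.le))
  have h2 : row g ⬝ᵥ row g ≤ ∑ _b : Fin n, (C * T) ^ 2 := by
    refine Finset.sum_le_sum fun b _ => ?_
    rw [← sq, ← sq_abs]
    exact pow_le_pow_left₀ (abs_nonneg _) (h1 b) 2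
  rw [Finset.sum_const, Finset.card_univ, Fintype.card_fin, nsmul_eq_mul] at h2
  refine h2.trans ?_
  have h3 : (n : ℝ) ≤ (n + 1) ^ 2 := by nlinarith [(Nat.cast_nonneg n : (0 : ℝ) ≤ n)]
  calc (n : ℝ) * (C * T) ^ 2 ≤ (n + 1) ^ 2 * (C * T) ^ 2 :=
        mul_le_mul_of_nonneg_right h3 (sq_nonneg _)
    _ = ((n + 1) * C * T) ^ 2 := by ring

lemma normBall_eq_empty {n : ℕ} (N : Seminorm ℝ (Mat n)) {T : ℝ} (hT : T < 0) :
    normBall N T = ∅ :=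
  Set.eq_empty_of_forall_notMem fun g (hg : N (mat g) ≤ T) =>
    absurd (hg.trans_lt hT) (not_lt.2 (apply_nonneg N _))

lemma measure_normBall_lt_top {n : ℕ} (N : Seminorm ℝ (Mat n)) (hN : ∀ A, N A = 0 → A = 0)
    (μ : Measure (G n)) [μ.IsHaarMeasure] (T : ℝ) : μ (normBall N T) < ∞ := by
  rcases lt_or_ge T 0 with hT | hT
  · rw [normBall_eq_empty N hT]
    simp
  · obtain ⟨D, -, hD⟩ := exists_normBall_subset N hN
    exact (measure_mono (hD T hT)).trans_lt (isCompact_preimage_row n _).measure_lt_top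

/-- In polar coordinates the density satisfies `r^{m+1} / √(1 + r²) ≤ r^m ≤ R^m` for `r ≤ R`. The
hyperbolic density saves one power of `R` against Euclidean volume. In dimension one the growth
would be logarithmic, hence the index `m + 1 + 1`. -/
lemma exists_hyp_ball_le (m : ℕ) : ∃ C : ℝ≥0∞, C ≠ ∞ ∧ ∀ R : ℝ, 0 ≤ R →
    hyp (m + 1 + 1) {x | x ⬝ᵥ x ≤ R ^ 2} ≤ C * ENNReal.ofReal (R ^ (m + 1)) := by
  obtain ⟨C, -, hCt, hC⟩ := exists_lintegral_radial (m + 1)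
  refine ⟨C, hCt, fun R hR => ?_⟩
  have hms := (isCompact_dotProduct_le (m + 1 + 1) (R ^ 2)).measurableSet
  have hf : Measurable fun r : ℝ => ENNReal.ofReal (1 / Real.sqrt (1 + r ^ 2)) *
      (Set.Iic R).indicator 1 r :=
    (by fun_prop : Measurable fun r : ℝ => ENNReal.ofReal (1 / Real.sqrt (1 + r ^ 2))).mul
      (measurable_one.indicator measurableSet_Iic)
  have h1 : hyp (m + 1 + 1) {x | x ⬝ᵥ x ≤ R ^ 2} = ∫⁻ x : Fin (m + 1 + 1) → ℝ,
      ENNReal.ofReal (1 / Real.sqrt (1 + Real.sqrt (x ⬝ᵥ x) ^ 2)) *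
        (Set.Iic R).indicator 1 (Real.sqrt (x ⬝ᵥ x)) := by
    rw [← lintegral_indicator_one hms, lintegral_hyp (measurable_one.indicator hms)]
    refine lintegral_congr fun x => ?_
    rw [Real.sq_sqrt (dotProduct_self_nonneg' x)]
    congr 1
    have : Real.sqrt (x ⬝ᵥ x) ≤ R ↔ x ⬝ᵥ x ≤ R ^ 2 := Real.sqrt_le_left hR
    simp only [Set.indicator, Set.mem_ofPred_eq, Set.mem_Iic, this, Pi.one_apply]
  rw [h1, hC _ hf]
  refine mul_le_mul_right ?_ C
  calc ∫⁻ r in Set.Ioi (0 : ℝ), ENNReal.ofReal (r ^ (m + 1)) *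
        (ENNReal.ofReal (1 / Real.sqrt (1 + r ^ 2)) * (Set.Iic R).indicator 1 r)
      ≤ ∫⁻ r in Set.Ioi (0 : ℝ), (Set.Iic R).indicator (fun _ => ENNReal.ofReal (R ^ m)) r := by
        refine setLIntegral_mono (measurable_const.indicator measurableSet_Iic) fun r hr => ?_
        have hr' : 0 < r := hr
        by_cases hrR : r ≤ R
        · rw [Set.indicator_of_mem (show r ∈ Set.Iic R from hrR),
            Set.indicator_of_mem (show r ∈ Set.Iic R from hrR), Pi.one_apply, mul_one,
            ← ENNReal.ofReal_mul (by positivity)]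
          refine ENNReal.ofReal_le_ofReal ?_
          have hs : r ≤ Real.sqrt (1 + r ^ 2) := Real.le_sqrt_of_sq_le (by linarith)
          have hs' : 0 < Real.sqrt (1 + r ^ 2) := hr'.trans_le hs
          rw [mul_one_div, div_le_iff₀ hs', pow_succ]
          exact mul_le_mul (pow_le_pow_left₀ hr'.le hrR m) hs hr'.le (by positivity)
        · rw [Set.indicator_of_notMem (show r ∉ Set.Iic R from hrR), mul_zero, mul_zero]
          exact zero_le
    _ = ENNReal.ofReal (R ^ (m + 1)) := by
        rw [lintegral_indicator measurableSet_Iic, Measure.restrict_restrict measurableSet_Iic,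
          setLIntegral_const, Set.Iic_inter_Ioi, Real.volume_Ioc, sub_zero,
          ← ENNReal.ofReal_mul (by positivity), pow_succ]

/-- Only the order of growth matters: this a priori bound is the input to Fatou's lemma in
`sublevel_asymptotics`. -/
lemma exists_measure_normBall_le {m : ℕ} (hm : m ≠ 0) (N : Seminorm ℝ (Mat (m + 1)))
    (hN : ∀ A, N A = 0 → A = 0) (μ : Measure (G (m + 1))) [μ.IsHaarMeasure]
    (κ : Measure (K (m + 1))) [κ.IsHaarMeasure] [IsProbabilityMeasure κ] :
    ∃ B : ℝ≥0∞, B ≠ ∞ ∧ ∀ᶠ T : ℝ in atTop,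
      μ (normBall N T) / ENNReal.ofReal (T ^ m) ≤ B := by
  obtain ⟨m, rfl⟩ := Nat.exists_eq_succ_of_ne_zero hm
  obtain ⟨c, -, rfl⟩ := exists_eq_smul_lam κ μ
  obtain ⟨C, hC, hCR⟩ := exists_hyp_ball_le m
  obtain ⟨D, hD, hDT⟩ := exists_normBall_subset N hN
  refine ⟨c * (C * ENNReal.ofReal (D ^ (m + 1))), ENNReal.mul_ne_top (by simp)
    (ENNReal.mul_ne_top hC ENNReal.ofReal_ne_top), ?_⟩
  filter_upwards [eventually_ge_atTop 0] with T hT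
  refine ENNReal.div_le_of_le_mul ?_
  have h1 : lam κ (normBall N T) ≤ C * ENNReal.ofReal ((D * T) ^ (m + 1)) := by
    refine (measure_mono (hDT T hT)).trans ?_
    rw [lam_preimage_row κ (isCompact_dotProduct_le _ _).measurableSet]
    exact hCR _ (by positivity)
  rw [Measure.smul_apply, mul_pow, ENNReal.ofReal_mul (by positivity)] at *
  calc c • lam κ (normBall N T) ≤ c • (C * (ENNReal.ofReal (D ^ (m + 1)) *
        ENNReal.ofReal (T ^ (m + 1)))) := by gcongr
    _ = _ := by
      rw [ENNReal.smul_def, smul_eq_mul]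
      simp only [mul_assoc]

/-! ### The limits of `a(s)` -/

/-- The rows of `a(∞)` are multiples of `e₁ + eₙ₊₁`, an eigenvector of `a(s)` with eigenvalue `e^s`.
This exact identity is what yields a lower bound uniform in `s`. -/
lemma aInf_mul_a (m : ℕ) (s : ℝ) : aInf (m + 1) * a (m + 1) s = Real.exp s • aInf (m + 1) := by
  have h1 := zero_ne_last m
  have h2 := h1.symm
  simp only [aInf, a, Matrix.mul_add, Matrix.add_mul, Matrix.smul_mul, Matrix.mul_smul,
    E, Matrix.single_mul_single_same, Matrix.single_mul_single_of_ne _ _ _ _ h1,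
    Matrix.single_mul_single_of_ne _ _ _ _ h2, mul_one, add_zero, zero_add]
  rw [← Real.cosh_add_sinh]
  module

lemma tendsto_exp_neg_mul_exp_neg :
    Tendsto (fun s : ℝ => Real.exp (-s) * Real.exp (-s)) atTop (𝓝 0) := by
  simpa using Real.tendsto_exp_neg_atTop_nhds_zero.mul Real.tendsto_exp_neg_atTop_nhds_zero

lemma tendsto_exp_neg_mul_cosh :
    Tendsto (fun s : ℝ => Real.exp (-s) * Real.cosh s) atTop (𝓝 (1 / 2)) := by
  have := (tendsto_const_nhds (x := (1 / 2 : ℝ))).add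
    (tendsto_exp_neg_mul_exp_neg.const_mul (1 / 2))
  rw [mul_zero, add_zero] at this
  refine this.congr fun s => ?_
  have h1 : Real.exp (-s) * Real.exp s = 1 := by rw [← Real.exp_add]; simp
  rw [Real.cosh_eq]
  linear_combination (-1 / 2) * h1

lemma tendsto_exp_neg_mul_sinh :
    Tendsto (fun s : ℝ => Real.exp (-s) * Real.sinh s) atTop (𝓝 (1 / 2)) := by
  have := (tendsto_const_nhds (x := (1 / 2 : ℝ))).sub
    (tendsto_exp_neg_mul_exp_neg.const_mul (1 / 2))
  rw [mul_zero, sub_zero] at this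
  refine this.congr fun s => ?_
  have h1 : Real.exp (-s) * Real.exp s = 1 := by rw [← Real.exp_add]; simp
  rw [Real.sinh_eq]
  linear_combination (-1 / 2) * h1

lemma tendsto_exp_neg_smul_a (n : ℕ) :
    Tendsto (fun s => Real.exp (-s) • a n s) atTop (𝓝 (aInf n)) := by
  have h0 : Tendsto (fun s : ℝ => Real.exp (-s)) atTop (𝓝 0) :=
    Real.tendsto_exp_neg_atTop_nhds_zero
  have hc := tendsto_exp_neg_mul_cosh.sub h0
  rw [sub_zero] at hc
  have hs := tendsto_exp_neg_mul_sinh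
  have h := ((h0.smul_const (1 : Mat n)).add
    (hc.smul_const (E 0 0 + E (Fin.last n) (Fin.last n) : Mat n))).add
    (hs.smul_const (E 0 (Fin.last n) + E (Fin.last n) 0 : Mat n))
  have hlim : (0 : ℝ) • (1 : Mat n) + (1 / 2 : ℝ) • (E 0 0 + E (Fin.last n) (Fin.last n)) +
      (1 / 2 : ℝ) • (E 0 (Fin.last n) + E (Fin.last n) 0) = aInf n := by
    rw [aInf]
    module
  rw [hlim] at h
  refine h.congr fun s => ?_
  rw [a]
  module

lemma aInf_ne_zero (n : ℕ) : aInf n ≠ 0 := by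
  intro h
  have h1 : aInf n 0 0 = 0 := by rw [h]; rfl
  simp only [aInf, Matrix.smul_apply, Matrix.add_apply, Matrix.single_apply, smul_eq_mul] at h1
  split_ifs at h1 <;> norm_num at h1
  all_goals tauto

lemma Jmat_mul_Jmat (n : ℕ) : Jmat n * Jmat n = 1 := by
  rw [Jmat, Matrix.diagonal_mul_diagonal, ← Matrix.diagonal_one]
  congr 1
  ext p
  split_ifs <;> norm_num

/-- Conjugation by `J` carries the statements about `a(∞)` over to `a(-∞)`; `J` itself has
determinant `-1` and is not in `G`. -/
lemma Jmat_mul_a_mul_Jmat (m : ℕ) (s : ℝ) :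
    Jmat (m + 1) * a (m + 1) s * Jmat (m + 1) = a (m + 1) (-s) := by
  have hl := zero_ne_last m
  ext p q
  simp only [Jmat, Matrix.mul_diagonal, Matrix.diagonal_mul, a, Matrix.add_apply,
    Matrix.smul_apply, Matrix.single_apply, smul_eq_mul, Real.cosh_neg, Real.sinh_neg,
    eq_comm (a := p) (b := 0), eq_comm (a := q) (b := 0)]
  by_cases hp : 0 = p
  · subst hp
    by_cases hq : 0 = q
    · subst hq
      simp [hl.symm]
    · simp [hl.symm, hq, Matrix.one_apply_ne hq]
  · by_cases hq : 0 = q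
    · subst hq
      simp [hl.symm, hp, Matrix.one_apply_ne (Ne.symm hp)]
      split_ifs <;> simp
    · simp [hp, hq]

lemma aNegInf_mul_a (m : ℕ) (s : ℝ) :
    aNegInf (m + 1) * a (m + 1) (-s) = Real.exp s • aNegInf (m + 1) := by
  rw [aNegInf, ← Jmat_mul_a_mul_Jmat]
  calc Jmat (m + 1) * aInf (m + 1) * Jmat (m + 1) * (Jmat (m + 1) * a (m + 1) s * Jmat (m + 1))
      = Jmat (m + 1) * (aInf (m + 1) * (Jmat (m + 1) * Jmat (m + 1)) * a (m + 1) s) *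
          Jmat (m + 1) := by simp only [Matrix.mul_assoc]
    _ = Real.exp s • (Jmat (m + 1) * aInf (m + 1) * Jmat (m + 1)) := by
      rw [Jmat_mul_Jmat, Matrix.mul_one, aInf_mul_a, Matrix.mul_smul, Matrix.smul_mul]

lemma tendsto_exp_neg_smul_a_neg (m : ℕ) :
    Tendsto (fun s => Real.exp (-s) • a (m + 1) (-s)) atTop (𝓝 (aNegInf (m + 1))) := by
  have hc : Continuous fun A : Mat (m + 1) => Jmat (m + 1) * A * Jmat (m + 1) :=
    (continuous_const.matrix_mul continuous_id).matrix_mul continuous_const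
  refine ((hc.tendsto _).comp (tendsto_exp_neg_smul_a (m + 1))).congr fun s => ?_
  rw [Function.comp_apply, Matrix.mul_smul, Matrix.smul_mul, Jmat_mul_a_mul_Jmat]

lemma aNegInf_ne_zero (n : ℕ) : aNegInf n ≠ 0 := by
  intro h
  apply aInf_ne_zero n
  have h1 : Jmat n * aNegInf n * Jmat n = aInf n := by
    rw [aNegInf]
    calc Jmat n * (Jmat n * aInf n * Jmat n) * Jmat n
        = (Jmat n * Jmat n) * aInf n * (Jmat n * Jmat n) := by simp only [Matrix.mul_assoc]
      _ = aInf n := by rw [Jmat_mul_Jmat, Matrix.mul_one, Matrix.one_mul]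
  rw [← h1, h, Matrix.mul_zero, Matrix.zero_mul]

/-! ### Asymptotics for families of translates -/

lemma mat_mul_mat_inv {n : ℕ} {S : Subgroup (SpecialLinearGroup (Fin (n + 1)) ℝ)} (g : S) :
    mat g * mat g⁻¹ = 1 := by
  rw [← mat_mul, mul_inv_cancel, mat_one]

lemma mat_inv_mul_mat {n : ℕ} {S : Subgroup (SpecialLinearGroup (Fin (n + 1)) ℝ)} (g : S) :
    mat g⁻¹ * mat g = 1 := by
  rw [← mat_mul, inv_mul_cancel, mat_one]

lemma mat_mul_mul_mat_ne_zero {n : ℕ} {S S' : Subgroup (SpecialLinearGroup (Fin (n + 1)) ℝ)}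
    (g : S) (g' : S') {A : Mat n} (hA : A ≠ 0) : mat g * A * mat g' ≠ 0 := by
  intro h
  apply hA
  calc A = (mat g⁻¹ * mat g) * A * (mat g' * mat g'⁻¹) := by
        rw [mat_inv_mul_mat, mat_mul_mat_inv, Matrix.one_mul, Matrix.mul_one]
    _ = mat g⁻¹ * (mat g * A * mat g') * mat g'⁻¹ := by simp only [Matrix.mul_assoc]
    _ = 0 := by rw [h, Matrix.mul_zero, Matrix.zero_mul]

/-- Left multiplication by `k α' k⁻¹` sends `k α(s) B` to `e^s k α' B`. These multipliers are
bounded because `K` is compact. -/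
lemma exists_mul_exp_le {n : ℕ} (N : Seminorm ℝ (Mat n)) (hN : ∀ A, N A = 0 → A = 0)
    {α : ℝ → Mat n} {α' : Mat n} (hα : ∀ s, α' * α s = Real.exp s • α') :
    ∃ c : ℝ, 0 < c ∧ ∀ (k : K n) (s : ℝ) (B : Mat n),
      c * (Real.exp s * N (mat k * α' * B)) ≤ N (mat k * α s * B) := by
  obtain ⟨C₁, hC₁, h₁⟩ := exists_seminorm_le N
  obtain ⟨C₂, hC₂, h₂⟩ := exists_entrySum_le N hN
  have hcont : Continuous fun k : K n => entrySum (mat k * α' * mat k⁻¹) :=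
    (continuous_entrySum n).comp ((continuous_mat.matrix_mul continuous_const).matrix_mul
      (continuous_mat.comp continuous_inv))
  obtain ⟨D, hD⟩ := (isCompact_range hcont).bddAbove
  have hD' : ∀ k : K n, entrySum (mat k * α' * mat k⁻¹) ≤ D := fun k => hD ⟨k, rfl⟩
  have hD0 : 0 ≤ D := (entrySum_nonneg _).trans (hD' 1)
  -- `D` is only known to be nonnegative; `D + 1` makes the constant positive.
  refine ⟨(C₁ * (D + 1) * C₂)⁻¹, by positivity, fun k s B => ?_⟩
  rw [← div_eq_inv_mul, div_le_iff₀ (by positivity)]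
  have hprod : mat k * α' * mat k⁻¹ * (mat k * α s * B) = Real.exp s • (mat k * α' * B) := by
    calc mat k * α' * mat k⁻¹ * (mat k * α s * B)
        = mat k * (α' * (mat k⁻¹ * mat k) * α s) * B := by simp only [Matrix.mul_assoc]
      _ = Real.exp s • (mat k * α' * B) := by
        rw [mat_inv_mul_mat, Matrix.mul_one, hα, Matrix.mul_smul, Matrix.smul_mul]
  calc Real.exp s * N (mat k * α' * B) = N (mat k * α' * mat k⁻¹ * (mat k * α s * B)) := by
        rw [hprod, map_smul_eq_mul, Real.norm_eq_abs, abs_of_pos (Real.exp_pos s)]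
    _ ≤ C₁ * entrySum (mat k * α' * mat k⁻¹ * (mat k * α s * B)) := h₁ _
    _ ≤ C₁ * (entrySum (mat k * α' * mat k⁻¹) * entrySum (mat k * α s * B)) := by
        gcongr
        exact entrySum_mul_le _ _
    _ ≤ C₁ * ((D + 1) * (C₂ * N (mat k * α s * B))) := by
        have h3 := h₂ (mat k * α s * B)
        have h4 : entrySum (mat k * α' * mat k⁻¹) ≤ D + 1 := (hD' k).trans (by linarith)
        have h5 := entrySum_nonneg (mat k * α s * B)
        gcongr
    _ = N (mat k * α s * B) * (C₁ * (D + 1) * C₂) := by ring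

/-- Common to all cases: `α` is `a(s)` or `a(-s)`, and `β` embeds the last factor in `G`. The limit
`L` is positive because `α' ≠ 0` is multiplied by invertible matrices. -/
lemma family_asymptotics {n d : ℕ} (hd : d ≠ 0) (N : Seminorm ℝ (Mat n))
    (hN : ∀ A, N A = 0 → A = 0) (κ : Measure (K n)) [SFinite κ] {Y : Type*} [TopologicalSpace Y]
    [SecondCountableTopology Y] [MeasurableSpace Y] [OpensMeasurableSpace Y] (ν : Measure Y)
    [SFinite ν] {β : Y → G n} (hβ : Continuous β) {α : ℝ → Mat n} (hαc : Continuous α)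
    {α' : Mat n} (hα' : α' ≠ 0) (hα : ∀ s, α' * α s = Real.exp s • α')
    (hαlim : Tendsto (fun s => Real.exp (-s) • α s) atTop (𝓝 α'))
    {w : ℝ → ℝ} (hwm : Measurable w) (hw : ∀ s, w s ≤ Real.exp (d * s)) {W : ℝ} (hW : 0 < W)
    (hwW : Tendsto (fun s => Real.exp (-(d * s)) * w s) atTop (𝓝 W))
    {B : ℝ≥0∞} (hB : B ≠ ∞)
    (hV : ∀ᶠ T : ℝ in atTop, (∫⁻ k, ∫⁻ y, ∫⁻ s, (Set.Iic T).indicator 1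
      (N (mat k * α s * mat (β y))) * ENNReal.ofReal (w s) ∂volume ∂ν ∂κ) /
        ENNReal.ofReal (T ^ d) ≤ B) :
    Integrable (fun p : K n × Y => 1 / N (mat p.1 * α' * mat (β p.2)) ^ d) (κ.prod ν) ∧
      Tendsto (fun T : ℝ => (∫⁻ k, ∫⁻ y, ∫⁻ s, (Set.Iic T).indicator 1
        (N (mat k * α s * mat (β y))) * ENNReal.ofReal (w s) ∂volume ∂ν ∂κ) /
          ENNReal.ofReal (T ^ d)) atTop
        (𝓝 (ENNReal.ofReal (W / d *
          ∫ k, ∫ y, 1 / N (mat k * α' * mat (β y)) ^ d ∂ν ∂κ))) := by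
  have hNc := continuous_seminorm N
  have hk : Continuous fun p : K n × Y => mat p.1 := continuous_mat.comp continuous_fst
  have hb : Continuous fun p : K n × Y => mat (β p.2) :=
    continuous_mat.comp (hβ.comp continuous_snd)
  have hMc : Continuous fun p : (K n × Y) × ℝ => N (mat p.1.1 * α p.2 * mat (β p.1.2)) :=
    hNc.comp (((hk.comp continuous_fst).matrix_mul (hαc.comp continuous_snd)).matrix_mul
      (hb.comp continuous_fst))
  have hLc : Continuous fun p : K n × Y => N (mat p.1 * α' * mat (β p.2)) :=
    hNc.comp ((hk.matrix_mul continuous_const).matrix_mul hb)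
  obtain ⟨c, hc, hcM⟩ := exists_mul_exp_le N hN hα
  have htriple : ∀ T : ℝ, ∫⁻ k, ∫⁻ y, ∫⁻ s, (Set.Iic T).indicator 1
      (N (mat k * α s * mat (β y))) * ENNReal.ofReal (w s) ∂volume ∂ν ∂κ =
      ∫⁻ p : K n × Y, ∫⁻ s, (Set.Iic T).indicator 1
        (N (mat p.1 * α s * mat (β p.2))) * ENNReal.ofReal (w s) ∂volume ∂(κ.prod ν) := by
    intro T
    have h1 : Measurable fun p : (K n × Y) × ℝ => (Set.Iic T).indicator (1 : ℝ → ℝ≥0∞)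
        (N (mat p.1.1 * α p.2 * mat (β p.1.2))) * ENNReal.ofReal (w p.2) :=
      ((measurable_one.indicator measurableSet_Iic).comp hMc.measurable).mul
        (hwm.comp measurable_snd).ennreal_ofReal
    have h2 : Measurable fun p : K n × Y => ∫⁻ s, (Set.Iic T).indicator (1 : ℝ → ℝ≥0∞)
        (N (mat p.1 * α s * mat (β p.2))) * ENNReal.ofReal (w s) := h1.lintegral_prod_right'
    rw [lintegral_prod _ h2.aemeasurable]
  simp only [htriple] at hV ⊢
  obtain ⟨hint, hlim⟩ := sublevel_asymptotics (κ.prod ν) hd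
    (M := fun p s => N (mat p.1 * α s * mat (β p.2))) hMc.measurable
    (L := fun p => N (mat p.1 * α' * mat (β p.2))) hLc.measurable
    (fun p => lt_of_le_of_ne (apply_nonneg N _) fun h =>
      mat_mul_mul_mat_ne_zero p.1 (β p.2) hα' (hN _ h.symm)) hc
    (fun p s => hcM p.1 s _)
    (fun p => by
      have hcont : Continuous fun A : Mat n => N (mat p.1 * A * mat (β p.2)) :=
        hNc.comp ((continuous_const.matrix_mul continuous_id).matrix_mul continuous_const)
      refine ((hcont.tendsto _).comp hαlim).congr fun s => ?_
      rw [Function.comp_apply, Matrix.mul_smul, Matrix.smul_mul, map_smul_eq_mul,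
        Real.norm_eq_abs, abs_of_pos (Real.exp_pos _)])
    hwm hw hW hwW hB hV
  refine ⟨hint, ?_⟩
  rw [integral_prod _ hint] at hlim
  exact hlim

/-! ### Weights -/

lemma setLIntegral_mul_ofReal {S : Set ℝ} (hS : MeasurableSet S) (f : ℝ → ℝ≥0∞) (w : ℝ → ℝ) :
    ∫⁻ s in S, f s * ENNReal.ofReal (w s) = ∫⁻ s, f s * ENNReal.ofReal (S.indicator w s) := by
  rw [← lintegral_indicator hS]
  refine lintegral_congr fun s => ?_
  by_cases hs : s ∈ S <;> simp [hs]

lemma measurable_weight (i j : ℕ) :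
    Measurable ((Set.Ioi (0 : ℝ)).indicator fun s => Real.sinh s ^ i * Real.cosh s ^ j) :=
  (by fun_prop : Measurable fun s : ℝ => Real.sinh s ^ i * Real.cosh s ^ j).indicator
    measurableSet_Ioi

/-- For `s > 0` both `sinh s` and `cosh s` are at most their sum `e^s`; elsewhere the weight
vanishes. -/
lemma weight_le {i j d : ℕ} (hd : i + j = d) (s : ℝ) :
    (Set.Ioi (0 : ℝ)).indicator (fun s => Real.sinh s ^ i * Real.cosh s ^ j) s ≤
      Real.exp (d * s) := by
  by_cases hs : s ∈ Set.Ioi (0 : ℝ)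
  · have hs0 : 0 < s := hs
    have h1 := Real.sinh_pos_iff.2 hs0
    have h2 := Real.cosh_pos s
    have h3 := Real.cosh_add_sinh s
    rw [Set.indicator_of_mem hs, Real.exp_nat_mul, ← hd, pow_add]
    exact mul_le_mul (pow_le_pow_left₀ h1.le (by linarith) i) (pow_le_pow_left₀ h2.le (by linarith) j)
      (by positivity) (by positivity)
  · rw [Set.indicator_of_notMem hs]
    exact (Real.exp_pos _).le

/-- Each of the `d` factors contributes `1/2`, the source of `2^{n-1}` in the constant. -/
lemma tendsto_weight {i j d : ℕ} (hd : i + j = d) :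
    Tendsto (fun s : ℝ => Real.exp (-(d * s)) *
      (Set.Ioi (0 : ℝ)).indicator (fun s => Real.sinh s ^ i * Real.cosh s ^ j) s) atTop
      (𝓝 ((1 / 2) ^ d)) := by
  have h := (tendsto_exp_neg_mul_sinh.pow i).mul (tendsto_exp_neg_mul_cosh.pow j)
  rw [← pow_add, hd] at h
  refine h.congr' ((eventually_gt_atTop 0).mono fun s hs => ?_)
  beta_reduce
  rw [Set.indicator_of_mem (show s ∈ Set.Ioi (0 : ℝ) from hs), ← mul_neg, Real.exp_nat_mul, ← hd,
    pow_add, mul_pow, mul_pow]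
  ring

/-! ### Asymptotic volume -/

lemma measurable_indicator_seminorm {n : ℕ} (N : Seminorm ℝ (Mat n)) (T : ℝ) :
    Measurable fun A : Mat n => (Set.Iic T).indicator (1 : ℝ → ℝ≥0∞) (N A) :=
  (measurable_one.indicator measurableSet_Iic).comp (continuous_seminorm N).measurable

lemma lintegral_indicator_seminorm {n : ℕ} (N : Seminorm ℝ (Mat n)) (μ : Measure (G n)) (T : ℝ) :
    ∫⁻ g, (Set.Iic T).indicator 1 (N (mat g)) ∂μ = μ (normBall N T) := by
  have hms : MeasurableSet (normBall N T) :=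
    (isClosed_le ((continuous_seminorm N).comp continuous_mat) continuous_const).measurableSet
  rw [← lintegral_indicator_one hms]
  rfl

lemma tendsto_measureReal_div {X : Type*} [MeasurableSpace X] {μ : Measure X} {S : ℝ → Set X}
    {d : ℕ} {c : ℝ} (hc : 0 ≤ c)
    (h : Tendsto (fun T : ℝ => μ (S T) / ENNReal.ofReal (T ^ d)) atTop (𝓝 (ENNReal.ofReal c))) :
    Tendsto (fun T : ℝ => μ.real (S T) / T ^ d) atTop (𝓝 c) := by
  have h1 := (ENNReal.tendsto_toReal ENNReal.ofReal_ne_top).comp h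
  rw [ENNReal.toReal_ofReal hc] at h1
  refine h1.congr' ((eventually_ge_atTop 0).mono fun T hT => ?_)
  rw [Function.comp_apply, ENNReal.toReal_div, ENNReal.toReal_ofReal (pow_nonneg hT d)]
  rfl

lemma integral_integral_one_div_nonneg {n d : ℕ} (N : Seminorm ℝ (Mat n)) {X Y : Type*}
    [MeasurableSpace X] [MeasurableSpace Y] (κ : Measure X) (ν : Measure Y) (A : X → Y → Mat n) :
    0 ≤ ∫ x, ∫ y, 1 / N (A x y) ^ d ∂ν ∂κ :=
  integral_nonneg fun _ => integral_nonneg fun _ =>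
    one_div_nonneg.2 (pow_nonneg (apply_nonneg N _) d)

/-- The weight is exactly `e^{ms}`, so `W = 1` and no power of two appears. -/
lemma asymptotics_of_decompU {m : ℕ} (hm : m ≠ 0) (N : Seminorm ℝ (Mat (m + 1)))
    (hN : ∀ A, N A = 0 → A = 0) (μ : Measure (G (m + 1))) [μ.IsHaarMeasure]
    (κ : Measure (K (m + 1))) [κ.IsHaarMeasure] [IsProbabilityMeasure κ]
    (ν : Measure (EuclideanSpace ℝ (Fin m))) [ν.IsAddHaarMeasure]
    (h : DecompU (n := m + 1) μ κ ν) :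
    Integrable (fun p : K (m + 1) × EuclideanSpace ℝ (Fin m) =>
        1 / N (mat p.1 * aInf (m + 1) * u (m + 1) p.2) ^ m) (κ.prod ν) ∧
      Tendsto (fun T : ℝ => μ.real (normBall N T) / T ^ m) atTop
        (𝓝 (1 / m * ∫ k, ∫ x, 1 / N (mat k * aInf (m + 1) * u (m + 1) x) ^ m ∂ν ∂κ)) := by
  obtain ⟨B, hB, hV⟩ := exists_measure_normBall_le hm N hN μ κ
  have hexp : ∀ s : ℝ, Real.exp (((m + 1 : ℕ) - 1 : ℝ) * s) = Real.exp (m * s) := by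
    intro s; push_cast; ring_nf
  have hμ : ∀ T, μ (normBall N T) = ∫⁻ k, ∫⁻ x, ∫⁻ s, (Set.Iic T).indicator 1
      (N (mat k * a (m + 1) s * mat (uG x))) * ENNReal.ofReal (Real.exp (m * s))
        ∂volume ∂ν ∂κ := by
    intro T
    have := h _ (measurable_indicator_seminorm N T)
    rw [lintegral_indicator_seminorm] at this
    simp only [hexp] at this
    simp only [mat_uG]
    exact this
  simp only [hμ] at hV
  obtain ⟨hint, hlim⟩ := family_asymptotics hm N hN κ ν (continuous_uG m) (continuous_a m)
    (aInf_ne_zero _) (aInf_mul_a m) (tendsto_exp_neg_smul_a _)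
    (by fun_prop : Measurable fun s : ℝ => Real.exp (m * s)) (fun s => le_rfl) one_pos
    (tendsto_const_nhds.congr fun s => by rw [← Real.exp_add, neg_add_cancel, Real.exp_zero]) hB hV
  simp only [← hμ] at hlim
  simp only [mat_uG] at hint hlim
  exact ⟨hint, tendsto_measureReal_div
    (mul_nonneg (by positivity) (integral_integral_one_div_nonneg N κ ν _)) hlim⟩

lemma asymptotics_of_decompPos {m i j : ℕ} (hm : m ≠ 0) (h : i + j + 1 = m + 1)
    (N : Seminorm ℝ (Mat (m + 1))) (hN : ∀ A, N A = 0 → A = 0) (μ : Measure (G (m + 1)))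
    [μ.IsHaarMeasure] (κ : Measure (K (m + 1))) [κ.IsHaarMeasure] [IsProbabilityMeasure κ]
    (ν : Measure (H h)) [ν.IsHaarMeasure] (hD : DecompPos h μ κ ν) :
    Integrable (fun p : K (m + 1) × H h =>
        1 / N (mat p.1 * aInf (m + 1) * mat p.2) ^ m) (κ.prod ν) ∧
      Tendsto (fun T : ℝ => μ.real (normBall N T) / T ^ m) atTop
        (𝓝 (1 / (m * 2 ^ m) *
          ∫ k, ∫ b, 1 / N (mat k * aInf (m + 1) * mat b) ^ m ∂ν ∂κ)) := by
  obtain ⟨B, hB, hV⟩ := exists_measure_normBall_le hm N hN μ κ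
  have hij : i + j = m := by omega
  have hμ : ∀ T, μ (normBall N T) = ∫⁻ k, ∫⁻ b, ∫⁻ s, (Set.Iic T).indicator 1
      (N (mat k * a (m + 1) s * mat (inclH h b))) * ENNReal.ofReal ((Set.Ioi (0 : ℝ)).indicator
        (fun s => Real.sinh s ^ i * Real.cosh s ^ j) s) ∂volume ∂ν ∂κ := by
    intro T
    have := hD _ (measurable_indicator_seminorm N T)
    rw [lintegral_indicator_seminorm] at this
    simp only [setLIntegral_mul_ofReal measurableSet_Ioi] at this
    exact this
  simp only [hμ] at hV
  obtain ⟨hint, hlim⟩ := family_asymptotics hm N hN κ ν (continuous_inclH h) (continuous_a m)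
    (aInf_ne_zero _) (aInf_mul_a m) (tendsto_exp_neg_smul_a _) (measurable_weight i j)
    (weight_le hij) (by positivity) (tendsto_weight hij) hB hV
  simp only [← hμ] at hlim
  refine ⟨hint, ?_⟩
  have hc : (1 / 2 : ℝ) ^ m / m = 1 / (m * 2 ^ m) := by
    rw [div_pow, one_pow, div_div, mul_comm]
  rw [hc] at hlim
  exact tendsto_measureReal_div
    (mul_nonneg (by positivity) (integral_integral_one_div_nonneg N κ ν _)) hlim

lemma asymptotics_of_decompZero {m j : ℕ} (hm : m ≠ 0) (h : 0 + j + 1 = m + 1)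
    (N : Seminorm ℝ (Mat (m + 1))) (hN : ∀ A, N A = 0 → A = 0) (μ : Measure (G (m + 1)))
    [μ.IsHaarMeasure] (κ : Measure (K (m + 1))) [κ.IsHaarMeasure] [IsProbabilityMeasure κ]
    (ν : Measure (H h)) [ν.IsHaarMeasure] (hD : DecompZero h μ κ ν) :
    Integrable (fun p : K (m + 1) × H h =>
        1 / N (mat p.1 * aInf (m + 1) * mat p.2) ^ m +
        1 / N (mat p.1 * aNegInf (m + 1) * mat p.2) ^ m) (κ.prod ν) ∧
      Tendsto (fun T : ℝ => μ.real (normBall N T) / T ^ m) atTop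
        (𝓝 (1 / (m * 2 ^ m) *
          ∫ k, ∫ b, (1 / N (mat k * aInf (m + 1) * mat b) ^ m +
            1 / N (mat k * aNegInf (m + 1) * mat b) ^ m) ∂ν ∂κ)) := by
  obtain ⟨B, hB, hV⟩ := exists_measure_normBall_le hm N hN μ κ
  have hj : m + 1 - 1 = j := by omega
  have hij : 0 + j = m := by omega
  set w : ℝ → ℝ := (Set.Ioi (0 : ℝ)).indicator (fun s => Real.sinh s ^ 0 * Real.cosh s ^ j)
  have hwm : Measurable w := measurable_weight 0 j
  set V₁ : ℝ → ℝ≥0∞ := fun T => ∫⁻ k, ∫⁻ b, ∫⁻ s, (Set.Iic T).indicator 1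
      (N (mat k * a (m + 1) s * mat (inclH h b))) * ENNReal.ofReal (w s) ∂volume ∂ν ∂κ with hV₁
  set V₂ : ℝ → ℝ≥0∞ := fun T => ∫⁻ k, ∫⁻ b, ∫⁻ s, (Set.Iic T).indicator 1
      (N (mat k * a (m + 1) (-s) * mat (inclH h b))) * ENNReal.ofReal (w s) ∂volume ∂ν ∂κ with hV₂
  have hμ : ∀ T, μ (normBall N T) = V₁ T + V₂ T := by
    intro T
    have h1 := hD _ (measurable_indicator_seminorm N T)
    rw [lintegral_indicator_seminorm] at h1
    have hpow : ∀ s : ℝ, Real.cosh s ^ (m + 1 - 1) = Real.sinh s ^ 0 * Real.cosh s ^ j := by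
      intro s
      rw [hj, pow_zero, one_mul]
    simp only [hpow, setLIntegral_mul_ofReal measurableSet_Ioi,
      Matrix.mul_assoc _ (a (m + 1) _) (wMat (m + 1))] at h1
    rw [lintegral_add_mul_triple κ ν volume
      (F := fun k b s => (Set.Iic T).indicator 1 (N (mat k * a (m + 1) s * mat b)))
      (F' := fun k b s => (Set.Iic T).indicator 1
        (N (mat k * (a (m + 1) s * wMat (m + 1)) * mat b)))
      (measurable_comp_mul continuous_mat (continuous_a m) continuous_mat
        (measurable_indicator_seminorm N T))
      (measurable_comp_mul continuous_mat ((continuous_a m).matrix_mul continuous_const)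
        continuous_mat (measurable_indicator_seminorm N T)) hwm.ennreal_ofReal] at h1
    rw [h1, hV₁, hV₂]
    congr 1
    -- Since `k a(s) w h = (k w) a(-s) h`, right translation by `w` in `K` removes it.
    refine Eq.trans ?_ (lintegral_mul_right_eq_self _ (wK hm))
    refine lintegral_congr fun k => lintegral_congr fun b => lintegral_congr fun s => ?_
    rw [mat_mul, mat_wK, a_mul_wMat hm, mat_inclH, ← Matrix.mul_assoc]
  -- Each of the two parts is at most the whole volume, so the a priori bound serves both.
  have hb₁ : ∀ᶠ T : ℝ in atTop, V₁ T / ENNReal.ofReal (T ^ m) ≤ B := hV.mono fun T hT =>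
    (ENNReal.div_le_div_right (by rw [hμ]; exact le_self_add) _).trans hT
  have hb₂ : ∀ᶠ T : ℝ in atTop, V₂ T / ENNReal.ofReal (T ^ m) ≤ B := hV.mono fun T hT =>
    (ENNReal.div_le_div_right (by rw [hμ]; exact le_add_self) _).trans hT
  obtain ⟨hint₁, hlim₁⟩ := family_asymptotics hm N hN κ ν (continuous_inclH h) (continuous_a m)
    (aInf_ne_zero _) (aInf_mul_a m) (tendsto_exp_neg_smul_a _) hwm
    (weight_le hij) (by positivity) (tendsto_weight hij) hB hb₁
  obtain ⟨hint₂, hlim₂⟩ := family_asymptotics hm N hN κ ν (continuous_inclH h)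
    ((continuous_a m).comp continuous_neg) (aNegInf_ne_zero _) (aNegInf_mul_a m)
    (tendsto_exp_neg_smul_a_neg _) hwm
    (weight_le hij) (by positivity) (tendsto_weight hij) hB hb₂
  simp only [mat_inclH] at hint₁ hint₂
  have hint := hint₁.add hint₂
  refine ⟨hint, ?_⟩
  have hc : (1 / 2 : ℝ) ^ m / m = 1 / (m * 2 ^ m) := by
    rw [div_pow, one_pow, div_div, mul_comm]
  have hsum : ∫ k, ∫ b, (1 / N (mat k * aInf (m + 1) * mat b) ^ m +
      1 / N (mat k * aNegInf (m + 1) * mat b) ^ m) ∂ν ∂κ =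
      ∫ k, ∫ b, 1 / N (mat k * aInf (m + 1) * mat b) ^ m ∂ν ∂κ +
      ∫ k, ∫ b, 1 / N (mat k * aNegInf (m + 1) * mat b) ^ m ∂ν ∂κ := by
    have e1 := integral_prod _ hint
    have e2 := integral_prod _ hint₁
    have e3 := integral_prod _ hint₂
    have e4 := integral_add hint₁ hint₂
    exact e1.symm.trans (e4.trans (congrArg₂ (· + ·) e2 e3))
  have hlim := hlim₁.add hlim₂
  have hn₁ := integral_integral_one_div_nonneg (d := m) N κ ν
    (fun k (b : H h) => mat k * aInf (m + 1) * mat b)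
  have hn₂ := integral_integral_one_div_nonneg (d := m) N κ ν
    (fun k (b : H h) => mat k * aNegInf (m + 1) * mat b)
  have hpos : (0 : ℝ) ≤ 1 / (m * 2 ^ m) := by positivity
  rw [hc] at hlim
  simp only [mat_inclH] at hlim
  rw [← ENNReal.ofReal_add (mul_nonneg hpos hn₁) (mul_nonneg hpos hn₂), ← mul_add, ← hsum] at hlim
  refine tendsto_measureReal_div ?_ (hlim.congr fun T => ?_)
  · rw [hsum]
    exact mul_nonneg hpos (add_nonneg hn₁ hn₂)
  · rw [hμ, ENNReal.add_div]
    rfl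

end HypVol

end

/-! ### The volume theorem -/

theorem mainTheorem8 (n : ℕ) (hn : 2 ≤ n)
    (N : Seminorm ℝ (HypVol.Mat n)) (hN : ∀ A, N A = 0 → A = 0)
    (μ : Measure (HypVol.G n)) [μ.IsHaarMeasure]
    (κ : Measure (HypVol.K n)) [κ.IsHaarMeasure] [IsProbabilityMeasure κ] :
    (∀ T : ℝ, μ (HypVol.normBall N T) < ∞) ∧
    -- `H = H_{0,n-1}`
    (∀ (i j : ℕ) (h : i + j + 1 = n), i = 0 →
      (∃ ν : Measure (HypVol.H h), ν.IsHaarMeasure ∧ HypVol.DecompZero h μ κ ν) ∧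
      ∀ ν : Measure (HypVol.H h), ν.IsHaarMeasure → HypVol.DecompZero h μ κ ν →
        Integrable (fun p : HypVol.K n × HypVol.H h =>
          1 / N (HypVol.mat p.1 * HypVol.aInf n * HypVol.mat p.2) ^ (n - 1) +
          1 / N (HypVol.mat p.1 * HypVol.aNegInf n * HypVol.mat p.2) ^ (n - 1)) (κ.prod ν) ∧
        Tendsto (fun T : ℝ => μ.real (HypVol.normBall N T) / T ^ (n - 1)) atTop
          (𝓝 (1 / (((n : ℝ) - 1) * 2 ^ (n - 1)) *
            ∫ k, ∫ b,
              (1 / N (HypVol.mat k * HypVol.aInf n * HypVol.mat b) ^ (n - 1) +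
               1 / N (HypVol.mat k * HypVol.aNegInf n * HypVol.mat b) ^ (n - 1)) ∂ν ∂κ))) ∧
    -- `H = H_{i,j}` with `i ≠ 0`
    (∀ (i j : ℕ) (h : i + j + 1 = n), i ≠ 0 →
      (∃ ν : Measure (HypVol.H h), ν.IsHaarMeasure ∧ HypVol.DecompPos h μ κ ν) ∧
      ∀ ν : Measure (HypVol.H h), ν.IsHaarMeasure → HypVol.DecompPos h μ κ ν →
        Integrable (fun p : HypVol.K n × HypVol.H h =>
          1 / N (HypVol.mat p.1 * HypVol.aInf n * HypVol.mat p.2) ^ (n - 1)) (κ.prod ν) ∧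
        Tendsto (fun T : ℝ => μ.real (HypVol.normBall N T) / T ^ (n - 1)) atTop
          (𝓝 (1 / (((n : ℝ) - 1) * 2 ^ (n - 1)) *
            ∫ k, ∫ b,
              1 / N (HypVol.mat k * HypVol.aInf n * HypVol.mat b) ^ (n - 1) ∂ν ∂κ))) ∧
    -- `H = U`
    ((∃ ν : Measure (EuclideanSpace ℝ (Fin (n - 1))),
        ν.IsAddHaarMeasure ∧ HypVol.DecompU μ κ ν) ∧
      ∀ ν : Measure (EuclideanSpace ℝ (Fin (n - 1))),
        ν.IsAddHaarMeasure → HypVol.DecompU μ κ ν →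
        Integrable (fun p : HypVol.K n × EuclideanSpace ℝ (Fin (n - 1)) =>
          1 / N (HypVol.mat p.1 * HypVol.aInf n * HypVol.u n p.2) ^ (n - 1)) (κ.prod ν) ∧
        Tendsto (fun T : ℝ => μ.real (HypVol.normBall N T) / T ^ (n - 1)) atTop
          (𝓝 (1 / ((n : ℝ) - 1) *
            ∫ k, ∫ x,
              1 / N (HypVol.mat k * HypVol.aInf n * HypVol.u n x) ^ (n - 1) ∂ν ∂κ))) := by
  -- With `n = m + 1` the exponent `n - 1` becomes `m`, which is nonzero because `n ≥ 2`.
  obtain ⟨m, rfl⟩ : ∃ m, n = m + 1 := ⟨n - 1, by omega⟩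
  have hm : m ≠ 0 := by omega
  have hcast : (((m + 1 : ℕ) : ℝ) - 1) = m := by push_cast; ring
  rw [hcast]
  refine ⟨HypVol.measure_normBall_lt_top N hN μ, ?_, ?_,
    HypVol.exists_haar_decompU μ κ, fun ν _ hD =>
      HypVol.asymptotics_of_decompU hm N hN μ κ ν hD⟩
  · rintro i j h rfl
    exact ⟨HypVol.exists_haar_decompZero hm h μ κ, fun ν _ hD =>
      HypVol.asymptotics_of_decompZero hm h N hN μ κ ν hD⟩
  · intro i j h hi
    exact ⟨HypVol.exists_haar_decompPos h hi μ κ, fun ν _ hD =>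
      HypVol.asymptotics_of_decompPos hm h N hN μ κ ν hD⟩
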